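/- Let $n\ge 1$ and $m\in\{0,\dots,n+1\}$. Put $I_1^m=\{2,\dots,n\}\cap\{2,\dots,n-m+1\}$, $I_2^m=\{2,\dots,n\}\setminus I_1^m$, $\kappa_1=\left[\frac{n+3-m}{2}\right]$, $\kappa_2=\left[\frac m2\right]$, and let $t=(t_1,\dots,t_n)\in\mathbb R^n$. **Deformation functions.** Let $d_0,\dots,d_{n+1}$ and $e$ be smooth real functions of $t$, and let $\zeta_{r,j}(t_1,\dots,t_{r-1})$ ($r\in I_1^m$, $r>\kappa_1$, $1\le j\le r$) and $\zeta_{r,r+j}(t_{r+1},\dots,t_n)$ ($r\in I_2^m$, $r\le n-\kappa_2$, $0\le j\le n-r$) be smooth functions with $\zeta_{r,r}=1$, such that for $\gamma=0,\dots,n+1$: * if $r\in\{1\}\cup I_1^m$ and $m\le\gamma\le m+r-1$, then $\frac{\partial d_\gamma}{\partial t_r}=(\gamma-m+1)\,d_{n-m+2+\gamma-r}$ when $r\le\kappa_1$, and $\frac{\partial d_\gamma}{\partial t_r}=(\gamma-m+1)\sum_{j=\gamma-m+1}^{r}\zeta_{r,j}\,d_{n-m+2+\gamma-j}$ when $r>\kappa_1$;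 * if $r\in I_2^m$ and $r-(n-m+2)\le\gamma\le m-2$, then $\frac{\partial d_\gamma}{\partial t_r}=-(\gamma-m+1)\sum_{j=0}^{n-m+2+\gamma-r}\zeta_{r,r+j}\,d_{n-m+2+\gamma-r-j}$ when $r\le n-\kappa_2$, and $\frac{\partial d_\gamma}{\partial t_r}=-(\gamma-m+1)\,d_{n-m+2+\gamma-r}$ when $r>n-\kappa_2$; * $\frac{\partial d_\gamma}{\partial t_r}=0$ for all other pairs $(\gamma,r)$ with $1\le r\le n$; * $\frac{\partial e}{\partial t_r}=0$ for all $r$ if $m\le n$, and $\frac{\partial e}{\partial t_r}=e\,\delta_{1,r}$ if $m=n+1$. **Hamiltonians.** On the phase space of points $\xi=(\lambda,\mu)=(\lambda_1,\dots,\lambda_n,\mu_1,\dots,\mu_n)$ with pairwise distinct $\lambda_i$ (all of them nonzero if $m\ge1$), with canonical Poisson bracket $\{\lambda_i,\mu_j\}=\delta_{ij}$, $\{\lambda_i,\lambda_j\}=\{\mu_i,\mu_j\}=0$, let $$\Phi(x,y,t)=\tfrac12x^my^2-\varphi(x,t)\,y-e(t)x^n,\qquad \varphi(x,t)=\sum_{\gamma=0}^{n+1}d_\gamma(t)x^\gamma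 ,$$ and let $h_1,\dots,h_n$ be the solution of the linear system $\sum_{r=1}^nh_r\lambda_i^{n-r}=\Phi(\lambda_i,\mu_i,t)$, $i=1,\dots,n$. With $\rho_k=(-1)^ks_k(\lambda)$ ($s_k$ the elementary symmetric polynomials, $\rho_0=1$) and $\Delta_i=\prod_{j\ne i}(\lambda_i-\lambda_j)$ put $h_1^B=h_1$ and $h_r^B=h_r+W_r$ for $r\ge2$, where $$W_r=-\sum_{i=1}^n\Big(\sum_{k=1}^{r-1}k\rho_{r-k-1}\frac{\lambda_i^{m+k-1}}{\Delta_i}\Big)\mu_i\ \ (r\in I_1^m),\qquad W_r=-\sum_{i=1}^n\Big(\sum_{k=1}^{n-r+1}k\rho_{r+k-1}\frac{\lambda_i^{m-k-1}}{\Delta_i}\Big)\mu_i\ \ (r\in I_2^m).$$ For $r\in\{1\}\cup I_1^m$ let $H_r^B=h_r^B$ if $r\le\kappa_1$ and $H_r^B=\sum_{j=1}^r\zeta_{r,j}h_j^B$ if $r>\kappa_1$; for $r\in I_2^m$ let $H_r^B=\sum_{j=0}^{n-r}\zeta_{r,r+j}h_{r+j}^B$ if $r\le n-\kappa_2$ and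 $H_r^B=h_r^B$ if $r>n-\kappa_2$. **Lax matrix.** For a (Laurent) polynomial $b$ and a polynomial $a$ in $x$, let $[b/a]_+$ be the (Laurent) polynomial with $b/a=[b/a]_++\varrho/a$ for some polynomial $\varrho$, $\deg\varrho<\deg a$ (a polynomial if $b$ is a polynomial), and let $\left[\frac{u}{x^k}\right]_-=\frac{u}{x^k}-\left[\frac{u}{x^k}\right]_+$. Put $$u(x)=\prod_{k=1}^n(x-\lambda_k),\quad v(x)=\sum_{i=1}^n\lambda_i^m\mu_i\prod_{k\ne i}\frac{x-\lambda_k}{\lambda_i-\lambda_k},\quad w(x,t)=-2x^m\left[\frac{\Phi(x,v(x)x^{-m},t)}{u(x)}\right]_+,$$ $$L(x,\xi,t)=\begin{pmatrix}v(x)-\varphi(x,t)&u(x)\\ w(x,t)&-v(x)+\varphi(x,t)\end{pmatrix},$$ $U_r=\left[\frac{B_r}{u}\right]_+$ entrywise, where $B_r=\frac12\left[\frac{u}{x^{n+1-r}}\right]_+L$ for $r\in\{1\}\cup I_1^m$ and $B_r=-\frac12\left[\frac{u}{x^{n+1-r}}\right]_-L$ for $r\in I_2^m$. Finally let $\overline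 U_r$ be formed from the $U_j$ as $H_r^B$ is formed from the $h_j^B$: for $r\in\{1\}\cup I_1^m$, $\overline U_r=U_r$ if $r\le\kappa_1$ and $\overline U_r=\sum_{j=1}^r\zeta_{r,j}U_j$ if $r>\kappa_1$; for $r\in I_2^m$, $\overline U_r=\sum_{j=0}^{n-r}\zeta_{r,r+j}U_{r+j}$ if $r\le n-\kappa_2$ and $\overline U_r=U_r$ if $r>n-\kappa_2$. **Theorem.** For each $r=1,\dots,n$ the flow of $H_r^B$ has the isomonodromic Lax representation $$\frac{d}{dt_r}L(x,\xi,t)=[\overline U_r(x,\xi,t),L(x,\xi,t)]+2x^m\frac{\partial}{\partial x}\overline U_r(x,\xi,t),\qquad \frac{d}{dt_r}=\frac{\partial}{\partial t_r}+\{\cdot,H_r^B\},$$ at every point $(\xi,t)$ and for every real $x\ne0$; all the derivatives involved exist, $H_r^B$ and the entries of $L(x,\cdot,\cdot)$ being differentiable in $(\xi,t)$ and those of $\overline U_r$ in $x$. -/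

import Mathlib

open scoped LaurentPolynomial Polynomial ContDiff

noncomputable section

namespace PainleveLax

/-! ### Index conventions

The evolution parameters `t₁, …, tₙ`, the Hamiltonians and the auxiliary matrices are numbered
from `1` to `n`; the separation coordinates are `lam, mu : Fin n → ℝ`. -/

/-- The space of evolution parameters `t = (t₁, …, tₙ)`. -/
abbrev Time (n : ℕ) : Type := Finset.Icc 1 n → ℝ

/-- `r ∈ {1} ∪ I₁ᵐ`, where `I₁ᵐ = {2, …, n - m + 1}`.  The other `r ∈ {1, …, n}` form
`I₂ᵐ = {2, …, n} ∩ {n - m + 2, …, n}`. -/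
def FirstKind (n m r : ℕ) : Prop := r = 1 ∨ r + m ≤ n + 1

instance (n m r : ℕ) : Decidable (FirstKind n m r) := by
  unfold FirstKind; infer_instance

/-- `κ₁ = [(n + 3 - m) / 2]`, used for `m ≤ n + 1`. -/
def kappa1 (n m : ℕ) : ℕ := (n + 3 - m) / 2

/-- `κ₂ = [m / 2]`. -/
def kappa2 (m : ℕ) : ℕ := m / 2

/-! ### Division of a Laurent polynomial by a polynomial -/

/-- `q = [b / a]₊`: one has `b / a = q + ρ / a` with a polynomial `ρ` of degree `< deg a`;
if `b` is a polynomial then `q` is the ordinary polynomial quotient. -/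
def IsPlusPart (b : ℝ[T;T⁻¹]) (a : ℝ[X]) (q : ℝ[T;T⁻¹]) : Prop :=
  (∃ ρ : ℝ[X], ρ.degree < a.degree ∧
    b = q * Polynomial.toLaurent a + Polynomial.toLaurent ρ) ∧
  ((∃ p : ℝ[X], b = Polynomial.toLaurent p) → ∃ p : ℝ[X], q = Polynomial.toLaurent p)

theorem poly_quotient_unique {a p ρ ρ' : ℝ[X]} (hρ : ρ.degree < a.degree)
    (hρ' : ρ'.degree < a.degree) (h : p * a = ρ - ρ') : p = 0 := by
  by_contra hp
  have h1 : a.degree ≤ (p * a).degree := by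
    rw [mul_comm]; exact Polynomial.degree_le_mul_left a hp
  rw [h] at h1
  exact absurd (lt_of_le_of_lt (Polynomial.degree_sub_le ρ ρ') (max_lt hρ hρ')) (not_lt.mpr h1)

/-- The quotient `[b / a]₊` exists and is unique as soon as `b` is a polynomial or
`a(0) ≠ 0` (and `a` is monic). -/
theorem existsUnique_isPlusPart (b : ℝ[T;T⁻¹]) (a : ℝ[X]) (ha : a.Monic)
    (h : (∃ p : ℝ[X], b = Polynomial.toLaurent p) ∨ a.coeff 0 ≠ 0) :
    ∃! q, IsPlusPart b a q := by
  have hinj : Function.Injective (Polynomial.toLaurent : ℝ[X] → ℝ[T;T⁻¹]) :=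
    Polynomial.toLaurent_injective
  by_cases hb : ∃ p : ℝ[X], b = Polynomial.toLaurent p
  · obtain ⟨p, rfl⟩ := hb
    refine ⟨Polynomial.toLaurent (p /ₘ a), ⟨⟨p %ₘ a, Polynomial.degree_modByMonic_lt p ha, ?_⟩,
      fun _ => ⟨_, rfl⟩⟩, ?_⟩
    · rw [← map_mul, ← map_add, mul_comm, add_comm, Polynomial.modByMonic_add_div p]
    · rintro q ⟨⟨ρ, hρ, hq⟩, hq'⟩
      obtain ⟨s, rfl⟩ := hq' ⟨p, rfl⟩
      rw [← map_mul, ← map_add] at hq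
      have h2 := hinj hq
      have h3 := Polynomial.modByMonic_add_div p a
      have := poly_quotient_unique (a := a) (p := s - p /ₘ a)
        (Polynomial.degree_modByMonic_lt p ha) hρ (by linear_combination -h2 - h3)
      rw [sub_eq_zero.mp this]
  · have ha0 : a.coeff 0 ≠ 0 := h.resolve_left hb
    have hcop : ∀ N : ℕ, IsCoprime (Polynomial.X ^ N : ℝ[X]) a := fun N =>
      IsCoprime.pow_left ((Polynomial.irreducible_X.coprime_iff_not_dvd).mpr
        (by rw [Polynomial.X_dvd_iff]; exact ha0))
    have hT : ∀ N : ℕ, LaurentPolynomial.T (R := ℝ) (-(N : ℤ)) * LaurentPolynomial.T N = 1 := by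
      intro N
      rw [← LaurentPolynomial.T_add]; simp
    refine existsUnique_of_exists_of_unique ?_ ?_
    · obtain ⟨N, p, hp⟩ := LaurentPolynomial.exists_T_pow b
      obtain ⟨x, y, hxy⟩ := hcop N
      refine ⟨Polynomial.toLaurent ((p * x) /ₘ a) +
        LaurentPolynomial.T (-(N : ℤ)) * Polynomial.toLaurent (p * y),
        ⟨(p * x) %ₘ a, Polynomial.degree_modByMonic_lt _ ha, ?_⟩, fun hb' => absurd hb' hb⟩
      have h3 := congrArg Polynomial.toLaurent (Polynomial.modByMonic_add_div (p * x) a)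
      have h4 := congrArg Polynomial.toLaurent hxy
      simp only [map_add, map_mul, map_one, Polynomial.toLaurent_X_pow] at h3 h4 hp ⊢
      have h5 := hT N
      linear_combination -b * h4 - h3 - Polynomial.toLaurent x * hp
        - LaurentPolynomial.T (-(N : ℤ)) * Polynomial.toLaurent y * Polynomial.toLaurent a * hp
        - b * Polynomial.toLaurent y * Polynomial.toLaurent a * h5
    · rintro q q' ⟨⟨ρ, hρ, hq⟩, -⟩ ⟨⟨ρ', hρ', hq'⟩, -⟩
      obtain ⟨N, s, hs⟩ := LaurentPolynomial.exists_T_pow (q - q')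
      have h1 : s * a = Polynomial.X ^ N * (ρ' - ρ) := by
        apply hinj
        simp only [map_mul, map_sub, Polynomial.toLaurent_X_pow, hs]
        linear_combination LaurentPolynomial.T (N : ℤ) * (hq' - hq)
      obtain ⟨c, hc⟩ := (hcop N).dvd_of_dvd_mul_right (Dvd.intro _ h1.symm)
      have hX : (Polynomial.X ^ N : ℝ[X]) ≠ 0 := pow_ne_zero _ Polynomial.X_ne_zero
      have h2 : c * a = ρ' - ρ := by
        apply mul_left_cancel₀ hX
        rw [← h1, hc]; ring
      have h3 : c = 0 := poly_quotient_unique hρ' hρ h2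
      rw [hc, h3, mul_zero, map_zero] at hs
      have h5 := hT N
      rw [← sub_eq_zero]
      linear_combination -(q - q') * h5 - LaurentPolynomial.T (-(N : ℤ)) * hs

/-- `[b / a]₊`. -/
def plusPart (b : ℝ[T;T⁻¹]) (a : ℝ[X]) : ℝ[T;T⁻¹] := Classical.epsilon (IsPlusPart b a)

/-- The value at `x` of a Laurent polynomial (used for `x ≠ 0`). -/
def evalAt (p : ℝ[T;T⁻¹]) (x : ℝ) : ℝ := p.coeff.sum fun k c => c * x ^ k

/-! ### The spectral curve and the Hamiltonians

`δ γ`, `ε`, `z r j` stand for the values of `d_γ`, `e`, `ζ_{r,j}` at a given `t`. -/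

/-- `Φ(x, y) = ½ x^m y² - ∑_{γ=0}^{n+1} d_γ x^γ y - e x^n`, for `x`, `y` in any real algebra. -/
def Phi {A : Type*} [CommRing A] [Algebra ℝ A] (n m : ℕ) (δ : ℕ → ℝ) (ε : ℝ) (x y : A) : A :=
  (1 / 2 : ℝ) • (x ^ m * y ^ 2) - (∑ γ ∈ Finset.range (n + 2), δ γ • (x ^ γ * y)) - ε • x ^ n

/-- The Stäckel Hamiltonian `h_r`, `1 ≤ r ≤ n`: the `r`-th component of the solution of the
separation relations `∑_r h_r λ_i^{n-r} = Φ(λ_i, μ_i)`, that is, the coefficient at `x^{n-r}` of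
the polynomial of degree `< n` with the values `Φ(λ_i, μ_i)` at `λ_i`. -/
def hSt (n m : ℕ) (δ : ℕ → ℝ) (ε : ℝ) (lam mu : Fin n → ℝ) (r : ℕ) : ℝ :=
  (Lagrange.interpolate Finset.univ lam fun i => Phi n m δ ε (lam i) (mu i)).coeff (n - r)

theorem sum_Icc_coeff (n : ℕ) (c : ℕ → ℝ) (y : ℝ) :
    ∑ r ∈ Finset.Icc 1 n, c (n - r) * y ^ (n - r) = ∑ k ∈ Finset.range n, c k * y ^ k := by
  refine Finset.sum_bij' (fun r _ => n - r) (fun k _ => n - k) ?_ ?_ ?_ ?_ ?_ <;>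
    intro k hk <;> simp only [Finset.mem_Icc, Finset.mem_range] at hk ⊢ <;> omega

/-- The `h_r` solve the separation relations. -/
theorem hSt_separation (n m : ℕ) (δ : ℕ → ℝ) (ε : ℝ) (lam mu : Fin n → ℝ)
    (hlam : Function.Injective lam) (i : Fin n) :
    ∑ r ∈ Finset.Icc 1 n, hSt n m δ ε lam mu r * lam i ^ (n - r) =
      Phi n m δ ε (lam i) (mu i) := by
  set P := Lagrange.interpolate Finset.univ lam fun i => Phi n m δ ε (lam i) (mu i) with hP
  have hdeg : P.degree < n := by
    have h := Lagrange.degree_interpolate_lt (s := Finset.univ) (v := lam)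
      (fun i => Phi n m δ ε (lam i) (mu i)) hlam.injOn
    rwa [Finset.card_univ, Fintype.card_fin] at h
  have hev : P.eval (lam i) = Phi n m δ ε (lam i) (mu i) :=
    Lagrange.eval_interpolate_at_node (s := Finset.univ) (v := lam)
      (fun i => Phi n m δ ε (lam i) (mu i)) hlam.injOn (Finset.mem_univ i)
  have hsum : P.eval (lam i) = ∑ k ∈ Finset.range n, P.coeff k * lam i ^ k := by
    have hn : 0 < n := i.pos
    rw [Polynomial.eval_eq_sum_range' (n := n)]
    rcases eq_or_ne P 0 with h0 | h0
    · simpa [h0] using hn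
    · exact (Polynomial.natDegree_lt_iff_degree_lt h0).mpr hdeg
  rw [← hev, hsum, ← sum_Icc_coeff]
  rfl

/-- The separation relations have no other solution. -/
theorem hSt_unique (n m : ℕ) (δ : ℕ → ℝ) (ε : ℝ) (lam mu : Fin n → ℝ)
    (hlam : Function.Injective lam) (g : ℕ → ℝ)
    (hg : ∀ i, ∑ r ∈ Finset.Icc 1 n, g r * lam i ^ (n - r) = Phi n m δ ε (lam i) (mu i))
    (r : ℕ) (hr : r ∈ Finset.Icc 1 n) : g r = hSt n m δ ε lam mu r := by
  set P : ℝ[X] := ∑ k ∈ Finset.range n, Polynomial.C (g (n - k)) * Polynomial.X ^ k with hP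
  have hdeg : P.degree < (Finset.univ : Finset (Fin n)).card := by
    rw [Finset.card_univ, Fintype.card_fin, ← Polynomial.mem_degreeLT]
    refine Submodule.sum_mem _ fun k hk => ?_
    rw [Polynomial.mem_degreeLT]
    exact lt_of_le_of_lt (Polynomial.degree_C_mul_X_pow_le _ _)
      (by exact_mod_cast Finset.mem_range.mp hk)
  have hev : ∀ i ∈ (Finset.univ : Finset (Fin n)),
      P.eval (lam i) = (fun i => Phi n m δ ε (lam i) (mu i)) i := by
    intro i _
    simp only [hP, Polynomial.eval_finsetSum, Polynomial.eval_mul, Polynomial.eval_C,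
      Polynomial.eval_pow, Polynomial.eval_X]
    rw [← sum_Icc_coeff n (fun k => g (n - k)), ← hg i]
    refine Finset.sum_congr rfl fun k hk => ?_
    rw [Finset.mem_Icc] at hk
    rw [Nat.sub_sub_self hk.2]
  have h := Lagrange.eq_interpolate_of_eval_eq _ hlam.injOn hdeg hev
  rw [Finset.mem_Icc] at hr
  rw [hSt, ← h, hP]
  simp only [Polynomial.finsetSum_coeff, Polynomial.coeff_C_mul, Polynomial.coeff_X_pow]
  rw [Finset.sum_eq_single (n - r)]
  · simp [Nat.sub_sub_self hr.2]
  · intro b _ hb; simp [Ne.symm hb]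
  · intro h'; exact absurd (Finset.mem_range.mpr (by omega)) h'

/-- The coefficient `ρ_k = (-1)^k s_k(λ)`, with `s_k` the elementary symmetric polynomial. -/
def rho {n : ℕ} (lam : Fin n → ℝ) (k : ℕ) : ℝ :=
  (-1) ^ k * (Finset.univ.val.map lam).esymm k

/-- `Δ_i = ∏_{j ≠ i} (λ_i - λ_j)`. -/
def Delta {n : ℕ} (lam : Fin n → ℝ) (i : Fin n) : ℝ :=
  ∏ j ∈ Finset.univ.erase i, (lam i - lam j)

/-- The quasi-Stäckel terms `W_r` (in particular `W₁ = 0`). -/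
def W (n m : ℕ) (lam mu : Fin n → ℝ) (r : ℕ) : ℝ :=
  if FirstKind n m r then
    -∑ i, (∑ k ∈ Finset.Icc 1 (r - 1),
      (k : ℝ) * rho lam (r - k - 1) * (lam i ^ (m + k - 1) / Delta lam i)) * mu i
  else
    -∑ i, (∑ k ∈ Finset.Icc 1 (n + 1 - r),
      (k : ℝ) * rho lam (r + k - 1) * (lam i ^ (m - k - 1) / Delta lam i)) * mu i

/-- `h_r^B = h_r + W_r`. -/
def hB (n m : ℕ) (δ : ℕ → ℝ) (ε : ℝ) (lam mu : Fin n → ℝ) (r : ℕ) : ℝ :=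
  hSt n m δ ε lam mu r + W n m lam mu r

/-- The combination, with coefficients `ζ`, which defines both `H_r^B` (from the `h_j^B`) and
`Ū_r` (from the `U_j`). -/
def deform {V : Type*} [AddCommMonoid V] [Module ℝ V] (n m : ℕ) (z : ℕ → ℕ → ℝ) (Y : ℕ → V)
    (r : ℕ) : V :=
  if FirstKind n m r then
    if r ≤ kappa1 n m then Y r else ∑ j ∈ Finset.Icc 1 r, z r j • Y j
  else
    if r ≤ n - kappa2 m then ∑ j ∈ Finset.Icc 0 (n - r), z r (r + j) • Y (r + j) else Y r

/-- The Hamiltonian `H_r^B(λ, μ, t)`. -/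
def HB (n m : ℕ) (d : ℕ → Time n → ℝ) (e : Time n → ℝ) (ζ : ℕ → ℕ → Time n → ℝ) (r : ℕ)
    (lam mu : Fin n → ℝ) (t : Time n) : ℝ :=
  deform n m (fun i j => ζ i j t) (fun j => hB n m (fun γ => d γ t) (e t) lam mu j) r

/-! ### Derivatives -/

/-- The partial derivative of `F` with respect to the `i`-th variable, at `a`. -/
def pderiv {ι : Type*} [DecidableEq ι] (F : (ι → ℝ) → ℝ) (i : ι) (a : ι → ℝ) : ℝ :=
  deriv (fun s => F (Function.update a i s)) (a i)

/-- The canonical Poisson bracket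
`{F, G} = ∑_i (∂F/∂λ_i ∂G/∂μ_i - ∂F/∂μ_i ∂G/∂λ_i)` at `(λ, μ)`. -/
def poisson {n : ℕ} (F G : (Fin n → ℝ) → (Fin n → ℝ) → ℝ) (lam mu : Fin n → ℝ) : ℝ :=
  ∑ i, (pderiv (fun l => F l mu) i lam * pderiv (fun p => G lam p) i mu
    - pderiv (fun p => F lam p) i mu * pderiv (fun l => G l mu) i lam)

/-- The evolutionary derivative `dF/dt_r = ∂F/∂t_r + {F, H}` along the Hamiltonian vector field
of `H`. -/
def evolDeriv {n : ℕ} (H F : (Fin n → ℝ) → (Fin n → ℝ) → Time n → ℝ) (r : Finset.Icc 1 n)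
    (lam mu : Fin n → ℝ) (t : Time n) : ℝ :=
  pderiv (fun s => F lam mu s) r t + poisson (fun l p => F l p t) (fun l p => H l p t) lam mu

/-! ### The deformation functions -/

/-- The conditions on the smooth functions `d_γ` (`0 ≤ γ ≤ n + 1`), `e` and `ζ_{r,j}`.
The compatibility conditions `∂²d_γ/∂t_r∂t_s = ∂²d_γ/∂t_s∂t_r` hold by smoothness.
In all the indices the subtractions are between naturals whose difference is nonnegative. -/
structure IsDeformation (n m : ℕ) (d : ℕ → Time n → ℝ) (e : Time n → ℝ)
    (ζ : ℕ → ℕ → Time n → ℝ) : Prop where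
  smooth_d : ∀ γ ≤ n + 1, ContDiff ℝ ∞ (d γ)
  smooth_e : ContDiff ℝ ∞ e
  /-- `ζ_{r,j} = ζ_{r,j}(t₁, …, t_{r-1})` is smooth, `r ∈ {κ₁ + 1, …, n - m + 1}`, `j ≤ r`. -/
  zeta_first : ∀ r : Finset.Icc 1 n, FirstKind n m r → kappa1 n m < r → ∀ j ∈ Finset.Icc 1 (r : ℕ),
    ContDiff ℝ ∞ (ζ r j) ∧
      ∀ t t' : Time n, (∀ k : Finset.Icc 1 n, (k : ℕ) < r → t k = t' k) → ζ r j t = ζ r j t'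
  /-- `ζ_{r,j} = ζ_{r,j}(t_{r+1}, …, t_n)` is smooth, `r ∈ {n - m + 2, …, n - κ₂}`, `j ≥ r`. -/
  zeta_second : ∀ r : Finset.Icc 1 n, ¬ FirstKind n m r → (r : ℕ) ≤ n - kappa2 m →
    ∀ j ∈ Finset.Icc (r : ℕ) n,
      ContDiff ℝ ∞ (ζ r j) ∧
        ∀ t t' : Time n, (∀ k : Finset.Icc 1 n, (r : ℕ) < k → t k = t' k) → ζ r j t = ζ r j t'
  /-- For the values `ζ_{r,r}` that do not occur this is a mere normalization. -/
  zeta_diag : ∀ (r : Finset.Icc 1 n) (t : Time n), ζ r r t = 1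
  /-- `r ∈ {1, …, κ₁}`. -/
  pde_first_low : ∀ r : Finset.Icc 1 n, FirstKind n m r → (r : ℕ) ≤ kappa1 n m →
    ∀ γ ≤ n + 1, ∀ t, pderiv (d γ) r t =
      if m ≤ γ ∧ γ + 1 ≤ m + r then
        ((γ : ℝ) - m + 1) * d (n + 2 + γ - m - r) t
      else 0
  /-- `r ∈ {κ₁ + 1, …, n - m + 1}`. -/
  pde_first_high : ∀ r : Finset.Icc 1 n, FirstKind n m r → kappa1 n m < r →
    ∀ γ ≤ n + 1, ∀ t, pderiv (d γ) r t =
      if m ≤ γ ∧ γ + 1 ≤ m + r then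
        ((γ : ℝ) - m + 1) * ∑ j ∈ Finset.Icc (γ + 1 - m) (r : ℕ),
          ζ r j t * d (n + 2 + γ - m - j) t
      else 0
  /-- `r ∈ {n - m + 2, …, n - κ₂}`. -/
  pde_second_low : ∀ r : Finset.Icc 1 n, ¬ FirstKind n m r → (r : ℕ) ≤ n - kappa2 m →
    ∀ γ ≤ n + 1, ∀ t, pderiv (d γ) r t =
      if m + r ≤ n + 2 + γ ∧ γ + 2 ≤ m then
        -((γ : ℝ) - m + 1) * ∑ j ∈ Finset.Icc 0 (n + 2 + γ - m - r),
          ζ r (r + j) t * d (n + 2 + γ - m - r - j) t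
      else 0
  /-- `r ∈ {n - κ₂ + 1, …, n}`. -/
  pde_second_high : ∀ r : Finset.Icc 1 n, ¬ FirstKind n m r → n - kappa2 m < r →
    ∀ γ ≤ n + 1, ∀ t, pderiv (d γ) r t =
      if m + r ≤ n + 2 + γ ∧ γ + 2 ≤ m then
        -((γ : ℝ) - m + 1) * d (n + 2 + γ - m - r) t
      else 0
  pde_e : ∀ (r : Finset.Icc 1 n) (t : Time n), pderiv e r t =
    if m = n + 1 ∧ (r : ℕ) = 1 then e t else 0

/-! ### The Lax matrix and the auxiliary matrices

Their entries are Laurent polynomials in the spectral parameter `x`. -/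

/-- `u(x) = ∏_k (x - λ_k)`. -/
def uPoly {n : ℕ} (lam : Fin n → ℝ) : ℝ[X] := ∏ k, (Polynomial.X - Polynomial.C (lam k))

/-- `v(x) = ∑_i λ_i^m μ_i ∏_{k ≠ i} (x - λ_k) / (λ_i - λ_k)`. -/
def vPoly {n : ℕ} (m : ℕ) (lam mu : Fin n → ℝ) : ℝ[X] :=
  ∑ i, Polynomial.C (lam i ^ m * mu i) * ∏ k ∈ Finset.univ.erase i,
    (Polynomial.C (lam i - lam k)⁻¹ * (Polynomial.X - Polynomial.C (lam k)))

/-- `φ(x) = ∑_{γ=0}^{n+1} d_γ x^γ`. -/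
def phiPoly (n : ℕ) (δ : ℕ → ℝ) : ℝ[X] :=
  ∑ γ ∈ Finset.range (n + 2), Polynomial.C (δ γ) * Polynomial.X ^ γ

/-- `w(x) = -2 x^m [Φ(x, v(x) x^{-m}) / u(x)]₊`. -/
def wLaurent (n m : ℕ) (δ : ℕ → ℝ) (ε : ℝ) (lam mu : Fin n → ℝ) : ℝ[T;T⁻¹] :=
  (-2 : ℝ) • (LaurentPolynomial.T (m : ℤ) *
    plusPart (Phi n m δ ε (LaurentPolynomial.T 1)
      (Polynomial.toLaurent (vPoly m lam mu) * LaurentPolynomial.T (-(m : ℤ)))) (uPoly lam))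

/-- The Lax matrix `L`, for given values of `d_γ` and `e`. -/
def Lax (n m : ℕ) (δ : ℕ → ℝ) (ε : ℝ) (lam mu : Fin n → ℝ) :
    Matrix (Fin 2) (Fin 2) ℝ[T;T⁻¹] :=
  !![Polynomial.toLaurent (vPoly m lam mu - phiPoly n δ), Polynomial.toLaurent (uPoly lam);
     wLaurent n m δ ε lam mu, Polynomial.toLaurent (-vPoly m lam mu + phiPoly n δ)]

/-- `[u(x) / x^k]₊`. -/
def uPlus {n : ℕ} (lam : Fin n → ℝ) (k : ℕ) : ℝ[T;T⁻¹] :=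
  plusPart (Polynomial.toLaurent (uPoly lam)) (Polynomial.X ^ k)

/-- `[u(x) / x^k]₋ = u(x) / x^k - [u(x) / x^k]₊`. -/
def uMinus {n : ℕ} (lam : Fin n → ℝ) (k : ℕ) : ℝ[T;T⁻¹] :=
  Polynomial.toLaurent (uPoly lam) * LaurentPolynomial.T (-(k : ℤ)) - uPlus lam k

/-- `B_r = ½ [u / x^{n+1-r}]₊ L` for `r ∈ {1} ∪ I₁ᵐ` and `B_r = -½ [u / x^{n+1-r}]₋ L` for
`r ∈ I₂ᵐ`. -/
def BMat (n m : ℕ) (δ : ℕ → ℝ) (ε : ℝ) (lam mu : Fin n → ℝ) (r : ℕ) :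
    Matrix (Fin 2) (Fin 2) ℝ[T;T⁻¹] :=
  if FirstKind n m r then (1 / 2 : ℝ) • uPlus lam (n + 1 - r) • Lax n m δ ε lam mu
  else (-(1 / 2) : ℝ) • uMinus lam (n + 1 - r) • Lax n m δ ε lam mu

/-- `U_r = [B_r / u]₊`, entry by entry. -/
def UMat (n m : ℕ) (δ : ℕ → ℝ) (ε : ℝ) (lam mu : Fin n → ℝ) (r : ℕ) :
    Matrix (Fin 2) (Fin 2) ℝ[T;T⁻¹] :=
  (BMat n m δ ε lam mu r).map fun b => plusPart b (uPoly lam)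

/-- The value `L(x, λ, μ, t)` of the Lax matrix. -/
def LaxAt (n m : ℕ) (d : ℕ → Time n → ℝ) (e : Time n → ℝ) (x : ℝ)
    (lam mu : Fin n → ℝ) (t : Time n) : Matrix (Fin 2) (Fin 2) ℝ :=
  (Lax n m (fun γ => d γ t) (e t) lam mu).map fun p => evalAt p x

/-- The value `Ū_r(x, λ, μ, t)` of the auxiliary matrix. -/
def UBarAt (n m : ℕ) (d : ℕ → Time n → ℝ) (e : Time n → ℝ) (ζ : ℕ → ℕ → Time n → ℝ) (r : ℕ)
    (x : ℝ) (lam mu : Fin n → ℝ) (t : Time n) : Matrix (Fin 2) (Fin 2) ℝ :=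
  (deform n m (fun i j => ζ i j t) (fun j => UMat n m (fun γ => d γ t) (e t) lam mu j) r).map
    fun p => evalAt p x

end PainleveLax

end

noncomputable section

namespace PainleveLax

/-! ### Values of Laurent polynomials -/

/-! Put K = n+1-j and F_j(p) = ½([p/x^K]₊ - σ p/x^K), with σ = 0 for an index j of the first kind
and σ = 1 for one of the second, so that B_j = F_j(u) L. For every entry f of L the terms with σ
cancel in F_j(u) f - F_j(f) u, and what remains is a polynomial of degree at most n. Dividing it by
the monic u leaves a constant, hence [F_j(u) f / u]₊ = F_j(f) + const: up to a constant matrix, U_j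
is F_j applied to the entries of L (`plusPart_trunc`, `evalAt_UMat`).

The same operator produces the Hamiltonians. The number 2 F_j(u)(λ_k) is the coefficient of
u/(x-λ_k) at x^{n-j}, so h_j = ∑ 2 F_j(u)(λ_i) Φ(λ_i, μ_i)/Δ_i, while W_j = -2 ∑ λ_i^m μ_i
F_j(u)'(λ_i)/Δ_i (`two_mul_truncLin_uPoly`, `W_eq_quasiTerm`). At a fixed t all of this is linear in
the operator, so the ζ-deformation merely replaces F_j by a linear combination F. The properties
that are needed form the class `IsLaxOp`, which is stable under linear combinations, and the Lax
equation is proved for F.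

The differential equations for the d_γ say exactly that ∂φ/∂t_r = 2x^m (Fφ)' (`phi_evolution`). In
the upper right entry, and in the diagonal one once φ is split off, both sides are then polynomials
of degree < n. It suffices to compare them at the nodes λ_k, where they become Hamilton's equations.
The delicate ingredient is ∂W/∂λ_k (`hasDerivAt_quasiTerm_lam`), which rests on the symmetry of
divided differences (`IsLaxOp.cofac_symm`).

The lower left entry is obtained from the spectral curve: v(v-2φ) + uw = 2x^m(e x^n + h), with h the
interpolant of the values Φ(λ_i, μ_i). Differentiating this along the flow and inserting the two
known entries, one finds that the defect Z of the third equation satisfies u Z = 2x^m (h' - p) with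
deg p < n. At the nodes the left side vanishes, so h' = p and Z = 0 (`IsLaxFlow.lower_left`); the
evolution of h never has to be computed. The exceptional law for e when m = n+1 is the leading term
produced by the `quad` property.

Finally, d/dt_r is a directional derivative (`hasDerivAt_line_evolDeriv`), so one may differentiate
polynomials coefficient by coefficient along a straight line. -/

theorem evalAt_add (p q : ℝ[T;T⁻¹]) (x : ℝ) : evalAt (p + q) x = evalAt p x + evalAt q x := by
  unfold evalAt
  rw [AddMonoidAlgebra.coeff_add]
  exact Finsupp.sum_add_index' (by simp) (by intros; ring)

theorem evalAt_C_mul_T (a : ℝ) (k : ℤ) (x : ℝ) :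
    evalAt (LaurentPolynomial.C a * LaurentPolynomial.T k) x = a * x ^ k := by
  unfold evalAt
  rw [← LaurentPolynomial.single_eq_C_mul_T, AddMonoidAlgebra.coeff_single]
  exact Finsupp.sum_single_index (by simp)

theorem evalAt_eq_eval₂ (p : ℝ[T;T⁻¹]) {x : ℝ} (hx : x ≠ 0) :
    evalAt p x = LaurentPolynomial.eval₂ (RingHom.id ℝ) (Units.mk0 x hx) p := by
  induction p using LaurentPolynomial.induction_on' with
  | add p q hp hq => rw [evalAt_add, map_add, hp, hq]
  | C_mul_T k a => rw [evalAt_C_mul_T, LaurentPolynomial.eval₂_C_mul_T]; simp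

theorem evalAt_mul (p q : ℝ[T;T⁻¹]) {x : ℝ} (hx : x ≠ 0) :
    evalAt (p * q) x = evalAt p x * evalAt q x := by
  simp only [evalAt_eq_eval₂ _ hx, map_mul]

theorem evalAt_sub (p q : ℝ[T;T⁻¹]) {x : ℝ} (hx : x ≠ 0) :
    evalAt (p - q) x = evalAt p x - evalAt q x := by
  simp only [evalAt_eq_eval₂ _ hx, map_sub]

theorem evalAt_C (a : ℝ) {x : ℝ} (hx : x ≠ 0) : evalAt (LaurentPolynomial.C a) x = a := by
  simp [evalAt_eq_eval₂ _ hx]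

theorem evalAt_smul (a : ℝ) (p : ℝ[T;T⁻¹]) {x : ℝ} (hx : x ≠ 0) :
    evalAt (a • p) x = a * evalAt p x := by
  rw [LaurentPolynomial.smul_eq_C_mul, evalAt_mul _ _ hx, evalAt_C _ hx]

theorem evalAt_T (k : ℤ) (x : ℝ) : evalAt (LaurentPolynomial.T k) x = x ^ k := by
  have := evalAt_C_mul_T 1 k x
  simpa using this

theorem evalAt_toLaurent (p : ℝ[X]) {x : ℝ} (hx : x ≠ 0) :
    evalAt (Polynomial.toLaurent p) x = p.eval x := by
  simp [evalAt_eq_eval₂ _ hx, Polynomial.eval, RingHom.id]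

theorem evalAt_sum {ι : Type*} (s : Finset ι) (p : ι → ℝ[T;T⁻¹]) {x : ℝ} (hx : x ≠ 0) :
    evalAt (∑ i ∈ s, p i) x = ∑ i ∈ s, evalAt (p i) x := by
  simp only [evalAt_eq_eval₂ _ hx, map_sum]

/-! ### The operation `[b / a]₊` -/

/-- Clearing denominators gives s a = x^N (ρ' - ρ). As a(0) ≠ 0, x^N is coprime to a and divides s,
and then degrees force the difference to vanish. For a = x uniqueness fails: 1 = x⁻¹ · x + 0 = 0 · x
+ 1. -/
theorem laurent_quotient_unique {a : ℝ[X]} (ha0 : a.coeff 0 ≠ 0)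
    {q q' : ℝ[T;T⁻¹]} {ρ ρ' : ℝ[X]} (hρ : ρ.degree < a.degree) (hρ' : ρ'.degree < a.degree)
    (h : q * Polynomial.toLaurent a + Polynomial.toLaurent ρ =
      q' * Polynomial.toLaurent a + Polynomial.toLaurent ρ') : q = q' := by
  obtain ⟨N, s, hs⟩ := LaurentPolynomial.exists_T_pow (q - q')
  have h1 : s * a = Polynomial.X ^ N * (ρ' - ρ) := by
    apply Polynomial.toLaurent_injective
    simp only [map_mul, map_sub, Polynomial.toLaurent_X_pow, hs]
    linear_combination LaurentPolynomial.T (N : ℤ) * h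
  have hcop : IsCoprime (Polynomial.X ^ N : ℝ[X]) a :=
    IsCoprime.pow_left ((Polynomial.irreducible_X.coprime_iff_not_dvd).mpr
      (by rw [Polynomial.X_dvd_iff]; exact ha0))
  obtain ⟨c, hc⟩ := hcop.dvd_of_dvd_mul_right (Dvd.intro _ h1.symm)
  have hX : (Polynomial.X ^ N : ℝ[X]) ≠ 0 := pow_ne_zero _ Polynomial.X_ne_zero
  have h2 : c * a = ρ' - ρ := by
    apply mul_left_cancel₀ hX
    rw [← h1, hc]; ring
  have h3 : c = 0 := poly_quotient_unique hρ' hρ h2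
  rw [hc, h3, mul_zero, map_zero] at hs
  have h4 : (LaurentPolynomial.T (N : ℤ) : ℝ[T;T⁻¹]) * LaurentPolynomial.T (-(N : ℤ)) = 1 := by
    rw [← LaurentPolynomial.T_add]; simp
  rw [← sub_eq_zero]
  linear_combination -(q - q') * h4 - LaurentPolynomial.T (-(N : ℤ)) * hs

/-- A quotient with remainder is `[b / a]₊`, if `a(0) ≠ 0` or everything is a polynomial. -/
theorem plusPart_eq {b q : ℝ[T;T⁻¹]} {a ρ : ℝ[X]} (ha : a.Monic)
    (h : a.coeff 0 ≠ 0 ∨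
      (∃ p : ℝ[X], b = Polynomial.toLaurent p) ∧ ∃ p : ℝ[X], q = Polynomial.toLaurent p)
    (hρ : ρ.degree < a.degree)
    (hb : b = q * Polynomial.toLaurent a + Polynomial.toLaurent ρ) : plusPart b a = q := by
  have hex := (existsUnique_isPlusPart b a ha (by tauto)).exists
  have hspec : IsPlusPart b a (plusPart b a) := Classical.epsilon_spec hex
  rcases h with h | ⟨h, hq⟩
  · obtain ⟨⟨ρ', hρ', hb'⟩, -⟩ := hspec
    exact laurent_quotient_unique h hρ' hρ (hb'.symm.trans hb)
  · exact (existsUnique_isPlusPart b a ha (Or.inl h)).unique hspec ⟨⟨ρ, hρ, hb⟩, fun _ => hq⟩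

/-! ### Truncated division by a power of `x` -/

open Polynomial in
/-- `½ ([p / x^K]₊ - σ p / x^K)`: for `σ = 0` it is `½ [p / x^K]₊` and for `σ = 1` it is
`-½ [p / x^K]₋`. -/
def truncL (σ : ℝ) (K : ℕ) (p : ℝ[X]) : ℝ[T;T⁻¹] :=
  (1 / 2 : ℝ) • (toLaurent (p /ₘ X ^ K) -
    σ • (LaurentPolynomial.T (-(K : ℤ)) * toLaurent p))

open Polynomial in
/-- The value of `truncL σ K p` at `x`. -/
def truncF (σ : ℝ) (K : ℕ) (p : ℝ[X]) (x : ℝ) : ℝ :=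
  ((p /ₘ X ^ K).eval x - σ * ((x ^ K)⁻¹ * p.eval x)) / 2

theorem evalAt_truncL (σ : ℝ) (K : ℕ) (p : ℝ[X]) {x : ℝ} (hx : x ≠ 0) :
    evalAt (truncL σ K p) x = truncF σ K p x := by
  unfold truncL truncF
  rw [evalAt_smul _ _ hx, evalAt_sub _ _ hx, evalAt_smul _ _ hx, evalAt_mul _ _ hx,
    evalAt_toLaurent _ hx, evalAt_toLaurent _ hx, evalAt_T, zpow_neg, zpow_natCast]
  ring

section

open Polynomial

theorem degree_mod_X_pow_lt (p : ℝ[X]) (K : ℕ) : (p %ₘ X ^ K).degree < K := by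
  simpa using degree_modByMonic_lt p (monic_X_pow (R := ℝ) K)

theorem coeff_div_X_pow (p : ℝ[X]) (K i : ℕ) : (p /ₘ X ^ K).coeff i = p.coeff (i + K) := by
  have h := congrArg (fun q => q.coeff (i + K)) (modByMonic_add_div p (X ^ K : ℝ[X]))
  simp only [coeff_add, mul_comm (X ^ K : ℝ[X]), coeff_mul_X_pow] at h
  rw [coeff_eq_zero_of_degree_lt (lt_of_lt_of_le (degree_mod_X_pow_lt p K)
    (by exact_mod_cast Nat.le_add_left K i)), zero_add] at h
  exact h

theorem coeff_mod_X_pow (p : ℝ[X]) (K i : ℕ) :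
    (p %ₘ X ^ K).coeff i = if i < K then p.coeff i else 0 := by
  split_ifs with hi
  · have h := congrArg (fun q => q.coeff i) (modByMonic_add_div p (X ^ K : ℝ[X]))
    simp only [coeff_add, coeff_X_pow_mul', if_neg (not_le.mpr hi), add_zero] at h
    exact h
  · exact coeff_eq_zero_of_degree_lt (lt_of_lt_of_le (degree_mod_X_pow_lt p K)
      (by exact_mod_cast not_lt.mp hi))

theorem div_X_pow_add (p q : ℝ[X]) (K : ℕ) :
    (p + q) /ₘ X ^ K = p /ₘ X ^ K + q /ₘ X ^ K := by
  ext i; simp [coeff_div_X_pow]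

theorem div_X_pow_smul (a : ℝ) (q : ℝ[X]) (K : ℕ) :
    (a • q) /ₘ X ^ K = a • (q /ₘ X ^ K) := by
  ext i; simp [coeff_div_X_pow]

theorem degree_div_X_pow_lt {p : ℝ[X]} {N K : ℕ} (h : p.degree < (N + K : ℕ)) :
    (p /ₘ X ^ K).degree < N := by
  rw [degree_lt_iff_coeff_zero]
  intro i hi
  rw [coeff_div_X_pow]
  exact coeff_eq_zero_of_degree_lt (lt_of_lt_of_le h (by exact_mod_cast by omega))

theorem degree_mul_lt_add {a k : ℝ[X]} {N K : ℕ} (ha : a.degree < K)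
    (hk : k.degree < (N + 1 : ℕ)) : (a * k).degree < ((N + K : ℕ) : WithBot ℕ) := by
  rw [degree_lt_iff_coeff_zero] at *
  intro i hi
  rw [coeff_mul]
  refine Finset.sum_eq_zero fun x hx => ?_
  rw [Finset.HasAntidiagonal.mem_antidiagonal] at hx
  by_cases hxK : K ≤ x.1
  · rw [ha _ hxK, zero_mul]
  · rw [hk _ (by omega), mul_zero]

/-- The commutator `[u / x^K]₊ f - [f / x^K]₊ u` has no terms of high degree. -/
theorem degree_trunc_commutator_lt {u f : ℝ[X]} {N K : ℕ}
    (hu : u.degree < (N + 1 : ℕ)) (hf : f.degree < (N + 1 : ℕ)) :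
    ((u /ₘ X ^ K) * f - (f /ₘ X ^ K) * u).degree < N := by
  -- Replacing x^K [p/x^K]₊ by p minus its remainder cancels the products u f; only products with
  -- remainders, of degree < K, are left.
  have h1 : ((u /ₘ X ^ K) * f - (f /ₘ X ^ K) * u) * X ^ K =
      (f %ₘ X ^ K) * u - (u %ₘ X ^ K) * f := by
    have hu' := modByMonic_add_div u (X ^ K : ℝ[X])
    have hf' := modByMonic_add_div f (X ^ K : ℝ[X])
    linear_combination f * hu' - u * hf'
  have h3 : (((u /ₘ X ^ K) * f - (f /ₘ X ^ K) * u) * X ^ K).degree <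
      ((N + K : ℕ) : WithBot ℕ) := by
    rw [h1]
    exact lt_of_le_of_lt (degree_sub_le _ _) (max_lt
      (degree_mul_lt_add (degree_mod_X_pow_lt f K) hu) (degree_mul_lt_add (degree_mod_X_pow_lt u K) hf))
  rw [degree_lt_iff_coeff_zero] at h3 ⊢
  intro i hi
  rw [← h3 (i + K) (by omega), coeff_mul_X_pow]

end

/-! ### Truncation as a linear operator, and its derivative in x -/

section

open Polynomial

theorem truncF_add (σ : ℝ) (K : ℕ) (p q : ℝ[X]) (x : ℝ) :
    truncF σ K (p + q) x = truncF σ K p x + truncF σ K q x := by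
  simp only [truncF, div_X_pow_add, eval_add]; ring

theorem truncF_smul (σ : ℝ) (K : ℕ) (a : ℝ) (p : ℝ[X]) (x : ℝ) :
    truncF σ K (a • p) x = a * truncF σ K p x := by
  simp only [truncF, div_X_pow_smul, eval_smul, smul_eq_mul]; ring

/-- `truncF σ K` as a linear map. -/
def truncLin (σ : ℝ) (K : ℕ) : ℝ[X] →ₗ[ℝ] (ℝ → ℝ) where
  toFun := truncF σ K
  map_add' p q := by funext x; exact truncF_add σ K p q x
  map_smul' a p := by funext x; exact truncF_smul σ K a p x

/-- Division by x^K drops the coefficients below K; multiplication by x lifts exactly one more of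
them, that of x^{K-1}, above the threshold. For K = 0 there is no such term. -/
theorem div_X_pow_shift (l : ℝ) (q : ℝ[X]) {K : ℕ} (hK : 1 ≤ K) :
    ((X - C l) * q) /ₘ X ^ K = C (q.coeff (K - 1)) + (X - C l) * (q /ₘ X ^ K) := by
  obtain ⟨k, rfl⟩ : ∃ k, K = k + 1 := ⟨K - 1, by omega⟩
  ext i
  rw [coeff_div_X_pow, sub_mul, sub_mul, coeff_sub, coeff_add, coeff_sub, coeff_C_mul, coeff_C_mul,
    coeff_div_X_pow, ← add_assoc, coeff_X_mul]
  cases i with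
  | zero => simp [sub_eq_add_neg]
  | succ i => simp [coeff_div_X_pow, coeff_C_succ]; ring_nf

theorem truncF_shift (σ : ℝ) {K : ℕ} (hK : 1 ≤ K) (l : ℝ) (q : ℝ[X]) (x : ℝ) :
    truncF σ K ((X - C l) * q) x = q.coeff (K - 1) / 2 + (x - l) * truncF σ K q x := by
  unfold truncF
  rw [div_X_pow_shift l q hK]
  simp only [eval_add, eval_mul, eval_sub, eval_X, eval_C]
  ring

theorem hasDerivAt_truncF {σ : ℝ} (K : ℕ) (p : ℝ[X]) {x : ℝ} (hx : σ = 0 ∨ x ≠ 0) :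
    HasDerivAt (truncF σ K p) (((derivative (p /ₘ X ^ K)).eval x -
      σ * ((x ^ K)⁻¹ * (derivative p).eval x - K * (x ^ (K + 1))⁻¹ * p.eval x)) / 2) x := by
  rcases hx with rfl | hx
  · have h0 : truncF 0 K p = fun y => (p /ₘ X ^ K).eval y / 2 := by funext y; simp [truncF]
    simpa [h0] using ((p /ₘ X ^ K).hasDerivAt x).div_const 2
  · have h1 : HasDerivAt (fun y : ℝ => (y ^ K)⁻¹) (-(K : ℝ) * (x ^ (K + 1))⁻¹) x := by
      have h := (hasDerivAt_pow K x).inv (pow_ne_zero K hx)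
      convert! h using 1
      rcases Nat.eq_zero_or_pos K with rfl | hK
      · simp
      · obtain ⟨k, rfl⟩ : ∃ k, K = k + 1 := ⟨K - 1, by omega⟩
        have := pow_ne_zero k hx
        simp only [Nat.add_sub_cancel]
        field_simp
        ring
    convert! (((p /ₘ X ^ K).hasDerivAt x).sub ((h1.mul (p.hasDerivAt x)).const_mul σ)).div_const 2
      using 1
    ring

/-- Order two is required because W contains a first derivative of F(u), which is differentiated
once more in λ. -/
theorem contDiffAt_truncF {σ : ℝ} (K : ℕ) (p : ℝ[X]) {x : ℝ} (hx : σ = 0 ∨ x ≠ 0) :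
    ContDiffAt ℝ 2 (truncF σ K p) x := by
  have h1 : ∀ q : ℝ[X], ContDiffAt ℝ 2 (fun y => q.eval y) x := fun q =>
    by simpa using (q.contDiff_aeval (𝕜 := ℝ) (R := ℝ) 2).contDiffAt (x := x)
  rcases hx with rfl | hx
  · have := (h1 (p /ₘ X ^ K)).div_const 2
    have h0 : truncF 0 K p = fun y => (p /ₘ X ^ K).eval y / 2 := by funext y; simp [truncF]
    rwa [h0]
  · exact ((h1 _).sub (contDiffAt_const.mul
      (((contDiffAt_id.pow K).inv (pow_ne_zero K hx)).mul (h1 p)))).div_const 2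

/-- The polynomial `x p' - K p` for the remainder `p` of `g` modulo `x^K`. -/
def euler (K : ℕ) (g : ℝ[X]) : ℝ[X] :=
  X * derivative (g %ₘ X ^ K) - C (K : ℝ) * (g %ₘ X ^ K)

theorem degree_euler_lt (K : ℕ) (g : ℝ[X]) : (euler K g).degree < K := by
  rw [degree_lt_iff_coeff_zero]
  intro i hi
  have h := degree_mod_X_pow_lt g K
  rw [degree_lt_iff_coeff_zero] at h
  rw [euler, coeff_sub, coeff_C_mul, h i hi]
  cases i with
  | zero => simp
  | succ i => rw [coeff_X_mul, coeff_derivative, h _ hi]; simp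

/-- Apply x d/dx - K to g = x^K q + ρ: it sends x^K q to x^{K+1} q' and ρ to `euler K g`. -/
theorem X_pow_mul_derivative_div (K : ℕ) (g : ℝ[X]) :
    X ^ (K + 1) * derivative (g /ₘ X ^ K) =
      X * derivative g - C (K : ℝ) * g - euler K g := by
  have h := modByMonic_add_div g (X ^ K : ℝ[X])
  have h' := congrArg derivative h
  rw [derivative_add, derivative_mul, derivative_X_pow] at h'
  have hX : X * (C (K : ℝ) * X ^ (K - 1)) = C (K : ℝ) * (X ^ K : ℝ[X]) := by
    rcases Nat.eq_zero_or_pos K with rfl | hK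
    · simp
    · obtain ⟨k, rfl⟩ : ∃ k, K = k + 1 := ⟨K - 1, by omega⟩
      simp only [Nat.add_sub_cancel]; ring
  unfold euler
  linear_combination X * h' - C (K : ℝ) * h - (g /ₘ X ^ K) * hX

/-! ### The class of operators generated by the truncations -/

/-- The properties shared by the linear combinations of the operators `truncF σ (n + 1 - j)`;
`κ` is the coefficient of the exceptional index `j = 1` if `m = n + 1`. -/
structure IsLaxOp (n m : ℕ) (κ : ℝ) (F : ℝ[X] →ₗ[ℝ] (ℝ → ℝ)) : Prop where
  -- The domain m = 0 or x ≠ 0 contains all nodes: a λ_i may vanish only if m = 0, and then every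
  -- index is of the first kind and there is no pole at 0.
  smooth : ∀ p x, (m = 0 ∨ x ≠ 0) → ContDiffAt ℝ 2 (F p) x
  shift : ∀ l q, ∃ b, ∀ x, (m = 0 ∨ x ≠ 0) → F ((X - C l) * q) x = b + (x - l) * F q x
  comm : ∀ (N : ℕ) (u f : ℝ[X]), u.degree < (N + 1 : ℕ) → f.degree < (N + 1 : ℕ) →
    ∃ R : ℝ[X], R.degree < N ∧ ∀ x, (m = 0 ∨ x ≠ 0) →
      F u x * f.eval x - F f x * u.eval x = R.eval x
  -- This puts 2x^m F(u)' and 2x^m F(v)' among the polynomials of degree < n, which are determined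
  -- by their values at the nodes.
  deriv_poly : ∀ f : ℝ[X], f.degree < (n + 1 : ℕ) → ∃ p : ℝ[X], p.degree < n ∧
    ∀ x, (m = 0 ∨ x ≠ 0) → x ^ m * deriv (F f) x = p.eval x
  -- To be applied to v(v - 2φ) + u w = 2x^m(e x^n + h). The term κ e x^n is the one that matches
  -- the evolution of e.
  quad : ∀ f₁ g₁ f₂ g₂ : ℝ[X], f₁.degree < (n + 2 : ℕ) → g₁.degree < (n + 2 : ℕ) →
    f₂.degree < (n + 2 : ℕ) → g₂.degree < (n + 2 : ℕ) → ∀ (e : ℝ) (h : ℝ[X]), h.degree < n →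
    f₁ * g₁ + f₂ * g₂ = 2 * X ^ m * (C e * X ^ n + h) → ∃ p : ℝ[X], p.degree < n ∧
      ∀ x, (m = 0 ∨ x ≠ 0) →
        f₁.eval x * deriv (F g₁) x + g₁.eval x * deriv (F f₁) x +
          (f₂.eval x * deriv (F g₂) x + g₂.eval x * deriv (F f₂) x) =
          p.eval x + κ * e * x ^ n

theorem IsLaxOp.differentiableAt {n m : ℕ} {κ : ℝ} {F : ℝ[X] →ₗ[ℝ] (ℝ → ℝ)}
    (hF : IsLaxOp n m κ F) (p : ℝ[X]) {x : ℝ} (hx : m = 0 ∨ x ≠ 0) :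
    DifferentiableAt ℝ (F p) x := (hF.smooth p x hx).differentiableAt (by norm_num)

theorem IsLaxOp.zero (n m : ℕ) : IsLaxOp n m 0 0 where
  smooth p x _ := contDiffAt_const
  shift l q := ⟨0, fun x _ => by simp⟩
  comm N u f _ _ := ⟨0, by simp, fun x _ => by simp⟩
  deriv_poly f _ := ⟨0, by simp, fun x _ => by simp⟩
  quad f₁ g₁ f₂ g₂ _ _ _ _ e h _ _ := ⟨0, by simp, fun x _ => by simp⟩

theorem IsLaxOp.add_smul {n m : ℕ} {κ κ' : ℝ} {F G : ℝ[X] →ₗ[ℝ] (ℝ → ℝ)}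
    (hF : IsLaxOp n m κ F) (hG : IsLaxOp n m κ' G) (c : ℝ) :
    IsLaxOp n m (κ + c * κ') (F + c • G) := by
  have hd : ∀ p x, (m = 0 ∨ x ≠ 0) →
      deriv ((F + c • G) p) x = deriv (F p) x + c * deriv (G p) x := by
    intro p x hx
    have h1 := (hF.differentiableAt p hx).hasDerivAt
    have h2 := (hG.differentiableAt p hx).hasDerivAt
    exact (h1.add (h2.const_smul c)).deriv
  have hlt : ∀ {a : ℕ} {p q : ℝ[X]}, p.degree < a → q.degree < a → (p + C c * q).degree < a := by
    intro a p q hp hq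
    rw [degree_lt_iff_coeff_zero] at *
    intro i hi
    rw [coeff_add, coeff_C_mul, hp i hi, hq i hi]; simp
  refine ⟨fun p x hx => ?_, fun l q => ?_, fun N u f hu hf => ?_, fun f hf => ?_,
    fun f₁ g₁ f₂ g₂ a₁ a₂ a₃ a₄ e h hh heq => ?_⟩
  · exact (hF.smooth p x hx).add ((hG.smooth p x hx).const_smul c)
  · obtain ⟨b, hb⟩ := hF.shift l q
    obtain ⟨b', hb'⟩ := hG.shift l q
    refine ⟨b + c * b', fun x hx => ?_⟩
    simp only [LinearMap.add_apply, LinearMap.smul_apply, Pi.add_apply, Pi.smul_apply, smul_eq_mul,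
      hb x hx, hb' x hx]
    ring
  · obtain ⟨p, hp, h1⟩ := hF.comm N u f hu hf
    obtain ⟨q, hq, h2⟩ := hG.comm N u f hu hf
    refine ⟨p + C c * q, hlt hp hq, fun x hx => ?_⟩
    simp only [LinearMap.add_apply, LinearMap.smul_apply, Pi.add_apply, Pi.smul_apply, smul_eq_mul,
      eval_add, eval_mul, eval_C, ← h1 x hx, ← h2 x hx]
    ring
  · obtain ⟨p, hp, h1⟩ := hF.deriv_poly f hf
    obtain ⟨q, hq, h2⟩ := hG.deriv_poly f hf
    refine ⟨p + C c * q, hlt hp hq, fun x hx => ?_⟩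
    rw [hd _ _ hx]
    simp only [eval_add, eval_mul, eval_C, ← h1 x hx, ← h2 x hx]
    ring
  · obtain ⟨p, hp, h1⟩ := hF.quad f₁ g₁ f₂ g₂ a₁ a₂ a₃ a₄ e h hh heq
    obtain ⟨q, hq, h2⟩ := hG.quad f₁ g₁ f₂ g₂ a₁ a₂ a₃ a₄ e h hh heq
    refine ⟨p + C c * q, hlt hp hq, fun x hx => ?_⟩
    simp only [hd _ _ hx, eval_add, eval_mul, eval_C]
    linear_combination h1 x hx + c * h2 x hx

/-- Membership is required only where the coefficient is nonzero: σ is fixed for the whole sum, and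
truncations with indices of the other kind need not lie in the class. -/
theorem IsLaxOp.sum_smul {n m : ℕ} (s : Finset ℕ) (c κ : ℕ → ℝ) (F : ℕ → ℝ[X] →ₗ[ℝ] (ℝ → ℝ))
    (hF : ∀ j ∈ s, c j ≠ 0 → IsLaxOp n m (κ j) (F j)) :
    IsLaxOp n m (∑ j ∈ s, c j * κ j) (∑ j ∈ s, c j • F j) := by
  induction s using Finset.induction_on with
  | empty => simpa using IsLaxOp.zero n m
  | insert j s hj ih =>
    rw [Finset.sum_insert hj, Finset.sum_insert hj, add_comm, add_comm (c j • F j)]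
    have h1 := ih fun i hi => hF i (Finset.mem_insert_of_mem hi)
    by_cases hc : c j = 0
    · simpa [hc] using h1
    · exact h1.add_smul (hF j (Finset.mem_insert_self j s) hc) (c j)

end

/-! ### The truncations belong to the class -/

section

open Polynomial

theorem truncLin_apply (σ : ℝ) (K : ℕ) (p : ℝ[X]) : truncLin σ K p = truncF σ K p := rfl

theorem truncF_comm {σ : ℝ} {K N : ℕ} {u f : ℝ[X]} (hu : u.degree < (N + 1 : ℕ))
    (hf : f.degree < (N + 1 : ℕ)) : ∃ R : ℝ[X], R.degree < N ∧ ∀ x,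
      truncF σ K u x * f.eval x - truncF σ K f x * u.eval x = R.eval x := by
  refine ⟨C (1 / 2) * ((u /ₘ X ^ K) * f - (f /ₘ X ^ K) * u), ?_, fun x => ?_⟩
  · rw [degree_C_mul (by norm_num)]
    exact degree_trunc_commutator_lt hu hf
  · simp only [eval_mul, eval_sub, eval_C, truncF]; ring

theorem deriv_truncF_zero (K : ℕ) (p : ℝ[X]) (x : ℝ) :
    deriv (truncF 0 K p) x = (derivative (p /ₘ X ^ K)).eval x / 2 := by
  rw [(hasDerivAt_truncF K p (Or.inl rfl)).deriv]; simp

/-- For σ = 1 the operator is -½ ρ/x^K with ρ the remainder modulo x^K, and (ρ/x^K)' = (xρ' -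
Kρ)/x^{K+1}. -/
theorem deriv_truncF_one (K : ℕ) (p : ℝ[X]) {x : ℝ} (hx : x ≠ 0) :
    deriv (truncF 1 K p) x = -(x ^ (K + 1))⁻¹ * (euler K p).eval x / 2 := by
  rw [(hasDerivAt_truncF K p (Or.inr hx)).deriv]
  have h := congrArg (eval x) (X_pow_mul_derivative_div K p)
  simp only [eval_mul, eval_sub, eval_C, eval_pow, eval_X] at h
  have hxK := pow_ne_zero K hx
  have hinv : (x ^ (K + 1))⁻¹ * (x ^ K * x) = 1 := by
    rw [← pow_succ]; exact inv_mul_cancel₀ (pow_ne_zero _ hx)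
  have hinv' : (x ^ K)⁻¹ = (x ^ (K + 1))⁻¹ * x := by
    rw [pow_succ]; field_simp
  rw [hinv']
  rw [pow_succ] at h
  rw [pow_succ] at hinv ⊢
  linear_combination ((x ^ K * x)⁻¹ / 2) * h - (derivative (p /ₘ X ^ K)).eval x / 2 * hinv

theorem degree_derivative_lt {p : ℝ[X]} {N : ℕ} (h : p.degree < (N + 1 : ℕ)) :
    (derivative p).degree < N := by
  rw [degree_lt_iff_coeff_zero] at *
  intro i hi
  rw [coeff_derivative, h _ (by omega), zero_mul]

theorem degree_C_mul_lt {p : ℝ[X]} {N : ℕ} (a : ℝ) (h : p.degree < N) : (C a * p).degree < N := by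
  rw [degree_lt_iff_coeff_zero] at *
  intro i hi
  rw [coeff_C_mul, h _ hi, mul_zero]

theorem degree_X_pow_mul_lt {p : ℝ[X]} {N M k : ℕ} (h : p.degree < N) (hM : k + N ≤ M) :
    (X ^ k * p : ℝ[X]).degree < (M : WithBot ℕ) := by
  rw [degree_lt_iff_coeff_zero] at *
  intro i hi
  rw [coeff_X_pow_mul', if_pos (by omega), h _ (by omega)]

/-- The derivative of the quotient has degree < n-K, and x^m adds at most K when m ≤ K. For K = n
the quotient is constant, so m = n+1 is harmless; this is the exceptional index j = 1. -/
theorem truncF_zero_deriv_poly {n m K : ℕ} (hK : K = n ∨ m ≤ K) (hKn : K ≤ n) (f : ℝ[X])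
    (hf : f.degree < (n + 1 : ℕ)) : ∃ p : ℝ[X], p.degree < n ∧
      ∀ x, x ^ m * deriv (truncF 0 K f) x = p.eval x := by
  have h1 : (f /ₘ X ^ K).degree < ((n - K + 1 : ℕ) : WithBot ℕ) :=
    degree_div_X_pow_lt (by convert! hf using 2; omega)
  have h2 := degree_derivative_lt h1
  refine ⟨C (1 / 2) * (X ^ m * derivative (f /ₘ X ^ K)), degree_C_mul_lt _ ?_, fun x => ?_⟩
  · rcases hK with rfl | hK
    · have h0 : derivative (f /ₘ X ^ K) = 0 := by
        rw [← degree_eq_bot]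
        simpa using h2
      simp [h0]
    · exact degree_X_pow_mul_lt h2 (by omega)
  · rw [deriv_truncF_zero]
    simp only [eval_mul, eval_C, eval_pow, eval_X]; ring

/-- Here x^m absorbs the pole of order K+1, leaving x^{m-K-1} times a polynomial of degree < K; the
total degree is below m-1 ≤ n. -/
theorem truncF_one_deriv_poly {n m K : ℕ} (hK : K + 1 ≤ m) (hm : m ≤ n + 1) (f : ℝ[X]) :
    ∃ p : ℝ[X], p.degree < n ∧
      ∀ x, x ≠ 0 → x ^ m * deriv (truncF 1 K f) x = p.eval x := by
  refine ⟨C (-1 / 2) * (X ^ (m - K - 1) * euler K f), degree_C_mul_lt _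
    (degree_X_pow_mul_lt (degree_euler_lt K f) (by omega)), fun x hx => ?_⟩
  rw [deriv_truncF_one _ _ hx]
  have h : x ^ m = x ^ (K + 1) * x ^ (m - K - 1) := by rw [← pow_add]; congr 1; omega
  have hxK := pow_ne_zero (K + 1) hx
  rw [h]
  simp only [eval_mul, eval_C, eval_pow, eval_X]
  field_simp

/-- `x F' - 2 K F` for `F = 2 x^m (e x^n + h)`, without its leading term. -/
theorem euler_quad_degree {n m K : ℕ} {h : ℝ[X]} (hh : h.degree < n) (hm : m ≤ K + 1) :
    (X * derivative (2 * X ^ m * h) - C (2 * (K : ℝ)) * (2 * X ^ m * h) : ℝ[X]).degree <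
      ((n + K + 1 : ℕ) : WithBot ℕ) := by
  have h1 : (X ^ m * h : ℝ[X]).degree < ((n + K + 1 : ℕ) : WithBot ℕ) := degree_X_pow_mul_lt hh (by omega)
  rw [degree_lt_iff_coeff_zero] at *
  intro i hi
  have h2 : (2 * X ^ m * h : ℝ[X]) = C 2 * (X ^ m * h) := by rw [mul_assoc]; rfl
  rw [h2, coeff_sub, coeff_C_mul, coeff_C_mul, h1 i hi]
  cases i with
  | zero => simp
  | succ i => rw [coeff_X_mul, coeff_derivative, coeff_C_mul, h1 _ hi]; simp

theorem degree_mul_euler_add {n K : ℕ} {f g : ℝ[X]} (hf : f.degree < (n + 2 : ℕ))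
    (hg : g.degree < (n + 2 : ℕ)) :
    (euler K g * f + euler K f * g).degree < ((n + K + 1 : ℕ) : WithBot ℕ) := by
  have h : ((n + 1 + K : ℕ) : WithBot ℕ) = ((n + K + 1 : ℕ) : WithBot ℕ) := by
    congr 1; omega
  rw [← h]
  exact lt_of_le_of_lt (degree_add_le _ _) (max_lt
    (degree_mul_lt_add (degree_euler_lt K g) hf) (degree_mul_lt_add (degree_euler_lt K f) hg))

theorem degree_lt_of_X_pow_mul {p : ℝ[X]} {N k : ℕ} (h : (X ^ k * p).degree < ((N + k : ℕ) : WithBot ℕ)) :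
    p.degree < N := by
  rw [degree_lt_iff_coeff_zero] at *
  intro i hi
  have := h (i + k) (by omega)
  rwa [mul_comm, coeff_mul_X_pow] at this

/-- Isolates the only monomial that can exceed the degree bound: x d/dx - 2K multiplies x^{n+m} by
n+m-2K. -/
theorem two_mul_X_pow_euler (e : ℝ) (n m K : ℕ) (h : ℝ[X]) :
    X * derivative (2 * X ^ m * (C e * X ^ n + h)) - C (2 * (K : ℝ)) * (2 * X ^ m * (C e * X ^ n + h))
      = (X * derivative (2 * X ^ m * h) - C (2 * (K : ℝ)) * (2 * X ^ m * h)) +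
        C (2 * e * (n + m - 2 * K)) * X ^ (n + m) := by
  have h1 : X * derivative (2 * X ^ m * (C e * X ^ n) : ℝ[X]) = C (2 * e * (n + m)) * X ^ (n + m) := by
    have h2 : (2 * X ^ m * (C e * X ^ n) : ℝ[X]) = C (2 * e) * X ^ (n + m) := by
      rw [C_mul, pow_add, show (C 2 : ℝ[X]) = 2 from rfl]; ring
    rw [h2, derivative_C_mul, derivative_X_pow]
    rcases Nat.eq_zero_or_pos (n + m) with h0 | h0
    · have : (n : ℝ) + m = 0 := by exact_mod_cast h0
      simp [h0, this]
    · obtain ⟨k, hk⟩ : ∃ k, n + m = k + 1 := ⟨n + m - 1, by omega⟩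
      have hk' : (n : ℝ) + m = k + 1 := by exact_mod_cast hk
      rw [hk, hk']
      simp only [Nat.add_sub_cancel, C_mul, Nat.cast_add, Nat.cast_one]
      ring
  rw [mul_add, derivative_add, mul_add, h1]
  simp only [C_mul, C_sub, C_add, pow_add, show (C 2 : ℝ[X]) = 2 from rfl]
  ring

theorem degree_lt_of_bound {p q : ℝ[X]} {N : ℕ} (hp : p.degree < N) (hq : q.degree < N) (a b : ℝ) :
    (C a * p + C b * q).degree < N :=
  lt_of_le_of_lt (degree_add_le _ _) (max_lt (degree_C_mul_lt a hp) (degree_C_mul_lt b hq))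

/-- Let G be the given quadratic expression. By `X_pow_mul_derivative_div`, 2x^{K+1} times the left
side is xG' - 2KG - T, where every term of T has a factor of degree < K and one of degree ≤ n+1.
Hence deg T ≤ n+K, and only the leading term of xG' - 2KG can contribute beyond degree < n after
division by x^{K+1}. -/
theorem truncF_zero_quad {n m K : ℕ} (hK : m ≤ K ∨ K = n ∧ m = n + 1) {f₁ g₁ f₂ g₂ : ℝ[X]}
    (a₁ : f₁.degree < (n + 2 : ℕ)) (b₁ : g₁.degree < (n + 2 : ℕ))
    (a₂ : f₂.degree < (n + 2 : ℕ)) (b₂ : g₂.degree < (n + 2 : ℕ)) {e : ℝ} {h : ℝ[X]}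
    (hh : h.degree < n) (heq : f₁ * g₁ + f₂ * g₂ = 2 * X ^ m * (C e * X ^ n + h)) :
    ∃ p : ℝ[X], p.degree < n ∧ ∀ x,
      f₁.eval x * deriv (truncF 0 K g₁) x + g₁.eval x * deriv (truncF 0 K f₁) x +
        (f₂.eval x * deriv (truncF 0 K g₂) x + g₂.eval x * deriv (truncF 0 K f₂) x) =
        p.eval x + (if m ≤ K then 0 else 1) * e * x ^ n := by
  set κ : ℝ := if m ≤ K then 0 else 1 with hκ
  set p₀ : ℝ[X] := C (1 / 2) * (f₁ * derivative (g₁ /ₘ X ^ K) + g₁ * derivative (f₁ /ₘ X ^ K) +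
    (f₂ * derivative (g₂ /ₘ X ^ K) + g₂ * derivative (f₂ /ₘ X ^ K))) - C (κ * e) * X ^ n with hp₀
  set M : ℝ[X] := X * derivative (2 * X ^ m * h) - C (2 * (K : ℝ)) * (2 * X ^ m * h) with hM
  set T : ℝ[X] := (euler K g₁ * f₁ + euler K f₁ * g₁) + (euler K g₂ * f₂ + euler K f₂ * g₂) with hT
  have hTdeg : T.degree < ((n + K + 1 : ℕ) : WithBot ℕ) :=
    lt_of_le_of_lt (degree_add_le _ _) (max_lt (degree_mul_euler_add a₁ b₁)
      (degree_mul_euler_add a₂ b₂))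
  have hMdeg : M.degree < ((n + K + 1 : ℕ) : WithBot ℕ) := euler_quad_degree hh (by omega)
  -- For m ≤ K the exponent n+m is already within the bound. For K = n, m = n+1 the factor n+m-2K
  -- equals 1, and the monomial x^{2n+1} is exactly what κ e x^n removes.
  have hlead : ((C (e * (n + m - 2 * K)) * X ^ (n + m) - C (κ * e) * X ^ (n + K + 1) : ℝ[X])).degree <
      ((n + K + 1 : ℕ) : WithBot ℕ) := by
    by_cases hmK : m ≤ K
    · rw [hκ, if_pos hmK]
      simp only [zero_mul, C_0, sub_zero]
      exact lt_of_le_of_lt (degree_C_mul_X_pow_le _ _) (by exact_mod_cast by omega)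
    · obtain ⟨rfl, rfl⟩ := hK.resolve_left hmK
      rw [hκ, if_neg hmK]
      have : e * ((K : ℝ) + ((K + 1 : ℕ) : ℝ) - 2 * K) = 1 * e := by push_cast; ring
      rw [this, ← add_assoc, sub_self]
      simp
  have hkey : X ^ (K + 1) * p₀ = (C (e * (n + m - 2 * K)) * X ^ (n + m) -
      C (κ * e) * X ^ (n + K + 1)) + (C (1 / 2) * M + C (-1 / 2) * T) := by
    have e1 := X_pow_mul_derivative_div K f₁
    have e2 := X_pow_mul_derivative_div K f₂
    have e3 := X_pow_mul_derivative_div K g₁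
    have e4 := X_pow_mul_derivative_div K g₂
    have e5 := two_mul_X_pow_euler e n m K h
    have e6 := congrArg derivative heq
    simp only [derivative_add, derivative_mul (f := f₁), derivative_mul (f := f₂)] at e6
    rw [← hM, ← heq] at e5
    rw [heq] at e5
    have e7 : (C (2 * e * (n + m - 2 * K)) : ℝ[X]) = 2 * C (e * (n + m - 2 * K)) := by
      rw [mul_assoc, C_mul]; rfl
    have e8 : (2 : ℝ[X]) * C (1 / 2) = 1 := by
      rw [show (2 : ℝ[X]) = C 2 from rfl, ← C_mul]; norm_num
    have e9 : (C (-1 / 2) : ℝ[X]) = - C (1 / 2) := by rw [← C_neg]; norm_num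
    have e10 : (C (2 * (K : ℝ)) : ℝ[X]) = 2 * C (K : ℝ) := by rw [C_mul]; rfl
    rw [e7] at e5
    rw [e9, hp₀, hT]
    rw [e10] at e5
    linear_combination (C (1 / 2) : ℝ[X]) * (f₁ * e3 + g₁ * e1 + f₂ * e4 + g₂ * e2) +
      C (1 / 2) * X * e6 - 2 * C (1 / 2) * C (K : ℝ) * heq + C (1 / 2) * e5 +
      C (e * (n + m - 2 * K)) * X ^ (n + m) * e8
  refine ⟨p₀, degree_lt_of_X_pow_mul (k := K + 1) ?_, fun x => ?_⟩
  · rw [hkey]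
    exact lt_of_le_of_lt (degree_add_le _ _) (max_lt hlead (degree_lt_of_bound hMdeg hTdeg _ _))
  · simp only [deriv_truncF_zero, hp₀, eval_sub, eval_mul, eval_add, eval_C, eval_pow, eval_X]
    ring

/-- The left side is -T/(2x^{K+1}) with deg T ≤ n+K, so only divisibility of T by x^{K+1} is at
stake. Up to a multiple of x^{K+1}, T is xG' - 2KG with G = 2x^m E, and m ≥ K+1. -/
theorem truncF_one_quad {n m K : ℕ} (hK : K + 1 ≤ m) {f₁ g₁ f₂ g₂ : ℝ[X]}
    (a₁ : f₁.degree < (n + 2 : ℕ)) (b₁ : g₁.degree < (n + 2 : ℕ))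
    (a₂ : f₂.degree < (n + 2 : ℕ)) (b₂ : g₂.degree < (n + 2 : ℕ)) {e : ℝ} {h : ℝ[X]}
    (heq : f₁ * g₁ + f₂ * g₂ = 2 * X ^ m * (C e * X ^ n + h)) :
    ∃ p : ℝ[X], p.degree < n ∧ ∀ x, x ≠ 0 →
      f₁.eval x * deriv (truncF 1 K g₁) x + g₁.eval x * deriv (truncF 1 K f₁) x +
        (f₂.eval x * deriv (truncF 1 K g₂) x + g₂.eval x * deriv (truncF 1 K f₂) x) =
        p.eval x := by
  set E : ℝ[X] := C e * X ^ n + h with hE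
  obtain ⟨a, rfl⟩ : ∃ a, m = K + 1 + a := ⟨m - (K + 1), by omega⟩
  set p₀ : ℝ[X] := C (1 / 2) * (f₁ * derivative (g₁ /ₘ X ^ K) + g₁ * derivative (f₁ /ₘ X ^ K) +
    (f₂ * derivative (g₂ /ₘ X ^ K) + g₂ * derivative (f₂ /ₘ X ^ K))) -
    X ^ a * (C (((K + 1 + a : ℕ) : ℝ) - 2 * K) * E + X * derivative E) with hp₀
  set T : ℝ[X] := (euler K g₁ * f₁ + euler K f₁ * g₁) + (euler K g₂ * f₂ + euler K f₂ * g₂) with hT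
  have hTdeg : T.degree < ((n + K + 1 : ℕ) : WithBot ℕ) :=
    lt_of_le_of_lt (degree_add_le _ _) (max_lt (degree_mul_euler_add a₁ b₁)
      (degree_mul_euler_add a₂ b₂))
  have hkey : X ^ (K + 1) * p₀ = C (-1 / 2) * T := by
    have e1 := X_pow_mul_derivative_div K f₁
    have e2 := X_pow_mul_derivative_div K f₂
    have e3 := X_pow_mul_derivative_div K g₁
    have e4 := X_pow_mul_derivative_div K g₂
    have e5 : derivative (2 * X ^ (K + 1 + a) * E) =
        2 * (C (((K + 1 + a : ℕ) : ℝ)) * X ^ (K + a) * E + X ^ (K + 1 + a) * derivative E) := by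
      rw [derivative_mul, derivative_mul, derivative_X_pow, derivative_ofNat,
        show K + 1 + a - 1 = K + a by omega]
      ring
    have e6 := congrArg derivative heq
    simp only [derivative_add, derivative_mul (f := f₁), derivative_mul (f := f₂)] at e6
    rw [e5] at e6
    have e8 : (2 : ℝ[X]) * C (1 / 2) = 1 := by
      rw [show (2 : ℝ[X]) = C 2 from rfl, ← C_mul]; norm_num
    have e9 : (C (-1 / 2) : ℝ[X]) = - C (1 / 2) := by rw [← C_neg]; norm_num
    have e10 : (C (((K + 1 + a : ℕ) : ℝ) - 2 * K) : ℝ[X]) =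
      C (((K + 1 + a : ℕ) : ℝ)) - 2 * C (K : ℝ) := by rw [C_sub, C_mul]; rfl
    rw [e9, hp₀, hT, e10]
    linear_combination (C (1 / 2) : ℝ[X]) * (f₁ * e3 + g₁ * e1 + f₂ * e4 + g₂ * e2) +
      C (1 / 2) * X * e6 - 2 * C (1 / 2) * C (K : ℝ) * heq +
      (X ^ (K + 1) * X ^ a * (C (((K + 1 + a : ℕ) : ℝ)) * E + X * derivative E -
        2 * C (K : ℝ) * E)) * e8
  refine ⟨p₀, degree_lt_of_X_pow_mul (k := K + 1) ?_, fun x hx => ?_⟩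
  · rw [hkey]
    exact degree_C_mul_lt _ hTdeg
  · have h := congrArg (eval x) hkey
    have hxK := pow_ne_zero (K + 1) hx
    simp only [deriv_truncF_one _ _ hx]
    apply mul_left_cancel₀ hxK
    rw [eval_mul, eval_pow, eval_X] at h
    rw [h, hT]
    simp only [eval_mul, eval_add, eval_C]
    field_simp
    ring

/-- The truncation operators which belong to the indices `1, …, n`. -/
theorem isLaxOp_truncLin {n m j : ℕ} {σ : ℝ} (hm : m ≤ n + 1) (hj : 1 ≤ j) (hjn : j ≤ n)
    (h : σ = 0 ∧ FirstKind n m j ∨ σ = 1 ∧ ¬ FirstKind n m j) :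
    IsLaxOp n m (if m = n + 1 ∧ j = 1 then 1 else 0) (truncLin σ (n + 1 - j)) := by
  unfold FirstKind at h
  have hx' : ∀ {x : ℝ}, (m = 0 ∨ x ≠ 0) → (σ = 0 ∨ x ≠ 0) := by
    intro x hx
    rcases h with ⟨rfl, -⟩ | ⟨-, h⟩
    · exact Or.inl rfl
    · exact Or.inr (hx.resolve_left (by omega))
  refine ⟨fun p x hx => contDiffAt_truncF _ p (hx' hx), fun l q => ⟨_, fun x _ =>
    truncF_shift σ (by omega) l q x⟩, fun N u f hu hf => ?_, fun f hf => ?_,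
    fun f₁ g₁ f₂ g₂ a₁ a₂ a₃ a₄ e p hp heq => ?_⟩
  · obtain ⟨R, hR, h1⟩ := truncF_comm (σ := σ) (K := n + 1 - j) hu hf
    exact ⟨R, hR, fun x _ => h1 x⟩
  · rcases h with ⟨rfl, h⟩ | ⟨rfl, h⟩
    · obtain ⟨p, hp, h1⟩ := truncF_zero_deriv_poly (n := n) (m := m) (K := n + 1 - j) (by omega)
        (by omega) f hf
      exact ⟨p, hp, fun x _ => h1 x⟩
    · obtain ⟨p, hp, h1⟩ := truncF_one_deriv_poly (n := n) (m := m) (K := n + 1 - j) (by omega) hm f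
      exact ⟨p, hp, fun x hx => h1 x (hx.resolve_left (by omega))⟩
  · rcases h with ⟨rfl, h⟩ | ⟨rfl, h⟩
    · obtain ⟨q, hq, h1⟩ := truncF_zero_quad (n := n) (m := m) (K := n + 1 - j) (by omega)
        a₁ a₂ a₃ a₄ hp heq
      refine ⟨q, hq, fun x _ => ?_⟩
      have h2 : (if m = n + 1 ∧ j = 1 then (1 : ℝ) else 0) = if m ≤ n + 1 - j then 0 else 1 := by
        split_ifs <;> first | rfl | omega
      rw [h2]
      exact h1 x
    · obtain ⟨q, hq, h1⟩ := truncF_one_quad (n := n) (m := m) (K := n + 1 - j) (by omega)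
        a₁ a₂ a₃ a₄ heq
      refine ⟨q, hq, fun x hx => ?_⟩
      rw [if_neg (by omega), zero_mul, zero_mul, add_zero]
      exact h1 x (hx.resolve_left (by omega))

end

section

open Polynomial Filter Topology

/-! ### Families of polynomials with differentiable coefficients -/

variable {E : Type*} [NormedAddCommGroup E] [NormedSpace ℝ E]

/-- All the coefficients of `p` are differentiable at `z`. -/
def CoeffDiff (p : E → ℝ[X]) (z : E) : Prop :=
  ∀ l, DifferentiableAt ℝ (fun y => (p y).coeff l) z

theorem CoeffDiff.const (p : ℝ[X]) (z : E) : CoeffDiff (fun _ => p) z :=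
  fun _ => differentiableAt_const _

theorem CoeffDiff.C {a : E → ℝ} {z : E} (h : DifferentiableAt ℝ a z) :
    CoeffDiff (fun y => C (a y)) z := by
  intro l
  simp only [coeff_C]
  split_ifs
  · exact h
  · exact differentiableAt_const _

theorem CoeffDiff.add {p q : E → ℝ[X]} {z : E} (hp : CoeffDiff p z) (hq : CoeffDiff q z) :
    CoeffDiff (fun y => p y + q y) z := by
  intro l
  simp only [coeff_add]
  exact (hp l).add (hq l)

theorem CoeffDiff.sub {p q : E → ℝ[X]} {z : E} (hp : CoeffDiff p z) (hq : CoeffDiff q z) :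
    CoeffDiff (fun y => p y - q y) z := by
  intro l
  simp only [coeff_sub]
  exact (hp l).sub (hq l)

theorem CoeffDiff.neg {p : E → ℝ[X]} {z : E} (hp : CoeffDiff p z) :
    CoeffDiff (fun y => -p y) z := by
  intro l
  simp only [coeff_neg]
  exact (hp l).neg

theorem CoeffDiff.mul {p q : E → ℝ[X]} {z : E} (hp : CoeffDiff p z) (hq : CoeffDiff q z) :
    CoeffDiff (fun y => p y * q y) z := by
  intro l
  simp only [coeff_mul]
  exact DifferentiableAt.fun_sum fun x _ => (hp _).mul (hq _)

theorem CoeffDiff.sum {ι : Type*} (s : Finset ι) {p : ι → E → ℝ[X]} {z : E}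
    (hp : ∀ i ∈ s, CoeffDiff (p i) z) : CoeffDiff (fun y => ∑ i ∈ s, p i y) z := by
  intro l
  simp only [finsetSum_coeff]
  exact DifferentiableAt.fun_sum fun x hx => hp x hx l

theorem CoeffDiff.prod {ι : Type*} (s : Finset ι) {p : ι → E → ℝ[X]} {z : E}
    (hp : ∀ i ∈ s, CoeffDiff (p i) z) : CoeffDiff (fun y => ∏ i ∈ s, p i y) z := by
  classical
  induction s using Finset.induction_on with
  | empty => simpa using CoeffDiff.const (1 : ℝ[X]) z
  | insert i s hi ih =>
    simp only [Finset.prod_insert hi]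
    exact (hp i (Finset.mem_insert_self i s)).mul
      (ih fun j hj => hp j (Finset.mem_insert_of_mem hj))

theorem eval_eq_sum_of_degree_lt {p : ℝ[X]} {N : ℕ} (h : p.degree < N) (x : ℝ) :
    p.eval x = ∑ l ∈ Finset.range N, p.coeff l * x ^ l := by
  rcases eq_or_ne p 0 with rfl | h0
  · simp
  · exact eval_eq_sum_range' ((natDegree_lt_iff_degree_lt h0).mpr h) x

/-- The locally uniform degree bound turns evaluation into a fixed finite sum; differentiable
coefficients alone would not suffice. -/
theorem CoeffDiff.eval {p : E → ℝ[X]} {z : E} (hp : CoeffDiff p z) {N : ℕ}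
    (hN : ∀ᶠ y in 𝓝 z, (p y).degree < N) {g : E → ℝ} (hg : DifferentiableAt ℝ g z) :
    DifferentiableAt ℝ (fun y => (p y).eval (g y)) z := by
  have h : DifferentiableAt ℝ (fun y => ∑ l ∈ Finset.range N, (p y).coeff l * g y ^ l) z :=
    DifferentiableAt.fun_sum fun l _ => (hp l).mul (hg.pow l)
  refine h.congr_of_eventuallyEq ?_
  filter_upwards [hN] with y hy
  exact eval_eq_sum_of_degree_lt hy _

/-- Compare coefficients at x^{n+i} in P = R + u q: the remainder does not reach this degree and u
is monic, so q is computed from the top down. -/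
theorem coeff_divByMonic_rec {u P : ℝ[X]} {n : ℕ} (hu : u.Monic) (hn : u.natDegree = n) (i : ℕ) :
    (P /ₘ u).coeff i =
      P.coeff (n + i) - ∑ a ∈ Finset.range n, u.coeff a * (P /ₘ u).coeff (n + i - a) := by
  have h := congrArg (fun q => q.coeff (n + i)) (modByMonic_add_div P u)
  have h1 : (P %ₘ u).coeff (n + i) = 0 := by
    refine coeff_eq_zero_of_degree_lt (lt_of_lt_of_le (degree_modByMonic_lt P hu) ?_)
    rw [degree_eq_natDegree hu.ne_zero, hn]
    exact_mod_cast Nat.le_add_right n i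
  have h2 : ∀ a ∈ Finset.range i, u.coeff (n + 1 + a) * (P /ₘ u).coeff (n + i - (n + 1 + a)) = 0 := by
    intro a _
    rw [coeff_eq_zero_of_natDegree_lt (by omega), zero_mul]
  simp only [coeff_add, h1, zero_add, coeff_mul] at h
  rw [Finset.Nat.sum_antidiagonal_eq_sum_range_succ_mk,
    show (n + i).succ = (n + 1) + i by omega, Finset.sum_range_add, Finset.sum_eq_zero h2, add_zero,
    Finset.sum_range_succ] at h
  have h3 : u.coeff n = 1 := by rw [← hn]; exact hu
  rw [← h, h3]
  simp

theorem CoeffDiff.divByMonic {u P : E → ℝ[X]} {z : E} {n N : ℕ} (hu : ∀ y, (u y).Monic)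
    (hn : ∀ y, (u y).natDegree = n) (hP : ∀ y, (P y).degree < N) (hud : CoeffDiff u z)
    (hPd : CoeffDiff P z) : CoeffDiff (fun y => P y /ₘ u y) z := by
  -- Downward induction on the index: k bounds how far i lies below N, where the coefficients
  -- vanish.
  have key : ∀ k i, N ≤ i + k → DifferentiableAt ℝ (fun y => (P y /ₘ u y).coeff i) z := by
    intro k
    induction k with
    | zero =>
      intro i hi
      have h0 : (fun y => (P y /ₘ u y).coeff i) = fun _ => 0 := by
        funext y
        exact coeff_eq_zero_of_degree_lt (lt_of_le_of_lt (degree_divByMonic_le _ _)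
          (lt_of_lt_of_le (hP y) (by exact_mod_cast hi)))
      rw [h0]
      exact differentiableAt_const _
    | succ k ih =>
      intro i hi
      have h0 : (fun y => (P y /ₘ u y).coeff i) = fun y => (P y).coeff (n + i) -
          ∑ a ∈ Finset.range n, (u y).coeff a * (P y /ₘ u y).coeff (n + i - a) := by
        funext y
        exact coeff_divByMonic_rec (hu y) (hn y) i
      rw [h0]
      refine (hPd _).sub (DifferentiableAt.fun_sum fun a ha => (hud a).mul (ih _ ?_))
      rw [Finset.mem_range] at ha
      omega
  exact fun i => key N i (by omega)

/-- Coefficientwise derivative of a one-parameter family of polynomials. -/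
def HasPolyDeriv (p : ℝ → ℝ[X]) (p' : ℝ[X]) (s : ℝ) : Prop :=
  ∀ l, HasDerivAt (fun y => (p y).coeff l) (p'.coeff l) s

theorem CoeffDiff.exists_hasPolyDeriv {p : ℝ → ℝ[X]} {s : ℝ} (hp : CoeffDiff p s) {N : ℕ}
    (hN : ∀ᶠ y in 𝓝 s, (p y).degree < N) : ∃ p' : ℝ[X], p'.degree < N ∧ HasPolyDeriv p p' s := by
  refine ⟨∑ l ∈ Finset.range N, Polynomial.C (deriv (fun y => (p y).coeff l) s) * X ^ l, ?_, ?_⟩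
  · rw [← mem_degreeLT]
    refine Submodule.sum_mem _ fun k hk => ?_
    rw [mem_degreeLT]
    exact lt_of_le_of_lt (degree_C_mul_X_pow_le _ _) (by exact_mod_cast Finset.mem_range.mp hk)
  · intro l
    simp only [finsetSum_coeff, coeff_C_mul_X_pow, Finset.sum_ite_eq, Finset.mem_range]
    split_ifs with hl
    · exact (hp l).hasDerivAt
    · refine (hasDerivAt_const s (0 : ℝ)).congr_of_eventuallyEq ?_
      filter_upwards [hN] with y hy
      exact coeff_eq_zero_of_degree_lt (lt_of_lt_of_le hy (by exact_mod_cast not_lt.mp hl))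

theorem HasPolyDeriv.unique {p : ℝ → ℝ[X]} {p' q' : ℝ[X]} {s : ℝ} (hp : HasPolyDeriv p p' s)
    (hq : HasPolyDeriv p q' s) : p' = q' := by
  ext l
  exact (hp l).unique (hq l)

theorem HasPolyDeriv.congr {p q : ℝ → ℝ[X]} {p' : ℝ[X]} {s : ℝ} (hp : HasPolyDeriv p p' s)
    (h : ∀ᶠ y in 𝓝 s, q y = p y) : HasPolyDeriv q p' s := by
  intro l
  refine (hp l).congr_of_eventuallyEq ?_
  filter_upwards [h] with y hy
  rw [hy]

theorem HasPolyDeriv.const (p : ℝ[X]) (s : ℝ) : HasPolyDeriv (fun _ => p) 0 s := by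
  intro l
  simpa using hasDerivAt_const s (p.coeff l)

theorem HasPolyDeriv.C {a : ℝ → ℝ} {a' s : ℝ} (h : HasDerivAt a a' s) :
    HasPolyDeriv (fun y => C (a y)) (C a') s := by
  intro l
  simp only [coeff_C]
  split_ifs
  · exact h
  · exact hasDerivAt_const _ _

theorem HasPolyDeriv.add {p q : ℝ → ℝ[X]} {p' q' : ℝ[X]} {s : ℝ} (hp : HasPolyDeriv p p' s)
    (hq : HasPolyDeriv q q' s) : HasPolyDeriv (fun y => p y + q y) (p' + q') s := by
  intro l
  simp only [coeff_add]
  exact (hp l).add (hq l)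

theorem HasPolyDeriv.sub {p q : ℝ → ℝ[X]} {p' q' : ℝ[X]} {s : ℝ} (hp : HasPolyDeriv p p' s)
    (hq : HasPolyDeriv q q' s) : HasPolyDeriv (fun y => p y - q y) (p' - q') s := by
  intro l
  simp only [coeff_sub]
  exact (hp l).sub (hq l)

theorem HasPolyDeriv.neg {p : ℝ → ℝ[X]} {p' : ℝ[X]} {s : ℝ} (hp : HasPolyDeriv p p' s) :
    HasPolyDeriv (fun y => -p y) (-p') s := by
  intro l
  simp only [coeff_neg]
  exact (hp l).neg

theorem HasPolyDeriv.mul {p q : ℝ → ℝ[X]} {p' q' : ℝ[X]} {s : ℝ} (hp : HasPolyDeriv p p' s)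
    (hq : HasPolyDeriv q q' s) : HasPolyDeriv (fun y => p y * q y) (p' * q s + p s * q') s := by
  intro l
  simp only [coeff_add, coeff_mul, ← Finset.sum_add_distrib]
  exact HasDerivAt.fun_sum fun x _ => (hp _).mul (hq _)

theorem HasPolyDeriv.eval {p : ℝ → ℝ[X]} {p' : ℝ[X]} {s : ℝ} (hp : HasPolyDeriv p p' s) {N : ℕ}
    (hN : ∀ᶠ y in 𝓝 s, (p y).degree < N) {g : ℝ → ℝ} {g' : ℝ} (hg : HasDerivAt g g' s) :
    HasDerivAt (fun y => (p y).eval (g y))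
      (p'.eval (g s) + (derivative (p s)).eval (g s) * g') s := by
  obtain ⟨q, hq, hpq⟩ := CoeffDiff.exists_hasPolyDeriv
    (fun l => (hp l).differentiableAt) hN
  obtain rfl := hp.unique hpq
  have h : HasDerivAt (fun y => ∑ l ∈ Finset.range N, (p y).coeff l * g y ^ l)
      (∑ l ∈ Finset.range N, (p'.coeff l * g s ^ l +
        (p s).coeff l * ((l : ℝ) * g s ^ (l - 1) * g'))) s :=
    HasDerivAt.fun_sum fun l _ => (hp l).mul (hg.pow l)
  refine (h.congr_deriv ?_).congr_of_eventuallyEq ?_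
  · rw [Finset.sum_add_distrib, ← eval_eq_sum_of_degree_lt hq]
    congr 1
    have hs := hN.self_of_nhds
    have h2 : derivative (p s) = ∑ l ∈ Finset.range N, Polynomial.C ((p s).coeff l * l) * X ^ (l - 1) := by
      conv_lhs => rw [show p s = ∑ l ∈ Finset.range N, Polynomial.C ((p s).coeff l) * X ^ l from by
        ext i
        simp only [finsetSum_coeff, coeff_C_mul_X_pow, Finset.sum_ite_eq, Finset.mem_range]
        split_ifs with hi
        · rfl
        · exact coeff_eq_zero_of_degree_lt (lt_of_lt_of_le hs (by exact_mod_cast not_lt.mp hi))]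
      simp only [derivative_sum, derivative_C_mul_X_pow]
    rw [h2, eval_finsetSum, Finset.sum_mul]
    refine Finset.sum_congr rfl fun l _ => ?_
    simp only [eval_mul, eval_C, eval_pow, eval_X]
    ring
  · filter_upwards [hN] with y hy
    exact eval_eq_sum_of_degree_lt hy _

/-! ### Derivatives of interpolants -/

theorem eventually_injective {Y : Type*} [TopologicalSpace Y] {n : ℕ} {l : Y → Fin n → ℝ} {z : Y}
    (hl : ∀ i, ContinuousAt (fun y => l y i) z) (h : Function.Injective (l z)) :
    ∀ᶠ y in 𝓝 z, Function.Injective (l y) := by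
  have h1 : ∀ i j : Fin n, i ≠ j → ∀ᶠ y in 𝓝 z, l y i ≠ l y j := by
    intro i j hij
    have h2 : ContinuousAt (fun y => l y i - l y j) z := (hl i).sub (hl j)
    have h3 : l z i - l z j ≠ 0 := sub_ne_zero.mpr fun h4 => hij (h h4)
    filter_upwards [h2.eventually_ne h3] with y hy
    exact sub_ne_zero.mp hy
  have h2 : ∀ᶠ y in 𝓝 z, ∀ i j : Fin n, i ≠ j → l y i ≠ l y j := by
    simp only [eventually_all]
    intro i j hij
    exact h1 i j hij
  filter_upwards [h2] with y hy i j hij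
  by_contra h3
  exact hy i j h3 hij

theorem CoeffDiff.interpolate {n : ℕ} {l r : E → Fin n → ℝ} {z : E}
    (hl : ∀ i, DifferentiableAt ℝ (fun y => l y i) z)
    (hr : ∀ i, DifferentiableAt ℝ (fun y => r y i) z) (h : Function.Injective (l z)) :
    CoeffDiff (fun y => Lagrange.interpolate Finset.univ (l y) (r y)) z := by
  simp only [Lagrange.interpolate_apply, Lagrange.basis, Lagrange.basisDivisor]
  refine CoeffDiff.sum _ fun i _ => (CoeffDiff.C (hr i)).mul (CoeffDiff.prod _ fun j hj =>
    (CoeffDiff.C (((hl i).sub (hl j)).inv ?_)).mul ((CoeffDiff.const _ _).sub (CoeffDiff.C (hl j))))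
  exact sub_ne_zero.mpr fun h4 => (Finset.ne_of_mem_erase hj) (h h4).symm

theorem degree_interpolate_lt' {n : ℕ} {l : Fin n → ℝ} (h : Function.Injective l) (r : Fin n → ℝ) :
    (Lagrange.interpolate Finset.univ l r).degree < n := by
  have := Lagrange.degree_interpolate_lt (s := Finset.univ) (v := l) r h.injOn
  rwa [Finset.card_univ, Fintype.card_fin] at this

theorem eval_interpolate' {n : ℕ} {l : Fin n → ℝ} (h : Function.Injective l) (r : Fin n → ℝ)
    (i : Fin n) : (Lagrange.interpolate Finset.univ l r).eval (l i) = r i :=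
  Lagrange.eval_interpolate_at_node r h.injOn (Finset.mem_univ i)

theorem eq_interpolate' {n : ℕ} {l : Fin n → ℝ} (h : Function.Injective l) {p : ℝ[X]}
    (hp : p.degree < n) {r : Fin n → ℝ} (hr : ∀ i, p.eval (l i) = r i) :
    p = Lagrange.interpolate Finset.univ l r :=
  Lagrange.eq_interpolate_of_eval_eq _ h.injOn (by rwa [Finset.card_univ, Fintype.card_fin])
    fun i _ => hr i

/-- Near s the nodes stay distinct and P(l_i) = r_i may be differentiated; the chain rule term
P'(l_i) l_i' accounts for the moving node. The derivative has degree < n, so these values determine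
it. -/
theorem hasPolyDeriv_interpolate {n : ℕ} {l r : ℝ → Fin n → ℝ} {l' r' : Fin n → ℝ} {s : ℝ}
    (hl : ∀ i, HasDerivAt (fun y => l y i) (l' i) s) (hr : ∀ i, HasDerivAt (fun y => r y i) (r' i) s)
    (h : Function.Injective (l s)) :
    HasPolyDeriv (fun y => Lagrange.interpolate Finset.univ (l y) (r y))
      (Lagrange.interpolate Finset.univ (l s) fun i => r' i -
        (derivative (Lagrange.interpolate Finset.univ (l s) (r s))).eval (l s i) * l' i) s := by
  have hinj : ∀ᶠ y in 𝓝 s, Function.Injective (l y) :=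
    eventually_injective (fun i => (hl i).continuousAt) h
  have hN : ∀ᶠ y in 𝓝 s, (Lagrange.interpolate Finset.univ (l y) (r y)).degree < n := by
    filter_upwards [hinj] with y hy
    exact degree_interpolate_lt' hy _
  obtain ⟨q, hq, hpq⟩ := (CoeffDiff.interpolate (fun i => (hl i).differentiableAt)
    (fun i => (hr i).differentiableAt) h).exists_hasPolyDeriv hN
  rw [← eq_interpolate' h hq fun i => ?_]
  · exact hpq
  · have h1 := hpq.eval hN (hl i)
    have h2 : HasDerivAt (fun y => (Lagrange.interpolate Finset.univ (l y) (r y)).eval (l y i))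
        (r' i) s := by
      refine (hr i).congr_of_eventuallyEq ?_
      filter_upwards [hinj] with y hy
      exact eval_interpolate' hy _ i
    linear_combination h1.unique h2

end

section

open Polynomial Filter Topology

/-! ### The polynomial `u` and its cofactors -/

/-- `u(x) / (x - λ_k)`. -/
def cofac {n : ℕ} (lam : Fin n → ℝ) (k : Fin n) : ℝ[X] :=
  ∏ j ∈ Finset.univ.erase k, (X - C (lam j))

variable {n : ℕ} {lam : Fin n → ℝ}

theorem uPoly_monic (lam : Fin n → ℝ) : (uPoly lam).Monic :=
  monic_prod_of_monic _ _ fun i _ => monic_X_sub_C (lam i)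

theorem uPoly_natDegree (lam : Fin n → ℝ) : (uPoly lam).natDegree = n := by
  rw [uPoly, natDegree_finsetProd_X_sub_C_eq_card]; simp

theorem uPoly_degree (lam : Fin n → ℝ) : (uPoly lam).degree = n := by
  rw [degree_eq_natDegree (uPoly_monic lam).ne_zero, uPoly_natDegree]

theorem uPoly_degree_lt (lam : Fin n → ℝ) : (uPoly lam).degree < (n + 1 : ℕ) := by
  rw [uPoly_degree]; exact_mod_cast Nat.lt_succ_self n

theorem mul_cofac (lam : Fin n → ℝ) (k : Fin n) : (X - C (lam k)) * cofac lam k = uPoly lam :=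
  Finset.mul_prod_erase _ (fun i => X - C (lam i)) (Finset.mem_univ k)

theorem uPoly_eval_node (lam : Fin n → ℝ) (i : Fin n) : (uPoly lam).eval (lam i) = 0 := by
  rw [← mul_cofac lam i]; simp

theorem cofac_monic (lam : Fin n → ℝ) (k : Fin n) : (cofac lam k).Monic :=
  monic_prod_of_monic _ _ fun i _ => monic_X_sub_C (lam i)

theorem cofac_natDegree (lam : Fin n → ℝ) (k : Fin n) : (cofac lam k).natDegree = n - 1 := by
  rw [cofac, natDegree_finsetProd_X_sub_C_eq_card]; simp

theorem cofac_degree_lt (lam : Fin n → ℝ) (k : Fin n) : (cofac lam k).degree < n := by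
  rw [degree_eq_natDegree (cofac_monic lam k).ne_zero, cofac_natDegree]
  exact_mod_cast Nat.sub_lt k.pos one_pos

theorem cofac_coeff_pred (lam : Fin n → ℝ) (k : Fin n) : (cofac lam k).coeff (n - 1) = 1 := by
  rw [← cofac_natDegree lam k]; exact cofac_monic lam k

theorem cofac_eval_self (lam : Fin n → ℝ) (k : Fin n) :
    (cofac lam k).eval (lam k) = Delta lam k := by
  simp [cofac, Delta, eval_prod]

theorem cofac_eval_ne (lam : Fin n → ℝ) {i k : Fin n} (h : i ≠ k) :
    (cofac lam k).eval (lam i) = 0 := by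
  rw [cofac, eval_prod]
  exact Finset.prod_eq_zero (Finset.mem_erase.mpr ⟨h, Finset.mem_univ i⟩) (by simp)

theorem Delta_ne_zero (h : Function.Injective lam) (k : Fin n) : Delta lam k ≠ 0 :=
  Finset.prod_ne_zero_iff.mpr fun _ hj =>
    sub_ne_zero.mpr fun h' => (Finset.ne_of_mem_erase hj) (h h').symm

theorem derivative_uPoly_eval (lam : Fin n → ℝ) (k : Fin n) :
    (derivative (uPoly lam)).eval (lam k) = Delta lam k := by
  rw [← mul_cofac lam k, derivative_mul]
  simp [cofac_eval_self]

theorem derivative_cofac_eval (lam : Fin n → ℝ) {i k : Fin n} (h : i ≠ k) :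
    (lam k - lam i) * (derivative (cofac lam i)).eval (lam k) = Delta lam k := by
  rw [← derivative_uPoly_eval lam k, ← mul_cofac lam i, derivative_mul]
  simp [cofac_eval_ne lam h.symm]

theorem basis_eq_cofac (lam : Fin n → ℝ) (i : Fin n) :
    Lagrange.basis Finset.univ lam i = C (Delta lam i)⁻¹ * cofac lam i := by
  simp only [Lagrange.basis, Lagrange.basisDivisor, Finset.prod_mul_distrib, cofac, Delta]
  rw [← Finset.prod_inv_distrib, map_prod]

theorem interpolate_eq_cofac (lam r : Fin n → ℝ) :
    Lagrange.interpolate Finset.univ lam r = ∑ i, C (r i / Delta lam i) * cofac lam i := by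
  rw [Lagrange.interpolate_apply]
  refine Finset.sum_congr rfl fun i _ => ?_
  rw [basis_eq_cofac, ← mul_assoc, ← C_mul, div_eq_mul_inv]

theorem vPoly_eq_interpolate (m : ℕ) (lam mu : Fin n → ℝ) :
    vPoly m lam mu = Lagrange.interpolate Finset.univ lam fun i => lam i ^ m * mu i := rfl

theorem phiPoly_eval (δ : ℕ → ℝ) (x : ℝ) :
    (phiPoly n δ).eval x = ∑ γ ∈ Finset.range (n + 2), δ γ * x ^ γ := by
  simp [phiPoly, eval_finsetSum]

theorem Phi_eq (m : ℕ) (δ : ℕ → ℝ) (ε x y : ℝ) :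
    Phi n m δ ε x y = x ^ m * y ^ 2 / 2 - (phiPoly n δ).eval x * y - ε * x ^ n := by
  rw [phiPoly_eval, Phi, Finset.sum_mul]
  simp only [smul_eq_mul, mul_assoc]
  ring

/-! ### Partial derivatives of the Stäckel Hamiltonians -/

theorem hasDerivAt_update {ι : Type*} [DecidableEq ι] (a : ι → ℝ) (k i : ι) :
    HasDerivAt (fun s => Function.update a k s i) (if i = k then 1 else 0) (a k) := by
  by_cases h : i = k
  · subst h
    simpa using hasDerivAt_id' (a i)
  · simpa [h] using hasDerivAt_const (a k) (a i)

/-- `½ x^m y² - φ(x) y - e x^n` differentiated in `x`. -/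
def PhiX (n m : ℕ) (δ : ℕ → ℝ) (ε x y : ℝ) : ℝ :=
  (m * x ^ (m - 1)) * y ^ 2 / 2 - (derivative (phiPoly n δ)).eval x * y - ε * (n * x ^ (n - 1))

theorem hasDerivAt_Phi (m : ℕ) (δ : ℕ → ℝ) (ε : ℝ) {f g : ℝ → ℝ} {f' g' s : ℝ}
    (hf : HasDerivAt f f' s) (hg : HasDerivAt g g' s) :
    HasDerivAt (fun y => Phi n m δ ε (f y) (g y)) (PhiX n m δ ε (f s) (g s) * f' +
      (f s ^ m * g s - (phiPoly n δ).eval (f s)) * g') s := by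
  have h : (fun y => Phi n m δ ε (f y) (g y)) = fun y => f y ^ m * g y ^ 2 / 2 -
      (phiPoly n δ).eval (f y) * g y - ε * f y ^ n := by
    funext y; exact Phi_eq m δ ε _ _
  rw [h]
  have h1 : HasDerivAt (fun y => (phiPoly n δ).eval (f y))
      ((derivative (phiPoly n δ)).eval (f s) * f') s := by
    have h2 := ((phiPoly n δ).hasDerivAt (f s)).comp s hf
    exact h2
  refine (((((hf.pow m).mul (hg.pow 2)).div_const 2).sub (h1.mul hg)).sub
    ((hf.pow n).const_mul ε)).congr_deriv ?_
  simp only [PhiX]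
  push_cast
  simp only [Pi.pow_apply]
  ring

theorem coeff_interpolate_single (lam : Fin n → ℝ) (k : Fin n) (c : ℝ) (l : ℕ) :
    (Lagrange.interpolate Finset.univ lam fun i => c * if i = k then 1 else 0).coeff l =
      c / Delta lam k * (cofac lam k).coeff l := by
  rw [interpolate_eq_cofac]
  simp only [finsetSum_coeff, coeff_C_mul]
  rw [Finset.sum_eq_single k]
  · simp
  · intro i _ hi; simp [hi]
  · simp

/-- The interpolant of the values `Φ(λ_i, μ_i)`. -/
def hPoly (n m : ℕ) (δ : ℕ → ℝ) (ε : ℝ) (lam mu : Fin n → ℝ) : ℝ[X] :=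
  Lagrange.interpolate Finset.univ lam fun i => Phi n m δ ε (lam i) (mu i)

/-- Varying μ_k changes the data at the node λ_k only, so the derivative of the interpolant is a
multiple of the cofactor u/(x-λ_k). The same holds for λ_k below. -/
theorem hasDerivAt_hSt_mu (m : ℕ) (δ : ℕ → ℝ) (ε : ℝ) (mu : Fin n → ℝ)
    (hlam : Function.Injective lam) (k : Fin n) (j : ℕ) :
    HasDerivAt (fun s => hSt n m δ ε lam (Function.update mu k s) j)
      ((lam k ^ m * mu k - (phiPoly n δ).eval (lam k)) / Delta lam k *
        (cofac lam k).coeff (n - j)) (mu k) := by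
  have h := hasPolyDeriv_interpolate (l := fun _ => lam) (l' := fun _ => 0)
    (r := fun s i => Phi n m δ ε (lam i) (Function.update mu k s i)) (s := mu k)
    (fun i => hasDerivAt_const _ _)
    (fun i => hasDerivAt_Phi (n := n) m δ ε (hasDerivAt_const _ (lam i)) (hasDerivAt_update mu k i))
    hlam (n - j)
  refine h.congr_deriv ?_
  rw [← coeff_interpolate_single]
  congr 2
  funext i
  by_cases hi : i = k
  · subst hi; simp
  · simp [hi]

theorem hasDerivAt_hSt_lam (m : ℕ) (δ : ℕ → ℝ) (ε : ℝ) (mu : Fin n → ℝ)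
    (hlam : Function.Injective lam) (k : Fin n) (j : ℕ) :
    HasDerivAt (fun s => hSt n m δ ε (Function.update lam k s) mu j)
      ((PhiX n m δ ε (lam k) (mu k) -
        (derivative (hPoly n m δ ε lam mu)).eval (lam k)) / Delta lam k *
        (cofac lam k).coeff (n - j)) (lam k) := by
  have h := hasPolyDeriv_interpolate (l := fun s => Function.update lam k s)
    (r := fun s i => Phi n m δ ε (Function.update lam k s i) (mu i)) (s := lam k)
    (fun i => hasDerivAt_update lam k i)
    (fun i => hasDerivAt_Phi (n := n) m δ ε (hasDerivAt_update lam k i) (hasDerivAt_const _ (mu i)))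
    (by simpa using hlam) (n - j)
  refine h.congr_deriv ?_
  rw [← coeff_interpolate_single]
  simp only [Function.update_eq_self]
  congr 2
  funext i
  by_cases hi : i = k
  · subst hi; simp [hPoly]
  · simp [hi]

end

section

open Polynomial Filter Topology

variable {n : ℕ} {lam : Fin n → ℝ}

/-! ### The quasi-Stäckel terms -/

theorem coeff_uPoly (lam : Fin n → ℝ) {i : ℕ} (hi : i ≤ n) :
    (uPoly lam).coeff i = rho lam (n - i) := by
  have h := Multiset.prod_X_sub_C_coeff (Finset.univ.val.map lam) (k := i) (by simpa using hi)
  rw [Multiset.map_map] at h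
  simpa [rho, uPoly, Finset.prod] using h

theorem derivative_eval_eq_sum {p : ℝ[X]} {N : ℕ} (h : p.degree < N) (x : ℝ) :
    (derivative p).eval x = ∑ l ∈ Finset.range N, (l : ℝ) * p.coeff l * x ^ (l - 1) := by
  conv_lhs => rw [show p = ∑ l ∈ Finset.range N, C (p.coeff l) * X ^ l from by
    ext i
    simp only [finsetSum_coeff, coeff_C_mul_X_pow, Finset.sum_ite_eq, Finset.mem_range]
    split_ifs with hi
    · rfl
    · exact coeff_eq_zero_of_degree_lt (lt_of_lt_of_le h (by exact_mod_cast not_lt.mp hi))]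
  simp only [derivative_sum, derivative_C_mul_X_pow, eval_finsetSum, eval_mul, eval_C, eval_pow,
    eval_X]
  exact Finset.sum_congr rfl fun l _ => by ring

/-- The function `-2 ∑_i λ_i^m μ_i (F u)'(λ_i) / Δ_i`. -/
def quasiTerm (m : ℕ) (F : ℝ[X] →ₗ[ℝ] (ℝ → ℝ)) (lam mu : Fin n → ℝ) : ℝ :=
  -2 * ∑ i, lam i ^ m * mu i * deriv (F (uPoly lam)) (lam i) / Delta lam i

/-- The inner sum of W_j is the termwise derivative of [u/x^{n+1-j}]₊, whose coefficient at x^k is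
ρ_{j-k-1}; the term k = 0 drops out. -/
theorem pow_mul_deriv_trunc_first {m j : ℕ} (hj : 1 ≤ j) (hjn : j ≤ n) (lam : Fin n → ℝ) (x : ℝ) :
    x ^ m * (2 * deriv (truncF 0 (n + 1 - j) (uPoly lam)) x) =
      ∑ k ∈ Finset.Icc 1 (j - 1), (k : ℝ) * rho lam (j - k - 1) * x ^ (m + k - 1) := by
  have hdeg : (uPoly lam /ₘ X ^ (n + 1 - j)).degree < (j : WithBot ℕ) := by
    apply degree_div_X_pow_lt
    rw [uPoly_degree]
    exact_mod_cast by omega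
  rw [deriv_truncF_zero, derivative_eval_eq_sum hdeg, mul_div_cancel₀ _ (by norm_num : (2 : ℝ) ≠ 0),
    Finset.mul_sum, Finset.range_eq_Ico, Finset.sum_eq_sum_Ico_succ_bot (by omega)]
  simp only [CharP.cast_eq_zero, zero_mul, mul_zero, zero_add]
  have hI : Finset.Ico 1 j = Finset.Icc 1 (j - 1) := by
    ext a; simp only [Finset.mem_Ico, Finset.mem_Icc]; omega
  rw [hI]
  refine Finset.sum_congr rfl fun k hk => ?_
  rw [Finset.mem_Icc] at hk
  rw [coeff_div_X_pow, coeff_uPoly lam (by omega), show n - (k + (n + 1 - j)) = j - k - 1 by omega,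
    show m + k - 1 = m + (k - 1) by omega, pow_add]
  ring

theorem pow_mul_deriv_trunc_second {m j : ℕ} (hj : 1 ≤ j) (hjn : j ≤ n) (hm : n + 1 < j + m)
    (lam : Fin n → ℝ) {x : ℝ} (hx : x ≠ 0) :
    x ^ m * (2 * deriv (truncF 1 (n + 1 - j) (uPoly lam)) x) =
      ∑ k ∈ Finset.Icc 1 (n + 1 - j), (k : ℝ) * rho lam (j + k - 1) * x ^ (m - k - 1) := by
  obtain ⟨K, hK⟩ : ∃ K, n + 1 - j = K := ⟨_, rfl⟩
  rw [hK, deriv_truncF_one _ _ hx]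
  have hpow : x ^ m = x ^ (K + 1) * x ^ (m - K - 1) := by rw [← pow_add]; congr 1; omega
  have hx' := pow_ne_zero (K + 1) hx
  have heuler : (euler K (uPoly lam)).eval x =
      ∑ l ∈ Finset.range K, ((l : ℝ) - K) * (uPoly lam).coeff l * x ^ l := by
    rw [eval_eq_sum_of_degree_lt (degree_euler_lt K _)]
    refine Finset.sum_congr rfl fun l hl => ?_
    congr 1
    rw [Finset.mem_range] at hl
    rw [euler, coeff_sub, coeff_C_mul, coeff_mod_X_pow, if_pos hl]
    cases l with
    | zero => simp
    | succ l => rw [coeff_X_mul, coeff_derivative, coeff_mod_X_pow, if_pos hl]; push_cast; ring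
  have h1 : x ^ m * (2 * (-(x ^ (K + 1))⁻¹ * (euler K (uPoly lam)).eval x / 2)) =
      -(x ^ (m - K - 1) * (euler K (uPoly lam)).eval x) := by
    rw [hpow]; field_simp
  rw [h1, heuler, Finset.mul_sum, ← Finset.sum_neg_distrib]
  -- The reflection k = K - l turns the factor l - K into -k and the coefficient ρ_{n-l} into
  -- ρ_{j+k-1}.
  refine Finset.sum_bij' (fun l _ => K - l) (fun k _ => K - k) ?_ ?_ ?_ ?_ ?_
  · intro l hl; simp only [Finset.mem_range, Finset.mem_Icc] at *; omega
  · intro l hl; simp only [Finset.mem_range, Finset.mem_Icc] at *; omega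
  · intro l hl; simp only [Finset.mem_range] at *; omega
  · intro l hl; simp only [Finset.mem_Icc] at *; omega
  · intro l hl
    rw [Finset.mem_range] at hl
    rw [coeff_uPoly lam (by omega), show j + (K - l) - 1 = n - l by omega,
      show m - (K - l) - 1 = (m - K - 1) + l by omega, pow_add, Nat.cast_sub hl.le]
    ring

theorem W_eq_quasiTerm {m j : ℕ} {σ : ℝ} (hj : 1 ≤ j) (hjn : j ≤ n)
    (h : σ = 0 ∧ FirstKind n m j ∨ σ = 1 ∧ ¬ FirstKind n m j) (lam mu : Fin n → ℝ)
    (h0 : ∀ i, m = 0 ∨ lam i ≠ 0) :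
    W n m lam mu j = quasiTerm m (truncLin σ (n + 1 - j)) lam mu := by
  unfold W quasiTerm
  rw [neg_mul, Finset.mul_sum]
  rcases h with ⟨rfl, h⟩ | ⟨rfl, h⟩
  · rw [if_pos h]
    congr 1
    refine Finset.sum_congr rfl fun i _ => ?_
    have h1 := pow_mul_deriv_trunc_first (m := m) hj hjn lam (lam i)
    rw [truncLin_apply]
    simp only [mul_div_assoc', ← Finset.sum_div, ← h1]
    ring
  · rw [if_neg h]
    unfold FirstKind at h
    congr 1
    refine Finset.sum_congr rfl fun i _ => ?_
    have h1 := pow_mul_deriv_trunc_second (m := m) hj hjn (by omega) lam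
      ((h0 i).resolve_left (by omega))
    rw [truncLin_apply]
    simp only [mul_div_assoc', ← Finset.sum_div, ← h1]
    ring

theorem hasDerivAt_quasiTerm_mu (m : ℕ) (F : ℝ[X] →ₗ[ℝ] (ℝ → ℝ)) (lam mu : Fin n → ℝ) (k : Fin n) :
    HasDerivAt (fun s => quasiTerm m F lam (Function.update mu k s))
      (-2 * lam k ^ m * deriv (F (uPoly lam)) (lam k) / Delta lam k) (mu k) := by
  have h := (HasDerivAt.fun_sum (u := Finset.univ) fun i _ =>
    (((hasDerivAt_update mu k i).const_mul (lam i ^ m)).mul_const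
      (deriv (F (uPoly lam)) (lam i))).div_const (Delta lam i)).const_mul (-2)
  refine h.congr_deriv ?_
  rw [Finset.sum_eq_single k]
  · simp; ring
  · intro i _ hi; simp [hi]
  · simp

/-! ### Differential calculus of F(u) and of F on the cofactors -/

section

variable {m : ℕ} {κ : ℝ} {F : ℝ[X] →ₗ[ℝ] (ℝ → ℝ)}

theorem eventually_mem_domain {x : ℝ} (hx : m = 0 ∨ x ≠ 0) : ∀ᶠ y in 𝓝 x, m = 0 ∨ y ≠ 0 := by
  rcases hx with hx | hx
  · exact Eventually.of_forall fun _ => Or.inl hx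
  · filter_upwards [eventually_ne_nhds hx] with y hy
    exact Or.inr hy

theorem IsLaxOp.deriv_add (hF : IsLaxOp n m κ F) (p q : ℝ[X]) {x : ℝ} (hx : m = 0 ∨ x ≠ 0) :
    deriv (F (p + q)) x = deriv (F p) x + deriv (F q) x := by
  rw [map_add]
  exact ((hF.differentiableAt p hx).hasDerivAt.add (hF.differentiableAt q hx).hasDerivAt).deriv

theorem IsLaxOp.deriv_smul (hF : IsLaxOp n m κ F) (a : ℝ) (q : ℝ[X]) {x : ℝ}
    (hx : m = 0 ∨ x ≠ 0) : deriv (F (a • q)) x = a * deriv (F q) x := by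
  rw [map_smul]
  exact ((hF.differentiableAt q hx).hasDerivAt.const_smul a).deriv

theorem IsLaxOp.deriv_sum (hF : IsLaxOp n m κ F) {ι : Type*} (s : Finset ι) (q : ι → ℝ[X])
    (a : ι → ℝ) {x : ℝ} (hx : m = 0 ∨ x ≠ 0) :
    deriv (F (∑ i ∈ s, C (a i) * q i)) x = ∑ i ∈ s, a i * deriv (F (q i)) x := by
  have h : F (∑ i ∈ s, C (a i) * q i) = fun y => ∑ i ∈ s, a i * F (q i) y := by
    funext y
    simp [← smul_eq_C_mul, map_sum, map_smul]
  rw [h]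
  exact (HasDerivAt.fun_sum fun i _ =>
    ((hF.differentiableAt (q i) hx).hasDerivAt.const_mul (a i))).deriv

theorem IsLaxOp.differentiableAt_deriv (hF : IsLaxOp n m κ F) (p : ℝ[X]) {x : ℝ}
    (hx : m = 0 ∨ x ≠ 0) : DifferentiableAt ℝ (deriv (F p)) x := by
  have h : ContDiffAt ℝ 1 (fderiv ℝ (F p)) x := (hF.smooth p x hx).fderiv_right (by norm_num)
  exact (h.differentiableAt (by norm_num)).clm_apply (differentiableAt_const 1)

/-- `F u (x) = F u (λ_i) + (x - λ_i) F (u / (x - λ_i)) (x)`. -/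
theorem IsLaxOp.apply_uPoly (hF : IsLaxOp n m κ F) (h0 : ∀ i, m = 0 ∨ lam i ≠ 0) (i : Fin n)
    {x : ℝ} (hx : m = 0 ∨ x ≠ 0) :
    F (uPoly lam) x = F (uPoly lam) (lam i) + (x - lam i) * F (cofac lam i) x := by
  obtain ⟨b, hb⟩ := hF.shift (lam i) (cofac lam i)
  rw [mul_cofac] at hb
  rw [hb x hx, hb _ (h0 i)]
  simp

theorem IsLaxOp.deriv_uPoly (hF : IsLaxOp n m κ F) (h0 : ∀ i, m = 0 ∨ lam i ≠ 0) (i : Fin n)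
    {x : ℝ} (hx : m = 0 ∨ x ≠ 0) :
    deriv (F (uPoly lam)) x =
      F (cofac lam i) x + (x - lam i) * deriv (F (cofac lam i)) x := by
  have h1 : HasDerivAt (fun y => F (uPoly lam) (lam i) + (y - lam i) * F (cofac lam i) y)
      (F (cofac lam i) x + (x - lam i) * deriv (F (cofac lam i)) x) x := by
    have h2 := (((hasDerivAt_id' x).sub_const (lam i)).mul
      (hF.differentiableAt (cofac lam i) hx).hasDerivAt).const_add (F (uPoly lam) (lam i))
    simpa using h2
  refine (h1.congr_of_eventuallyEq ?_).deriv
  filter_upwards [eventually_mem_domain hx] with y hy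
  exact hF.apply_uPoly h0 i hy

/-- F(u) is a constant plus (x-λ_i) F(u/(x-λ_i)), so at x = λ_i Leibniz leaves twice the first
derivative of the second factor. -/
theorem IsLaxOp.hasDerivAt_deriv_uPoly (hF : IsLaxOp n m κ F) (h0 : ∀ i, m = 0 ∨ lam i ≠ 0)
    (i : Fin n) :
    HasDerivAt (deriv (F (uPoly lam))) (2 * deriv (F (cofac lam i)) (lam i)) (lam i) := by
  have h1 := (hF.differentiableAt (cofac lam i) (h0 i)).hasDerivAt.add
    (((hasDerivAt_id' (lam i)).sub_const (lam i)).mul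
      (hF.differentiableAt_deriv (cofac lam i) (h0 i)).hasDerivAt)
  refine (h1.congr_deriv (by simp; ring)).congr_of_eventuallyEq ?_
  filter_upwards [eventually_mem_domain (h0 i)] with y hy
  exact hF.deriv_uPoly h0 i hy

/-- The symmetry behind the formula for `∂W/∂λ`. -/
theorem IsLaxOp.cofac_symm (hF : IsLaxOp n m κ F) (h0 : ∀ i, m = 0 ∨ lam i ≠ 0)
    (hlam : Function.Injective lam) (i k : Fin n) :
    (if i = k then 2 * deriv (F (cofac lam k)) (lam k) else 0) - deriv (F (cofac lam k)) (lam i) -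
      deriv (F (uPoly lam)) (lam i) * ((derivative (cofac lam i)).eval (lam k) / Delta lam k) =
    deriv (F (cofac lam i)) (lam k) -
      deriv (F (uPoly lam)) (lam k) * ((derivative (cofac lam i)).eval (lam k) / Delta lam k) := by
  by_cases hik : i = k
  · subst hik; rw [if_pos rfl]; ring
  · rw [if_neg hik]
    have hne : lam k - lam i ≠ 0 := sub_ne_zero.mpr fun h => hik (hlam h).symm
    have hD := Delta_ne_zero hlam k
    have h1 := derivative_cofac_eval lam hik
    have h2 := hF.deriv_uPoly h0 i (h0 k)
    have h3 := hF.deriv_uPoly h0 k (h0 i)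
    have h4 := hF.apply_uPoly h0 i (h0 k)
    have h5 := hF.apply_uPoly h0 k (h0 i)
    -- Both sides are the divided difference of F(u) at λ_i and λ_k, which is symmetric.
    have h6 : F (cofac lam i) (lam k) = F (cofac lam k) (lam i) := by
      apply mul_left_cancel₀ hne
      linear_combination -h4 - h5
    have h7 : (derivative (cofac lam i)).eval (lam k) / Delta lam k = (lam k - lam i)⁻¹ := by
      field_simp
      linear_combination h1
    rw [h7]
    field_simp
    linear_combination h2 - h3 + h6

end

end

/-! ### The derivative of the quasi-Stäckel terms in λ -/

section

open Polynomial Filter Topology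

variable {n : ℕ} {lam : Fin n → ℝ} {m : ℕ} {κ : ℝ} {F : ℝ[X] →ₗ[ℝ] (ℝ → ℝ)}

theorem cofac_update (lam : Fin n → ℝ) (k : Fin n) (s : ℝ) :
    cofac (Function.update lam k s) k = cofac lam k := by
  unfold cofac
  exact Finset.prod_congr rfl fun j hj => by
    rw [Function.update_of_ne (Finset.ne_of_mem_erase hj)]

theorem uPoly_update (lam : Fin n → ℝ) (k : Fin n) (s : ℝ) :
    uPoly (Function.update lam k s) = uPoly lam + (lam k - s) • cofac lam k := by
  rw [← mul_cofac (Function.update lam k s) k, cofac_update, ← mul_cofac lam k, smul_eq_C_mul]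
  simp
  ring

/-- As the coefficient of an interpolant at x^{n-1}, the sum falls under `hasPolyDeriv_interpolate`,
and the Δ_i need not be differentiated. -/
theorem quasiTerm_eq_coeff (m : ℕ) (F : ℝ[X] →ₗ[ℝ] (ℝ → ℝ)) (lam mu : Fin n → ℝ) :
    quasiTerm m F lam mu = -2 * (Lagrange.interpolate Finset.univ lam fun i =>
      lam i ^ m * mu i * deriv (F (uPoly lam)) (lam i)).coeff (n - 1) := by
  rw [interpolate_eq_cofac, quasiTerm, finsetSum_coeff]
  simp only [coeff_C_mul, cofac_coeff_pred, mul_one]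

/-- `∂v/∂λ_k` at `λ_k`. -/
def vRate (m : ℕ) (lam mu : Fin n → ℝ) (k : Fin n) : ℝ :=
  m * lam k ^ (m - 1) * mu k - (derivative (vPoly m lam mu)).eval (lam k)

/-- The variable λ_k enters as a node, through λ_k^m, as the argument of F(u)', and through u
itself, whose λ_k-derivative is -u/(x-λ_k). The contributions collapse by `IsLaxOp.cofac_symm`,
summed with the weights λ_i^m μ_i/Δ_i, because v is the combination of the cofactors with these
weights. -/
theorem hasDerivAt_quasiTerm_lam (hF : IsLaxOp n m κ F) (mu : Fin n → ℝ)
    (h0 : ∀ i, m = 0 ∨ lam i ≠ 0) (hlam : Function.Injective lam) (k : Fin n) :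
    HasDerivAt (fun s => quasiTerm m F (Function.update lam k s) mu)
      (-2 * (deriv (F (vPoly m lam mu)) (lam k) +
        vRate m lam mu k * deriv (F (uPoly lam)) (lam k) / Delta lam k)) (lam k) := by
  have hr : ∀ i, HasDerivAt (fun s => Function.update lam k s i ^ m * mu i *
      deriv (F (uPoly (Function.update lam k s))) (Function.update lam k s i))
      ((if i = k then m * lam k ^ (m - 1) * mu k * deriv (F (uPoly lam)) (lam k) else 0) +
        lam i ^ m * mu i * ((if i = k then 2 * deriv (F (cofac lam k)) (lam k) else 0) -
          deriv (F (cofac lam k)) (lam i))) (lam k) := by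
    intro i
    have hupd := hasDerivAt_update lam k i
    have hself : Function.update lam k (lam k) i = lam i := by simp
    have hdu : HasDerivAt (fun s => deriv (F (uPoly lam)) (Function.update lam k s i))
        (if i = k then 2 * deriv (F (cofac lam k)) (lam k) else 0) (lam k) := by
      by_cases hi : i = k
      · subst hi
        simpa using hF.hasDerivAt_deriv_uPoly h0 i
      · simpa [hi] using hasDerivAt_const (lam k) (deriv (F (uPoly lam)) (lam i))
    -- The variation of u itself: u changes by (λ_k - s) u/(x-λ_k), and F is linear.
    have hdc : HasDerivAt (fun s => (lam k - s) *
        deriv (F (cofac lam k)) (Function.update lam k s i))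
        (-deriv (F (cofac lam k)) (lam i)) (lam k) := by
      have h1 : DifferentiableAt ℝ (fun s => deriv (F (cofac lam k)) (Function.update lam k s i))
          (lam k) := by
        have h2 := hF.differentiableAt_deriv (cofac lam k) (h0 i)
        rw [← hself] at h2
        exact h2.comp (lam k) hupd.differentiableAt
      have h3 := ((hasDerivAt_id' (lam k)).const_sub (lam k)).mul h1.hasDerivAt
      refine h3.congr_deriv ?_
      rw [hself]; ring
    have hsum : HasDerivAt (fun s => deriv (F (uPoly (Function.update lam k s)))
        (Function.update lam k s i))
        ((if i = k then 2 * deriv (F (cofac lam k)) (lam k) else 0) +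
          -deriv (F (cofac lam k)) (lam i)) (lam k) := by
      refine (hdu.add hdc).congr_of_eventuallyEq ?_
      have hev : ∀ᶠ s in 𝓝 (lam k), m = 0 ∨ Function.update lam k s i ≠ 0 := by
        have h1 : ContinuousAt (fun s => Function.update lam k s i) (lam k) := hupd.continuousAt
        have h2 : ∀ᶠ y in 𝓝 (Function.update lam k (lam k) i), m = 0 ∨ y ≠ 0 := by
          rw [hself]; exact eventually_mem_domain (h0 i)
        exact h1.eventually h2
      filter_upwards [hev] with s hs
      rw [uPoly_update, hF.deriv_add _ _ hs, hF.deriv_smul _ _ hs]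
      rfl
    refine (((hupd.pow m).mul_const (mu i)).mul hsum).congr_deriv ?_
    simp only [Pi.pow_apply, hself, Function.update_eq_self]
    by_cases hi : i = k
    · subst hi; simp only [↓reduceIte]; ring
    · simp [hi]
  have h := (hasPolyDeriv_interpolate (fun i => hasDerivAt_update lam k i) hr
    (by simpa using hlam) (n - 1)).const_mul (-2)
  have hfun : (fun s => quasiTerm m F (Function.update lam k s) mu) = fun s =>
      -2 * (Lagrange.interpolate Finset.univ (Function.update lam k s) fun i =>
        Function.update lam k s i ^ m * mu i * deriv (F (uPoly (Function.update lam k s)))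
          (Function.update lam k s i)).coeff (n - 1) := by
    funext s; exact quasiTerm_eq_coeff m F _ mu
  rw [hfun]
  refine h.congr_deriv ?_
  congr 1
  simp only [Function.update_eq_self]
  rw [interpolate_eq_cofac lam fun i => _ - _ * _, finsetSum_coeff]
  simp only [coeff_C_mul, cofac_coeff_pred, mul_one]
  have hD : ∀ i, Delta lam i ≠ 0 := Delta_ne_zero hlam
  have hG : (derivative (Lagrange.interpolate Finset.univ lam fun i =>
      lam i ^ m * mu i * deriv (F (uPoly lam)) (lam i))).eval (lam k) =
      ∑ i, lam i ^ m * mu i * deriv (F (uPoly lam)) (lam i) / Delta lam i *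
        (derivative (cofac lam i)).eval (lam k) := by
    rw [interpolate_eq_cofac]
    simp [eval_finsetSum]
  have hv : (derivative (vPoly m lam mu)).eval (lam k) =
      ∑ i, lam i ^ m * mu i / Delta lam i * (derivative (cofac lam i)).eval (lam k) := by
    rw [vPoly_eq_interpolate, interpolate_eq_cofac]
    simp [eval_finsetSum]
  have hFv : deriv (F (vPoly m lam mu)) (lam k) =
      ∑ i, lam i ^ m * mu i / Delta lam i * deriv (F (cofac lam i)) (lam k) := by
    rw [vPoly_eq_interpolate, interpolate_eq_cofac, hF.deriv_sum _ _ _ (h0 k)]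
  rw [vRate, hv, hFv]
  -- Separates what is concentrated at the node k from what is spread over all the nodes.
  have hsplit : ∀ g : Fin n → ℝ, ∀ (a : ℝ) (b : Fin n → ℝ),
      ∑ i, (((if i = k then a else 0) + g i) -
      b i * (if i = k then 1 else 0)) / Delta lam i = (a - b k) / Delta lam k +
        ∑ i, g i / Delta lam i := by
    intro g a b
    have h1 : ∀ i, (((if i = k then a else 0) + g i) - b i * (if i = k then 1 else 0)) / Delta lam i =
        (if i = k then (a - b k) / Delta lam k else 0) + g i / Delta lam i := by
      intro i
      by_cases hi : i = k
      · subst hi; simp; ring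
      · simp [hi]
    simp only [h1, Finset.sum_add_distrib, Finset.sum_ite_eq', Finset.mem_univ, if_true]
  rw [hsplit _ _ fun i => eval (lam i) _, hG]
  have hsum := Finset.sum_congr rfl fun i (_ : i ∈ Finset.univ) =>
    congrArg (fun y => lam i ^ m * mu i / Delta lam i * y) (hF.cofac_symm h0 hlam i k)
  simp only [mul_sub (_ / _), Finset.sum_sub_distrib] at hsum
  have e1 : ∑ i, lam i ^ m * mu i * ((if i = k then 2 * deriv (F (cofac lam k)) (lam k) else 0) -
        deriv (F (cofac lam k)) (lam i)) / Delta lam i =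
      ∑ i, lam i ^ m * mu i / Delta lam i *
        (if i = k then 2 * deriv (F (cofac lam k)) (lam k) else 0) -
      ∑ i, lam i ^ m * mu i / Delta lam i * deriv (F (cofac lam k)) (lam i) := by
    rw [← Finset.sum_sub_distrib]
    exact Finset.sum_congr rfl fun i _ => by ring
  have e2 : ∑ i, lam i ^ m * mu i / Delta lam i * (deriv (F (uPoly lam)) (lam i) *
        ((derivative (cofac lam i)).eval (lam k) / Delta lam k)) =
      (∑ i, lam i ^ m * mu i * deriv (F (uPoly lam)) (lam i) / Delta lam i *
        (derivative (cofac lam i)).eval (lam k)) / Delta lam k := by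
    rw [Finset.sum_div]
    exact Finset.sum_congr rfl fun i _ => by ring
  have e3 : ∑ i, lam i ^ m * mu i / Delta lam i * (deriv (F (uPoly lam)) (lam k) *
        ((derivative (cofac lam i)).eval (lam k) / Delta lam k)) =
      (∑ i, lam i ^ m * mu i / Delta lam i * (derivative (cofac lam i)).eval (lam k)) *
        deriv (F (uPoly lam)) (lam k) / Delta lam k := by
    rw [Finset.sum_mul, Finset.sum_div]
    exact Finset.sum_congr rfl fun i _ => by ring
  rw [e2, e3] at hsum
  rw [e1]
  linear_combination hsum

/-! ### The gradient of the Hamiltonians -/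

/-- The derivative with respect to `μ_k` of the Hamiltonian attached to `F`. -/
def gradMu (m : ℕ) (δ : ℕ → ℝ) (F : ℝ[X] →ₗ[ℝ] (ℝ → ℝ)) (lam mu : Fin n → ℝ) (k : Fin n) : ℝ :=
  (2 * F (uPoly lam) (lam k) * (lam k ^ m * mu k - (phiPoly n δ).eval (lam k)) -
    2 * lam k ^ m * deriv (F (uPoly lam)) (lam k)) / Delta lam k

/-- The derivative with respect to `λ_k` of the Hamiltonian attached to `F`. -/
def gradLam (m : ℕ) (δ : ℕ → ℝ) (ε : ℝ) (F : ℝ[X] →ₗ[ℝ] (ℝ → ℝ)) (lam mu : Fin n → ℝ)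
    (k : Fin n) : ℝ :=
  2 * F (uPoly lam) (lam k) * (PhiX n m δ ε (lam k) (mu k) -
    (derivative (hPoly n m δ ε lam mu)).eval (lam k)) / Delta lam k -
    2 * (deriv (F (vPoly m lam mu)) (lam k) +
      vRate m lam mu k * deriv (F (uPoly lam)) (lam k) / Delta lam k)

/-- In the shift rule for u = (x-λ_k) · u/(x-λ_k) the second term vanishes at x = λ_k, and the
surviving coefficient has index n+1-j-1 = n-j, for either σ. This ties h_j to the operator that
defines U_j. -/
theorem two_mul_truncLin_uPoly {j : ℕ} (σ : ℝ) (hjn : j ≤ n) (lam : Fin n → ℝ)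
    (k : Fin n) :
    2 * truncLin σ (n + 1 - j) (uPoly lam) (lam k) = (cofac lam k).coeff (n - j) := by
  rw [truncLin_apply, ← mul_cofac lam k, truncF_shift σ (by omega),
    show n + 1 - j - 1 = n - j by omega]
  ring

theorem hasDerivAt_hB_mu {j : ℕ} {σ : ℝ} (hj : 1 ≤ j) (hjn : j ≤ n)
    (h : σ = 0 ∧ FirstKind n m j ∨ σ = 1 ∧ ¬ FirstKind n m j) (δ : ℕ → ℝ) (ε : ℝ) (mu : Fin n → ℝ)
    (h0 : ∀ i, m = 0 ∨ lam i ≠ 0) (hlam : Function.Injective lam) (k : Fin n) :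
    HasDerivAt (fun s => hB n m δ ε lam (Function.update mu k s) j)
      (gradMu m δ (truncLin σ (n + 1 - j)) lam mu k) (mu k) := by
  simp only [hB, W_eq_quasiTerm hj hjn h lam _ h0]
  refine ((hasDerivAt_hSt_mu m δ ε mu hlam k j).add
    (hasDerivAt_quasiTerm_mu m _ lam mu k)).congr_deriv ?_
  rw [← two_mul_truncLin_uPoly σ hjn, gradMu]
  ring

theorem hasDerivAt_hB_lam {j : ℕ} {σ : ℝ} (hm : m ≤ n + 1) (hj : 1 ≤ j) (hjn : j ≤ n)
    (h : σ = 0 ∧ FirstKind n m j ∨ σ = 1 ∧ ¬ FirstKind n m j) (δ : ℕ → ℝ) (ε : ℝ) (mu : Fin n → ℝ)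
    (h0 : ∀ i, m = 0 ∨ lam i ≠ 0) (hlam : Function.Injective lam) (k : Fin n) :
    HasDerivAt (fun s => hB n m δ ε (Function.update lam k s) mu j)
      (gradLam m δ ε (truncLin σ (n + 1 - j)) lam mu k) (lam k) := by
  have h1 := (hasDerivAt_hSt_lam m δ ε mu hlam k j).add
    (hasDerivAt_quasiTerm_lam (isLaxOp_truncLin hm hj hjn h) mu h0 hlam k)
  refine (h1.congr_deriv ?_).congr_of_eventuallyEq ?_
  · rw [← two_mul_truncLin_uPoly σ hjn, gradLam]
    ring
  · have hev : ∀ᶠ s in 𝓝 (lam k), ∀ i, m = 0 ∨ Function.update lam k s i ≠ 0 := by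
      rw [eventually_all]
      intro i
      have h1 : ContinuousAt (fun s => Function.update lam k s i) (lam k) :=
        (hasDerivAt_update lam k i).continuousAt
      have h2 : ∀ᶠ y in 𝓝 (Function.update lam k (lam k) i), m = 0 ∨ y ≠ 0 := by
        simpa using eventually_mem_domain (h0 i)
      exact h1.eventually h2
    filter_upwards [hev] with s hs
    simp only [hB, Pi.add_apply, W_eq_quasiTerm hj hjn h _ mu hs]

end

section

open Polynomial Filter Topology

variable {n : ℕ} {lam : Fin n → ℝ} {m : ℕ} {κ : ℝ} {F : ℝ[X] →ₗ[ℝ] (ℝ → ℝ)}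

/-! ### The lower left entry of the Lax matrix -/

/-- Distinct nodes are not needed: if nodes coincide, the corresponding quotients by Δ_i are 0 by
convention, and the cofactors always have degree < n. The degree bounds below thus hold at every
point. -/
theorem interpolate_degree_lt (lam r : Fin n → ℝ) :
    (Lagrange.interpolate Finset.univ lam r).degree < n := by
  rw [interpolate_eq_cofac, ← mem_degreeLT]
  refine Submodule.sum_mem _ fun k _ => ?_
  rw [mem_degreeLT]
  exact degree_C_mul_lt _ (cofac_degree_lt lam k)

theorem vPoly_degree_lt (m : ℕ) (lam mu : Fin n → ℝ) : (vPoly m lam mu).degree < n :=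
  interpolate_degree_lt _ _

theorem hPoly_degree_lt (m : ℕ) (δ : ℕ → ℝ) (ε : ℝ) (lam mu : Fin n → ℝ) :
    (hPoly n m δ ε lam mu).degree < n := interpolate_degree_lt _ _

theorem phiPoly_degree_lt (n : ℕ) (δ : ℕ → ℝ) : (phiPoly n δ).degree < (n + 2 : ℕ) := by
  rw [phiPoly, ← mem_degreeLT]
  refine Submodule.sum_mem _ fun k hk => ?_
  rw [mem_degreeLT]
  exact lt_of_le_of_lt (degree_C_mul_X_pow_le _ _) (by exact_mod_cast Finset.mem_range.mp hk)

theorem phiPoly_coeff (n : ℕ) (δ : ℕ → ℝ) (i : ℕ) :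
    (phiPoly n δ).coeff i = if i ≤ n + 1 then δ i else 0 := by
  simp [phiPoly, coeff_X_pow, Nat.lt_succ_iff]

/-- The product `u w`. -/
def uwPoly (n m : ℕ) (δ : ℕ → ℝ) (ε : ℝ) (lam mu : Fin n → ℝ) : ℝ[X] :=
  2 * X ^ m * (C ε * X ^ n + hPoly n m δ ε lam mu) -
    vPoly m lam mu * (vPoly m lam mu - 2 * phiPoly n δ)

/-- The polynomial `w`. -/
def wPoly (n m : ℕ) (δ : ℕ → ℝ) (ε : ℝ) (lam mu : Fin n → ℝ) : ℝ[X] :=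
  uwPoly n m δ ε lam mu /ₘ uPoly lam

theorem degree_mul_lt_of_lt {p q : ℝ[X]} {a b c : ℕ} (hp : p.degree < (a + 1 : ℕ))
    (hq : q.degree < b) (h : a + b ≤ c) : (p * q).degree < (c : WithBot ℕ) := by
  have h1 := degree_mul_lt_add hq hp
  rw [mul_comm] at h1
  exact lt_of_lt_of_le h1 (by exact_mod_cast h)

theorem degree_two_mul_X_pow_lt {p : ℝ[X]} {m a c : ℕ} (hp : p.degree < a) (h : m + a ≤ c) :
    (2 * X ^ m * p : ℝ[X]).degree < (c : WithBot ℕ) := by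
  rw [mul_assoc, show (2 : ℝ[X]) = C 2 from rfl]
  exact degree_C_mul_lt _ (degree_X_pow_mul_lt hp h)

theorem degree_C_mul_X_pow_add_lt {h : ℝ[X]} (ε : ℝ) (hh : h.degree < n) :
    (C ε * X ^ n + h).degree < ((n + 1 : ℕ) : WithBot ℕ) := by
  refine lt_of_le_of_lt (degree_add_le _ _) (max_lt ?_ (hh.trans (by exact_mod_cast n.lt_succ_self)))
  exact lt_of_le_of_lt (degree_C_mul_X_pow_le _ _) (by exact_mod_cast n.lt_succ_self)

theorem degree_v_sub_two_phi (m : ℕ) (δ : ℕ → ℝ) (lam mu : Fin n → ℝ) :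
    (vPoly m lam mu - 2 * phiPoly n δ).degree < ((n + 2 : ℕ) : WithBot ℕ) := by
  refine lt_of_le_of_lt (degree_sub_le _ _) (max_lt
    ((vPoly_degree_lt m lam mu).trans (by exact_mod_cast by omega)) ?_)
  rw [show (2 : ℝ[X]) = C 2 from rfl]
  exact degree_C_mul_lt _ (phiPoly_degree_lt n δ)

theorem uwPoly_degree_lt (hm : m ≤ n + 1) (δ : ℕ → ℝ) (ε : ℝ) (lam mu : Fin n → ℝ) :
    (uwPoly n m δ ε lam mu).degree < ((2 * n + 2 : ℕ) : WithBot ℕ) := by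
  refine lt_of_le_of_lt (degree_sub_le _ _) (max_lt ?_ ?_)
  · exact degree_two_mul_X_pow_lt (degree_C_mul_X_pow_add_lt ε (hPoly_degree_lt m δ ε lam mu))
      (by omega)
  · exact degree_mul_lt_of_lt (a := n) ((vPoly_degree_lt m lam mu).trans
      (by exact_mod_cast n.lt_succ_self)) (degree_v_sub_two_phi m δ lam mu) (by omega)

/-- At a node h equals Φ and v equals λ_i^m μ_i, so 2x^m(e x^n + h) becomes v(v - 2φ). Hence u
divides `uwPoly`, which makes w a polynomial. -/
theorem uwPoly_eval (δ : ℕ → ℝ) (ε : ℝ) (mu : Fin n → ℝ) (hlam : Function.Injective lam)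
    (i : Fin n) : (uwPoly n m δ ε lam mu).eval (lam i) = 0 := by
  have h1 : (vPoly m lam mu).eval (lam i) = lam i ^ m * mu i := eval_interpolate' hlam _ i
  have h2 : (hPoly n m δ ε lam mu).eval (lam i) = Phi n m δ ε (lam i) (mu i) :=
    eval_interpolate' hlam _ i
  simp only [uwPoly, eval_sub, eval_mul, eval_add, eval_C, eval_pow, eval_X, eval_ofNat, h1, h2,
    Phi_eq]
  ring

theorem uPoly_mul_wPoly (δ : ℕ → ℝ) (ε : ℝ) (mu : Fin n → ℝ) (hlam : Function.Injective lam) :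
    uPoly lam * wPoly n m δ ε lam mu = uwPoly n m δ ε lam mu := by
  have h1 : uwPoly n m δ ε lam mu %ₘ uPoly lam = 0 := by
    have h2 : (uwPoly n m δ ε lam mu %ₘ uPoly lam).degree < n := by
      rw [← uPoly_degree lam]; exact degree_modByMonic_lt _ (uPoly_monic lam)
    rw [eq_interpolate' hlam h2 (r := 0) fun i => ?_]
    · exact map_zero _
    · have h3 := congrArg (eval (lam i)) (modByMonic_add_div (uwPoly n m δ ε lam mu) (uPoly lam))
      simpa [uPoly_eval_node, uwPoly_eval _ _ _ hlam] using h3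
  have h := modByMonic_add_div (uwPoly n m δ ε lam mu) (uPoly lam)
  rwa [h1, zero_add] at h

theorem wPoly_degree_lt (hm : m ≤ n + 1) (δ : ℕ → ℝ) (ε : ℝ) (lam mu : Fin n → ℝ) :
    (wPoly n m δ ε lam mu).degree < ((n + 2 : ℕ) : WithBot ℕ) := by
  have h := uwPoly_degree_lt hm δ ε lam mu
  rw [degree_lt_iff_coeff_zero]
  intro i hi
  apply coeff_eq_zero_of_natDegree_lt
  rw [wPoly, natDegree_divByMonic _ (uPoly_monic lam), uPoly_natDegree]
  by_cases h0 : uwPoly n m δ ε lam mu = 0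
  · rw [h0]; simp; omega
  · have := (natDegree_lt_iff_degree_lt h0).mpr h
    omega

/-- Since u vanishes at λ_k, this is Δ_k w(λ_k): the values of w at the nodes are expressed by the
quantities that occur in the gradient. -/
theorem uwPoly_derivative_eval (δ : ℕ → ℝ) (ε : ℝ) (mu : Fin n → ℝ) (hlam : Function.Injective lam)
    (k : Fin n) :
    (derivative (uwPoly n m δ ε lam mu)).eval (lam k) =
      2 * (vRate m lam mu k * (lam k ^ m * mu k - (phiPoly n δ).eval (lam k)) -
        lam k ^ m * (PhiX n m δ ε (lam k) (mu k) -
          (derivative (hPoly n m δ ε lam mu)).eval (lam k))) := by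
  have h1 : (vPoly m lam mu).eval (lam k) = lam k ^ m * mu k := eval_interpolate' hlam _ k
  have h2 : (hPoly n m δ ε lam mu).eval (lam k) = Phi n m δ ε (lam k) (mu k) :=
    eval_interpolate' hlam _ k
  simp only [uwPoly, derivative_mul, derivative_sub, derivative_add, derivative_C,
    derivative_X_pow, derivative_ofNat, eval_sub, eval_mul, eval_add, eval_C, eval_pow, eval_X,
    eval_ofNat, eval_zero, h1, h2, Phi_eq, vRate, PhiX]
  ring

/-! ### The Lax equation -/

theorem eval_eq_of_nodes {p q : ℝ[X]} (hlam : Function.Injective lam) (hp : p.degree < n)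
    (hq : q.degree < n) (h : ∀ i, p.eval (lam i) = q.eval (lam i)) : p = q := by
  rw [eq_interpolate' hlam hp (r := fun i => q.eval (lam i)) h]
  exact (eq_interpolate' hlam hq fun _ => rfl).symm

/-- The data of the flow of the Hamiltonian attached to `F`, at a point. -/
structure IsLaxFlow (n m : ℕ) (κ : ℝ) (F : ℝ[X] →ₗ[ℝ] (ℝ → ℝ)) (δ : ℕ → ℝ) (ε : ℝ)
    (lam mu : Fin n → ℝ) (φ' u' v' h' w' : ℝ[X]) : Prop where
  phi : ∀ x, (m = 0 ∨ x ≠ 0) → φ'.eval x = 2 * x ^ m * deriv (F (phiPoly n δ)) x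
  u_degree : u'.degree < n
  -- This and `v_eval` are the flow derivatives of u(λ_k) = 0 and v(λ_k) = λ_k^m μ_k; `w_eq` is that
  -- of u w = `uwPoly`, with κ ε for the derivative of e.
  u_eval : ∀ k, u'.eval (lam k) = -Delta lam k * gradMu m δ F lam mu k
  v_degree : v'.degree < n
  v_eval : ∀ k, v'.eval (lam k) = vRate m lam mu k * gradMu m δ F lam mu k -
    lam k ^ m * gradLam m δ ε F lam mu k
  h_degree : h'.degree < n
  w_eq : u' * wPoly n m δ ε lam mu + uPoly lam * w' =
    2 * X ^ m * (C (κ * ε) * X ^ n + h') - (v' * (vPoly m lam mu - 2 * phiPoly n δ) +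
      vPoly m lam mu * (v' - 2 * φ'))

variable {δ : ℕ → ℝ} {ε : ℝ} {mu : Fin n → ℝ} {φ' u' v' h' w' : ℝ[X]} {R₁ R₂ : ℝ[X]} {c₁ c₂ : ℝ}

/-- The right side is -2R₁ + 2x^m F(u)', of degree < n like u'; at λ_k the equality is Hamilton's
equation for λ_k. -/
theorem IsLaxFlow.upper_right (hflow : IsLaxFlow n m κ F δ ε lam mu φ' u' v' h' w')
    (hF : IsLaxOp n m κ F) (hlam : Function.Injective lam) (h0 : ∀ i, m = 0 ∨ lam i ≠ 0)
    (hR₁ : R₁.degree < n) (hU₁ : ∀ x, (m = 0 ∨ x ≠ 0) →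
      F (uPoly lam) x * (vPoly m lam mu - phiPoly n δ).eval x =
        (F (vPoly m lam mu - phiPoly n δ) x + c₁) * (uPoly lam).eval x + R₁.eval x)
    {x : ℝ} (hx : m = 0 ∨ x ≠ 0) :
    u'.eval x = 2 * (uPoly lam).eval x * (F (vPoly m lam mu - phiPoly n δ) x + c₁) -
      2 * F (uPoly lam) x * (vPoly m lam mu - phiPoly n δ).eval x +
      2 * x ^ m * deriv (F (uPoly lam)) x := by
  obtain ⟨p, hp, hpx⟩ := hF.deriv_poly (uPoly lam) (uPoly_degree_lt lam)
  have h1 : u' = C (-2) * R₁ + C 2 * p := by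
    refine eval_eq_of_nodes hlam hflow.u_degree (degree_lt_of_bound hR₁ hp _ _) fun k => ?_
    have hD := Delta_ne_zero hlam k
    have h2 := hU₁ _ (h0 k)
    have h3 : (vPoly m lam mu).eval (lam k) = lam k ^ m * mu k := eval_interpolate' hlam _ k
    rw [uPoly_eval_node, mul_zero, zero_add, eval_sub, h3] at h2
    rw [hflow.u_eval, gradMu, eval_add, eval_mul, eval_mul, eval_C, eval_C, ← hpx _ (h0 k), ← h2]
    field_simp
    ring
  rw [h1, eval_add, eval_mul, eval_mul, eval_C, eval_C, ← hpx _ hx]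
  linear_combination 2 * hU₁ x hx

/-- Once `hflow.phi` has removed φ, the claim is v' = R₂ + 2x^m F(v)' between polynomials of degree
< n. At a node the two terms with F(u)' in v' cancel each other, and those with F(u) add up to F(u)
w by the formula for (uw)'. -/
theorem IsLaxFlow.diagonal (hflow : IsLaxFlow n m κ F δ ε lam mu φ' u' v' h' w')
    (hF : IsLaxOp n m κ F) (hlam : Function.Injective lam) (h0 : ∀ i, m = 0 ∨ lam i ≠ 0)
    (hR₂ : R₂.degree < n) (hU₂ : ∀ x, (m = 0 ∨ x ≠ 0) →
      F (uPoly lam) x * (wPoly n m δ ε lam mu).eval x =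
        (F (wPoly n m δ ε lam mu) x + c₂) * (uPoly lam).eval x + R₂.eval x)
    {x : ℝ} (hx : m = 0 ∨ x ≠ 0) :
    v'.eval x - φ'.eval x = F (uPoly lam) x * (wPoly n m δ ε lam mu).eval x -
      (uPoly lam).eval x * (F (wPoly n m δ ε lam mu) x + c₂) +
      2 * x ^ m * deriv (F (vPoly m lam mu - phiPoly n δ)) x := by
  obtain ⟨p, hp, hpx⟩ := hF.deriv_poly (vPoly m lam mu) ((vPoly_degree_lt m lam mu).trans
    (by exact_mod_cast n.lt_succ_self))
  have h1 : v' = C 1 * R₂ + C 2 * p := by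
    refine eval_eq_of_nodes hlam hflow.v_degree (degree_lt_of_bound hR₂ hp _ _) fun k => ?_
    have hD := Delta_ne_zero hlam k
    have h2 := hU₂ _ (h0 k)
    rw [uPoly_eval_node, mul_zero, zero_add] at h2
    have h3 := congrArg (fun q => (derivative q).eval (lam k))
      (uPoly_mul_wPoly (m := m) δ ε mu hlam)
    simp only [derivative_mul, eval_add, eval_mul, uPoly_eval_node, zero_mul, add_zero,
      derivative_uPoly_eval, uwPoly_derivative_eval δ ε mu hlam k] at h3
    rw [hflow.v_eval, gradMu, gradLam, eval_add, eval_mul, eval_mul, eval_C, eval_C,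
      ← hpx _ (h0 k), ← h2]
    have h4 : (wPoly n m δ ε lam mu).eval (lam k) = (2 * (vRate m lam mu k *
        (lam k ^ m * mu k - (phiPoly n δ).eval (lam k)) - lam k ^ m *
        (PhiX n m δ ε (lam k) (mu k) - (derivative (hPoly n m δ ε lam mu)).eval (lam k)))) /
        Delta lam k := by
      rw [← h3]; field_simp
    rw [h4]
    field_simp
    ring
  have h5 : deriv (F (vPoly m lam mu - phiPoly n δ)) x =
      deriv (F (vPoly m lam mu)) x - deriv (F (phiPoly n δ)) x := by
    have := hF.deriv_add (vPoly m lam mu) ((-1 : ℝ) • phiPoly n δ) hx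
    rw [hF.deriv_smul _ _ hx] at this
    rw [sub_eq_add_neg, ← neg_one_smul ℝ (phiPoly n δ), this]
    ring
  rw [h5, hflow.phi x hx, h1, eval_add, eval_mul, eval_mul, eval_C, eval_C, ← hpx _ hx]
  linear_combination -hU₂ x hx

/-- The derivative of the spectral relation expresses u times the unknown entry by the two entries
already known, so no formula for ∂w/∂λ is needed. -/
theorem IsLaxFlow.lower_left (hflow : IsLaxFlow n m κ F δ ε lam mu φ' u' v' h' w')
    (hF : IsLaxOp n m κ F) (hm : m ≤ n + 1)
    (hlam : Function.Injective lam) (h0 : ∀ i, m = 0 ∨ lam i ≠ 0)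
    (hR₁ : R₁.degree < n) (hU₁ : ∀ x, (m = 0 ∨ x ≠ 0) →
      F (uPoly lam) x * (vPoly m lam mu - phiPoly n δ).eval x =
        (F (vPoly m lam mu - phiPoly n δ) x + c₁) * (uPoly lam).eval x + R₁.eval x)
    (hR₂ : R₂.degree < n) (hU₂ : ∀ x, (m = 0 ∨ x ≠ 0) →
      F (uPoly lam) x * (wPoly n m δ ε lam mu).eval x =
        (F (wPoly n m δ ε lam mu) x + c₂) * (uPoly lam).eval x + R₂.eval x)
    {x : ℝ} (hx : m = 0 ∨ x ≠ 0) :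
    w'.eval x = 2 * (F (wPoly n m δ ε lam mu) x + c₂) * (vPoly m lam mu - phiPoly n δ).eval x -
      2 * (wPoly n m δ ε lam mu).eval x * (F (vPoly m lam mu - phiPoly n δ) x + c₁) +
      2 * x ^ m * deriv (F (wPoly n m δ ε lam mu)) x := by
  set Z : ℝ → ℝ := fun x => w'.eval x -
    (2 * (F (wPoly n m δ ε lam mu) x + c₂) * (vPoly m lam mu - phiPoly n δ).eval x -
      2 * (wPoly n m δ ε lam mu).eval x * (F (vPoly m lam mu - phiPoly n δ) x + c₁) +
      2 * x ^ m * deriv (F (wPoly n m δ ε lam mu)) x) with hZ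
  -- The product of v with v - 2φ instead of the square of v - φ: the right side of the relation is
  -- then 2x^m(e x^n + h), without φ².
  obtain ⟨p, hp, hpx⟩ := hF.quad (vPoly m lam mu) (vPoly m lam mu - 2 * phiPoly n δ) (uPoly lam)
    (wPoly n m δ ε lam mu) ((vPoly_degree_lt m lam mu).trans (by exact_mod_cast by omega))
    (degree_v_sub_two_phi m δ lam mu)
    ((uPoly_degree_lt lam).trans (by exact_mod_cast by omega)) (wPoly_degree_lt hm δ ε lam mu)
    ε (hPoly n m δ ε lam mu) (hPoly_degree_lt m δ ε lam mu)
    (by rw [uPoly_mul_wPoly δ ε mu hlam, uwPoly]; ring)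
  have hkey : ∀ y, (m = 0 ∨ y ≠ 0) →
      (uPoly lam).eval y * Z y = 2 * y ^ m * (h' - p).eval y := by
    intro y hy
    have e1 := hflow.upper_right hF hlam h0 hR₁ hU₁ hy
    have e2 := hflow.diagonal hF hlam h0 hR₂ hU₂ hy
    have e3 := congrArg (eval y) hflow.w_eq
    have e4 := hflow.phi y hy
    have e5 := hpx y hy
    have h2 : (vPoly m lam mu - 2 * phiPoly n δ) = vPoly m lam mu + (-2 : ℝ) • phiPoly n δ := by
      rw [smul_eq_C_mul, sub_eq_add_neg, C_neg, neg_mul]; rfl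
    have h3 : (vPoly m lam mu - phiPoly n δ) = vPoly m lam mu + (-1 : ℝ) • phiPoly n δ := by
      rw [neg_one_smul, sub_eq_add_neg]
    have e6 := hF.deriv_add (vPoly m lam mu) ((-2 : ℝ) • phiPoly n δ) hy
    have e7 := hF.deriv_add (vPoly m lam mu) ((-1 : ℝ) • phiPoly n δ) hy
    rw [hF.deriv_smul _ _ hy, ← h2] at e6
    rw [hF.deriv_smul _ _ hy, ← h3] at e7
    rw [e6] at e5
    rw [e7] at e2
    simp only [eval_sub, eval_add, eval_mul, eval_C, eval_pow, eval_X, eval_ofNat] at e1 e2 e3 e5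
    simp only [hZ, eval_sub]
    linear_combination e3 - (wPoly n m δ ε lam mu).eval y * e1 +
      -2 * ((vPoly m lam mu).eval y - (phiPoly n δ).eval y) * e2 +
      2 * (phiPoly n δ).eval y * e4 - 2 * y ^ m * e5
  -- At a node u vanishes and λ_k^m does not, so a polynomial of degree < n has n zeros.
  have hq : h' - p = 0 := by
    refine eval_eq_of_nodes hlam (lt_of_le_of_lt (degree_sub_le _ _) (max_lt hflow.h_degree hp))
      (by simp) fun k => ?_
    have h1 := hkey (lam k) (h0 k)
    rw [uPoly_eval_node, zero_mul] at h1
    have h2 : lam k ^ m ≠ 0 := by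
      rcases h0 k with h | h
      · simp [h]
      · exact pow_ne_zero m h
    rw [eval_zero]
    have h3 := h1.symm
    simpa [h2] using h3
  -- Dividing by u gives Z = 0 away from the nodes only; at a node the value follows by continuity.
  have hZc : ContinuousAt Z x := by
    have c1 := (hF.differentiableAt (wPoly n m δ ε lam mu) hx).continuousAt
    have c2 := (hF.differentiableAt (vPoly m lam mu - phiPoly n δ) hx).continuousAt
    have c3 := (hF.differentiableAt_deriv (wPoly n m δ ε lam mu) hx).continuousAt
    have c4 : ∀ q : ℝ[X], ContinuousAt (fun y => q.eval y) x := fun q => q.continuous.continuousAt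
    exact (c4 _).sub ((((continuousAt_const.mul (c1.add continuousAt_const)).mul (c4 _)).sub
      ((continuousAt_const.mul (c4 _)).mul (c2.add continuousAt_const))).add
      ((continuousAt_const.mul (continuousAt_id.pow m)).mul c3))
  have hev : ∀ᶠ y in 𝓝[≠] x, Z y = 0 := by
    have h1 : ∀ᶠ y in 𝓝[≠] x, ∀ i, y ≠ lam i := by
      rw [eventually_all]
      intro i
      by_cases hi : x = lam i
      · rw [← hi]; exact self_mem_nhdsWithin
      · exact nhdsWithin_le_nhds (eventually_ne_nhds hi)
    filter_upwards [h1, nhdsWithin_le_nhds (eventually_mem_domain hx)] with y hy hy'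
    have h2 := hkey y hy'
    rw [hq, eval_zero, mul_zero] at h2
    refine (mul_eq_zero.mp h2).resolve_left ?_
    rw [uPoly, eval_prod]
    exact Finset.prod_ne_zero_iff.mpr fun i _ => by simpa using sub_ne_zero.mpr (hy i)
  have hZx : Z x = 0 := by
    have t1 : Tendsto Z (𝓝[≠] x) (𝓝 (Z x)) := hZc.tendsto.mono_left nhdsWithin_le_nhds
    have t2 : Tendsto Z (𝓝[≠] x) (𝓝 0) := tendsto_const_nhds.congr' (by
      filter_upwards [hev] with y hy using hy.symm)
    exact tendsto_nhds_unique t1 t2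
  exact sub_eq_zero.mp hZx

end

section

open Polynomial

variable {n m : ℕ} {lam : Fin n → ℝ}

/-! ### The entries of the Lax matrix and of the auxiliary matrices -/

theorem uPlus_eq (lam : Fin n → ℝ) (K : ℕ) : uPlus lam K = toLaurent (uPoly lam /ₘ X ^ K) := by
  refine plusPart_eq (ρ := uPoly lam %ₘ X ^ K) (monic_X_pow K) (Or.inr ⟨⟨_, rfl⟩, ⟨_, rfl⟩⟩)
    (degree_modByMonic_lt _ (monic_X_pow K)) ?_
  rw [← map_mul, ← map_add, mul_comm, add_comm, modByMonic_add_div]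

theorem uPoly_coeff_zero_ne (h : ∀ i, lam i ≠ 0) : (uPoly lam).coeff 0 ≠ 0 := by
  rw [coeff_zero_eq_eval_zero, uPoly, eval_prod]
  exact Finset.prod_ne_zero_iff.mpr fun i _ => by simpa using h i

theorem T_neg_mul_T (k : ℕ) :
    (LaurentPolynomial.T (-(k : ℤ)) : ℝ[T;T⁻¹]) * LaurentPolynomial.T (k : ℤ) = 1 := by
  rw [← LaurentPolynomial.T_add]; simp

theorem sum_smul_T_mul (n : ℕ) (δ : ℕ → ℝ) (y : ℝ[T;T⁻¹]) :
    ∑ γ ∈ Finset.range (n + 2), δ γ • ((LaurentPolynomial.T 1 : ℝ[T;T⁻¹]) ^ γ * y) =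
      toLaurent (phiPoly n δ) * y := by
  rw [phiPoly, map_sum, Finset.sum_mul]
  refine Finset.sum_congr rfl fun γ _ => ?_
  rw [map_mul, toLaurent_C, map_pow, toLaurent_X, LaurentPolynomial.smul_eq_C_mul, mul_assoc]

/-- Divided by -2x^m, the identity u w = 2x^m(e x^n + h) - v(v-2φ) reads Φ(x, v x^{-m}) = -½ x^{-m}
w u + h with deg h < n, which is a division with remainder. -/
theorem wLaurent_eq (δ : ℕ → ℝ) (ε : ℝ) (mu : Fin n → ℝ) (hlam : Function.Injective lam)
    (h0 : ∀ i, m = 0 ∨ lam i ≠ 0) :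
    wLaurent n m δ ε lam mu = toLaurent (wPoly n m δ ε lam mu) := by
  have hquot : plusPart (Phi n m δ ε (LaurentPolynomial.T 1)
      (toLaurent (vPoly m lam mu) * LaurentPolynomial.T (-(m : ℤ)))) (uPoly lam) =
      (-1 / 2 : ℝ) • (LaurentPolynomial.T (-(m : ℤ)) * toLaurent (wPoly n m δ ε lam mu)) := by
    refine plusPart_eq (ρ := hPoly n m δ ε lam mu) (uPoly_monic lam) ?_
      (by rw [uPoly_degree]; exact hPoly_degree_lt m δ ε lam mu) ?_
    -- For m = 0 some λ_i may vanish, and uniqueness of the quotient comes from all terms being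
    -- polynomials; otherwise u(0) ≠ 0.
    · by_cases hm : m = 0
      · subst hm
        refine Or.inr ⟨⟨Phi n 0 δ ε X (vPoly 0 lam mu), ?_⟩, ⟨(-1 / 2 : ℝ) • wPoly n 0 δ ε lam mu, ?_⟩⟩
        · simp [Phi, LaurentPolynomial.smul_eq_C_mul, smul_eq_C_mul, map_sum]
        · simp [LaurentPolynomial.smul_eq_C_mul, smul_eq_C_mul]
      · exact Or.inl (uPoly_coeff_zero_ne fun i => (h0 i).resolve_left hm)
    · have h1 := congrArg toLaurent (uPoly_mul_wPoly (m := m) δ ε mu hlam)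
      have h2 : (toLaurent (2 : ℝ[X]) : ℝ[T;T⁻¹]) = 2 := map_ofNat _ 2
      simp only [uwPoly, map_mul, map_sub, map_add, toLaurent_C, toLaurent_X_pow, h2] at h1
      have hT := T_neg_mul_T m
      rw [Phi, sum_smul_T_mul, LaurentPolynomial.T_pow, LaurentPolynomial.T_pow]
      simp only [LaurentPolynomial.smul_eq_C_mul, mul_one]
      have hC : (LaurentPolynomial.C (-1 / 2 : ℝ)) = -LaurentPolynomial.C (1 / 2 : ℝ) := by
        rw [← map_neg]; norm_num
      have hC2 : (2 : ℝ[T;T⁻¹]) * LaurentPolynomial.C (1 / 2 : ℝ) = 1 := by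
        have : (2 : ℝ[T;T⁻¹]) = LaurentPolynomial.C (2 : ℝ) := (map_ofNat _ 2).symm
        rw [this, ← map_mul]; norm_num
      rw [hC]
      set c := LaurentPolynomial.C (1 / 2 : ℝ)
      set t := (LaurentPolynomial.T (-(m : ℤ)) : ℝ[T;T⁻¹])
      set v := toLaurent (vPoly m lam mu)
      set φ := toLaurent (phiPoly n δ)
      set h := toLaurent (hPoly n m δ ε lam mu)
      linear_combination (c * v ^ 2 * t + 2 * c * LaurentPolynomial.C ε * LaurentPolynomial.T (n : ℤ)
        + 2 * c * h) * hT + (-c * t) * (-h1) + (-LaurentPolynomial.C ε * LaurentPolynomial.T (n : ℤ) - h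
        - φ * t * v) * (-hC2)
  rw [wLaurent, hquot]
  have hT : (LaurentPolynomial.T (m : ℤ) : ℝ[T;T⁻¹]) * LaurentPolynomial.T (-(m : ℤ)) = 1 := by
    rw [mul_comm]; exact T_neg_mul_T m
  rw [mul_smul_comm, smul_smul, ← mul_assoc, hT, one_mul]
  norm_num

/-- The polynomial entries of the Lax matrix. -/
def laxEntry (n m : ℕ) (δ : ℕ → ℝ) (ε : ℝ) (lam mu : Fin n → ℝ) : Matrix (Fin 2) (Fin 2) ℝ[X] :=
  !![vPoly m lam mu - phiPoly n δ, uPoly lam;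
     wPoly n m δ ε lam mu, -(vPoly m lam mu - phiPoly n δ)]

theorem Lax_apply (δ : ℕ → ℝ) (ε : ℝ) (mu : Fin n → ℝ) (hlam : Function.Injective lam)
    (h0 : ∀ i, m = 0 ∨ lam i ≠ 0) (i j : Fin 2) :
    Lax n m δ ε lam mu i j = toLaurent (laxEntry n m δ ε lam mu i j) := by
  rw [Lax, wLaurent_eq δ ε mu hlam h0, laxEntry]
  fin_cases i <;> fin_cases j <;> simp
  ring

theorem laxEntry_degree_lt (hm : m ≤ n + 1) (δ : ℕ → ℝ) (ε : ℝ) (lam mu : Fin n → ℝ) (i j : Fin 2) :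
    (laxEntry n m δ ε lam mu i j).degree < ((n + 2 : ℕ) : WithBot ℕ) := by
  have h1 : (vPoly m lam mu - phiPoly n δ).degree < ((n + 2 : ℕ) : WithBot ℕ) :=
    lt_of_le_of_lt (degree_sub_le _ _) (max_lt
      ((vPoly_degree_lt m lam mu).trans (by exact_mod_cast by omega)) (phiPoly_degree_lt n δ))
  have h2 := (uPoly_degree_lt lam).trans (show ((n + 1 : ℕ) : WithBot ℕ) < ((n + 2 : ℕ) : WithBot ℕ) by
    exact_mod_cast by omega)
  have h3 := wPoly_degree_lt hm δ ε lam mu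
  fin_cases i <;> fin_cases j
  · exact h1
  · exact h2
  · exact h3
  · change (-(vPoly m lam mu - phiPoly n δ)).degree < _
    rwa [degree_neg]

/-! ### Division of F(u) f by u -/

/-- The constant by which `[A f / u]₊` differs from the truncation of `f`. -/
def truncConst (n K : ℕ) (u f : ℝ[X]) : ℝ :=
  ((u /ₘ X ^ K) * f - (f /ₘ X ^ K) * u).coeff n / 2

/-- The remainder of the division of `A f` by `u`. -/
def truncRem (n K : ℕ) (u f : ℝ[X]) : ℝ[X] :=
  C (1 / 2) * ((u /ₘ X ^ K) * f - (f /ₘ X ^ K) * u) - C (truncConst n K u f) * u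

/-- As f may have degree n+1, the commutator can reach degree n; subtracting the multiple of the
monic u with the same coefficient at x^n brings it below n. -/
theorem truncRem_degree_lt {u f : ℝ[X]} (K : ℕ) (hu : u.Monic) (hn : u.degree = n)
    (hf : f.degree < ((n + 2 : ℕ) : WithBot ℕ)) : (truncRem n K u f).degree < n := by
  have h1 := degree_trunc_commutator_lt (N := n + 1) (K := K) (u := u) (f := f)
    (by rw [hn]; exact_mod_cast by omega) hf
  rw [degree_lt_iff_coeff_zero] at *
  intro i hi
  rw [truncRem, coeff_sub, coeff_C_mul, coeff_C_mul]
  rcases hi.eq_or_lt with rfl | hi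
  · have h2 : u.coeff n = 1 := by
      rw [← natDegree_eq_of_degree_eq_some hn]; exact hu
    rw [h2, truncConst]
    ring
  · rw [h1 i hi, coeff_eq_zero_of_degree_lt (by rw [hn]; exact_mod_cast hi)]
    ring

theorem truncF_mul_eq (σ : ℝ) (K : ℕ) (u f : ℝ[X]) (x : ℝ) :
    truncF σ K u x * f.eval x =
      (truncF σ K f x + truncConst n K u f) * u.eval x + (truncRem n K u f).eval x := by
  simp only [truncF, truncRem, eval_sub, eval_mul, eval_C]
  ring

theorem plusPart_trunc {σ : ℝ} {K : ℕ} {u f : ℝ[X]} (hu : u.Monic) (hn : u.degree = n)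
    (hf : f.degree < ((n + 2 : ℕ) : WithBot ℕ)) (h : u.coeff 0 ≠ 0 ∨ σ = 0) :
    plusPart (truncL σ K u * toLaurent f) u =
      truncL σ K f + LaurentPolynomial.C (truncConst n K u f) := by
  refine plusPart_eq (ρ := truncRem n K u f) hu ?_
    (by rw [hn]; exact truncRem_degree_lt K hu hn hf) ?_
  · rcases h with h | rfl
    · exact Or.inl h
    · refine Or.inr ⟨⟨C (1 / 2) * (u /ₘ X ^ K) * f, ?_⟩,
        ⟨C (1 / 2) * (f /ₘ X ^ K) + C (truncConst n K u f), ?_⟩⟩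
      · simp [truncL, LaurentPolynomial.smul_eq_C_mul]
      · simp [truncL, LaurentPolynomial.smul_eq_C_mul]
  · simp only [truncL, truncRem, LaurentPolynomial.smul_eq_C_mul, map_sub, map_mul, toLaurent_C]
    ring

theorem BMat_apply {j : ℕ} {σ : ℝ}
    (h : σ = 0 ∧ FirstKind n m j ∨ σ = 1 ∧ ¬ FirstKind n m j) (δ : ℕ → ℝ) (ε : ℝ)
    (mu : Fin n → ℝ) (hlam : Function.Injective lam) (h0 : ∀ i, m = 0 ∨ lam i ≠ 0) (a b : Fin 2) :
    BMat n m δ ε lam mu j a b =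
      truncL σ (n + 1 - j) (uPoly lam) * toLaurent (laxEntry n m δ ε lam mu a b) := by
  rw [BMat]
  rcases h with ⟨rfl, h⟩ | ⟨rfl, h⟩
  · rw [if_pos h]
    simp only [Matrix.smul_apply, Lax_apply δ ε mu hlam h0, uPlus_eq, truncL, smul_eq_mul, zero_smul,
      sub_zero, smul_mul_assoc]
  · rw [if_neg h]
    simp only [Matrix.smul_apply, Lax_apply δ ε mu hlam h0, uMinus, uPlus_eq, truncL, smul_eq_mul,
      one_smul, LaurentPolynomial.smul_eq_C_mul]
    rw [show (LaurentPolynomial.C (-(1 / 2) : ℝ)) = -LaurentPolynomial.C (1 / 2 : ℝ) from map_neg _ _]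
    ring

theorem evalAt_UMat {j : ℕ} {σ : ℝ} (hm : m ≤ n + 1) (hjn : j ≤ n)
    (h : σ = 0 ∧ FirstKind n m j ∨ σ = 1 ∧ ¬ FirstKind n m j) (δ : ℕ → ℝ) (ε : ℝ)
    (mu : Fin n → ℝ) (hlam : Function.Injective lam) (h0 : ∀ i, m = 0 ∨ lam i ≠ 0) (a b : Fin 2)
    {x : ℝ} (hx : x ≠ 0) :
    evalAt (UMat n m δ ε lam mu j a b) x =
      truncLin σ (n + 1 - j) (laxEntry n m δ ε lam mu a b) x +
        truncConst n (n + 1 - j) (uPoly lam) (laxEntry n m δ ε lam mu a b) := by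
  have hcond : (uPoly lam).coeff 0 ≠ 0 ∨ σ = 0 := by
    rcases h with ⟨rfl, -⟩ | ⟨-, h⟩
    · exact Or.inr rfl
    · unfold FirstKind at h
      exact Or.inl (uPoly_coeff_zero_ne fun i => (h0 i).resolve_left (by omega))
  rw [UMat, Matrix.map_apply, BMat_apply h δ ε mu hlam h0,
    plusPart_trunc (uPoly_monic lam) (uPoly_degree lam) (laxEntry_degree_lt hm δ ε lam mu a b) hcond,
    evalAt_add, evalAt_truncL _ _ _ hx, evalAt_C _ hx]
  rfl

/-! ### The deformation -/

/-- The coefficient of the `j`-th object in the deformation. -/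
def deformCoeff (n m : ℕ) (z : ℕ → ℕ → ℝ) (r j : ℕ) : ℝ :=
  if FirstKind n m r then
    if r ≤ kappa1 n m then if j = r then 1 else 0 else if j ≤ r then z r j else 0
  else
    if r ≤ n - kappa2 m then if r ≤ j then z r j else 0 else if j = r then 1 else 0

theorem deform_eq_sum {V : Type*} [AddCommMonoid V] [Module ℝ V] (z : ℕ → ℕ → ℝ) (Y : ℕ → V)
    {r : ℕ} (hr : r ∈ Finset.Icc 1 n) :
    deform n m z Y r = ∑ j ∈ Finset.Icc 1 n, deformCoeff n m z r j • Y j := by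
  have hsingle : ∑ j ∈ Finset.Icc 1 n, (if j = r then (1 : ℝ) else 0) • Y j = Y r := by
    rw [Finset.sum_eq_single_of_mem r hr fun j _ hj => by simp [hj]]
    simp
  unfold deform deformCoeff
  rw [Finset.mem_Icc] at hr
  split_ifs
  · exact hsingle.symm
  · have hsub : Finset.Icc 1 r ⊆ Finset.Icc 1 n := Finset.Icc_subset_Icc_right hr.2
    rw [← Finset.sum_subset hsub fun j hj hj' => ?_]
    · exact Finset.sum_congr rfl fun j hj => by rw [if_pos (Finset.mem_Icc.mp hj).2]
    · rw [Finset.mem_Icc] at hj hj'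
      rw [if_neg (by omega), zero_smul]
  · have hsub : Finset.Icc r n ⊆ Finset.Icc 1 n := Finset.Icc_subset_Icc_left hr.1
    rw [← Finset.sum_subset hsub fun j hj hj' => ?_]
    · refine Finset.sum_bij' (fun j _ => r + j) (fun j _ => j - r) ?_ ?_ ?_ ?_ ?_ <;>
        intro j hj <;> simp only [Finset.mem_Icc] at hj ⊢
      · omega
      · omega
      · omega
      · omega
      · rw [if_pos (by omega)]
    · rw [Finset.mem_Icc] at hj hj'
      rw [if_neg (by omega), zero_smul]
  · exact hsingle.symm

/-- Sums of the first kind run over j ≤ r and those of the second over j ≥ r, so they never leave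
the kind of r, and a single σ serves the whole combination. -/
theorem firstKind_of_deformCoeff_ne_zero {z : ℕ → ℕ → ℝ} {r j : ℕ} (hr : 1 ≤ r) (hj : 1 ≤ j)
    (h : deformCoeff n m z r j ≠ 0) : FirstKind n m j ↔ FirstKind n m r := by
  unfold deformCoeff at h
  split_ifs at h <;> unfold FirstKind at * <;> first | omega | simp at h

/-- For m = n+1 the index 1 is the only one of the first kind and κ₁ = 1; it therefore enters no
combination but its own. -/
theorem sum_deformCoeff_exceptional (z : ℕ → ℕ → ℝ) {r : ℕ} (hr : r ∈ Finset.Icc 1 n) :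
    ∑ j ∈ Finset.Icc 1 n, deformCoeff n m z r j * (if m = n + 1 ∧ j = 1 then 1 else 0) =
      if m = n + 1 ∧ r = 1 then 1 else 0 := by
  rw [Finset.mem_Icc] at hr
  by_cases hm : m = n + 1
  · rw [Finset.sum_eq_single_of_mem 1 (Finset.mem_Icc.mpr ⟨le_rfl, by omega⟩)
      fun j _ hj => by simp [hj]]
    have hk : kappa1 n m = 1 := by unfold kappa1; omega
    unfold deformCoeff
    rw [hk]
    by_cases hr1 : r = 1
    · simp [hm, hr1, FirstKind]
    · have h1 : ¬ FirstKind n m r := by unfold FirstKind; omega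
      have h2 : ¬ r ≤ 1 := by omega
      have h3 : ¬ 1 = r := by omega
      rw [if_neg h1]
      simp [h2, h3, hr1]
  · simp [hm]

/-- `0` for the first and `1` for the second kind. -/
def kindSign (n m r : ℕ) : ℝ := if FirstKind n m r then 0 else 1

/-- The operator attached to the `r`-th deformed Hamiltonian. -/
def deformOp (n m : ℕ) (z : ℕ → ℕ → ℝ) (r : ℕ) : ℝ[X] →ₗ[ℝ] (ℝ → ℝ) :=
  ∑ j ∈ Finset.Icc 1 n, deformCoeff n m z r j • truncLin (kindSign n m r) (n + 1 - j)

theorem kind_of_deformCoeff_ne_zero {z : ℕ → ℕ → ℝ} {r j : ℕ} (hr : 1 ≤ r) (hj : 1 ≤ j)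
    (h : deformCoeff n m z r j ≠ 0) :
    kindSign n m r = 0 ∧ FirstKind n m j ∨ kindSign n m r = 1 ∧ ¬ FirstKind n m j := by
  rw [firstKind_of_deformCoeff_ne_zero hr hj h]
  unfold kindSign
  split_ifs with h1 <;> simp [h1]

theorem isLaxOp_deformOp (hm : m ≤ n + 1) (z : ℕ → ℕ → ℝ) {r : ℕ} (hr : r ∈ Finset.Icc 1 n) :
    IsLaxOp n m (if m = n + 1 ∧ r = 1 then 1 else 0) (deformOp n m z r) := by
  rw [← sum_deformCoeff_exceptional z hr]
  rw [Finset.mem_Icc] at hr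
  refine IsLaxOp.sum_smul _ _ _ _ fun j hj h => ?_
  rw [Finset.mem_Icc] at hj
  exact isLaxOp_truncLin hm hj.1 hj.2 (kind_of_deformCoeff_ne_zero hr.1 hj.1 h)

theorem deformOp_apply (z : ℕ → ℕ → ℝ) (r : ℕ) (p : ℝ[X]) (x : ℝ) :
    deformOp n m z r p x = ∑ j ∈ Finset.Icc 1 n,
      deformCoeff n m z r j * truncLin (kindSign n m r) (n + 1 - j) p x := by
  simp [deformOp, LinearMap.sum_apply, Finset.sum_apply]

theorem deriv_deformOp (z : ℕ → ℕ → ℝ) (r : ℕ) (p : ℝ[X]) {x : ℝ}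
    (hx : kindSign n m r = 0 ∨ x ≠ 0) :
    deriv (deformOp n m z r p) x = ∑ j ∈ Finset.Icc 1 n,
      deformCoeff n m z r j * deriv (truncLin (kindSign n m r) (n + 1 - j) p) x := by
  have h : deformOp n m z r p = fun y => ∑ j ∈ Finset.Icc 1 n,
      deformCoeff n m z r j * truncLin (kindSign n m r) (n + 1 - j) p y := by
    funext y; exact deformOp_apply z r p y
  rw [h]
  exact (HasDerivAt.fun_sum fun j _ =>
    (((contDiffAt_truncF (n + 1 - j) p hx).differentiableAt
      (by norm_num)).hasDerivAt.const_mul _)).deriv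

/-- The constant term of the entry of `Ū_r` which belongs to `f`. -/
def deformConst (n m : ℕ) (z : ℕ → ℕ → ℝ) (r : ℕ) (u f : ℝ[X]) : ℝ :=
  ∑ j ∈ Finset.Icc 1 n, deformCoeff n m z r j * truncConst n (n + 1 - j) u f

/-- The remainder which belongs to `f`. -/
def deformRem (n m : ℕ) (z : ℕ → ℕ → ℝ) (r : ℕ) (u f : ℝ[X]) : ℝ[X] :=
  ∑ j ∈ Finset.Icc 1 n, C (deformCoeff n m z r j) * truncRem n (n + 1 - j) u f

theorem deformRem_degree_lt (z : ℕ → ℕ → ℝ) (r : ℕ) {f : ℝ[X]} (lam : Fin n → ℝ)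
    (hf : f.degree < ((n + 2 : ℕ) : WithBot ℕ)) : (deformRem n m z r (uPoly lam) f).degree < n := by
  rw [deformRem, ← mem_degreeLT]
  refine Submodule.sum_mem _ fun k _ => ?_
  rw [mem_degreeLT]
  exact degree_C_mul_lt _ (truncRem_degree_lt _ (uPoly_monic lam) (uPoly_degree lam) hf)

theorem deformOp_mul_eq (z : ℕ → ℕ → ℝ) (r : ℕ) (u f : ℝ[X]) (x : ℝ) :
    deformOp n m z r u x * f.eval x =
      (deformOp n m z r f x + deformConst n m z r u f) * u.eval x +
        (deformRem n m z r u f).eval x := by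
  simp only [deformOp_apply, deformConst, deformRem, eval_finsetSum, eval_mul, eval_C,
    ← Finset.sum_add_distrib, Finset.sum_mul]
  refine Finset.sum_congr rfl fun j _ => ?_
  simp only [truncLin_apply]
  linear_combination deformCoeff n m z r j * truncF_mul_eq (n := n) (kindSign n m r) (n + 1 - j) u f x

theorem deformConst_self (z : ℕ → ℕ → ℝ) (r : ℕ) (u : ℝ[X]) : deformConst n m z r u u = 0 := by
  simp [deformConst, truncConst]

theorem deformConst_neg (z : ℕ → ℕ → ℝ) (r : ℕ) (u f : ℝ[X]) :
    deformConst n m z r u (-f) = -deformConst n m z r u f := by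
  rw [deformConst, deformConst, ← Finset.sum_neg_distrib]
  refine Finset.sum_congr rfl fun j _ => ?_
  have h : (-f) /ₘ X ^ (n + 1 - j) = -(f /ₘ X ^ (n + 1 - j)) := by
    ext i; simp [coeff_div_X_pow]
  rw [truncConst, truncConst, h, show u /ₘ X ^ (n + 1 - j) * -f - -(f /ₘ X ^ (n + 1 - j)) * u =
    -(u /ₘ X ^ (n + 1 - j) * f - (f /ₘ X ^ (n + 1 - j)) * u) by ring, coeff_neg]
  ring

theorem UBarAt_apply (hm : m ≤ n + 1) (d : ℕ → Time n → ℝ) (e : Time n → ℝ)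
    (ζ : ℕ → ℕ → Time n → ℝ) {r : ℕ} (hr : r ∈ Finset.Icc 1 n) (mu : Fin n → ℝ) (t : Time n)
    (hlam : Function.Injective lam) (h0 : ∀ i, m = 0 ∨ lam i ≠ 0) (a b : Fin 2)
    {x : ℝ} (hx : x ≠ 0) :
    UBarAt n m d e ζ r x lam mu t a b =
      deformOp n m (fun i j => ζ i j t) r (laxEntry n m (fun γ => d γ t) (e t) lam mu a b) x +
        deformConst n m (fun i j => ζ i j t) r (uPoly lam)
          (laxEntry n m (fun γ => d γ t) (e t) lam mu a b) := by
  rw [UBarAt, Matrix.map_apply, deform_eq_sum _ _ hr, Matrix.sum_apply, evalAt_sum _ _ hx,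
    deformOp_apply, deformConst, ← Finset.sum_add_distrib]
  rw [Finset.mem_Icc] at hr
  refine Finset.sum_congr rfl fun j hj => ?_
  rw [Finset.mem_Icc] at hj
  rw [Matrix.smul_apply, evalAt_smul _ _ hx, ← mul_add]
  by_cases hc : deformCoeff n m (fun i j => ζ i j t) r j = 0
  · rw [hc, zero_mul, zero_mul]
  · rw [evalAt_UMat hm hj.2 (kind_of_deformCoeff_ne_zero hr.1 hj.1 hc) _ _ mu hlam h0 a b hx]

end

section

open Polynomial Filter Topology

variable {n m : ℕ}

/-! ### The evolution of `φ` -/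

theorem two_mul_pow_deriv_truncF_zero (m K : ℕ) (f : ℝ[X]) (x : ℝ) :
    2 * x ^ m * deriv (truncF 0 K f) x = (X ^ m * derivative (f /ₘ X ^ K)).eval x := by
  rw [deriv_truncF_zero, eval_mul, eval_pow, eval_X]; ring

theorem two_mul_pow_deriv_truncF_one {K : ℕ} (hK : K + 1 ≤ m) (f : ℝ[X]) {x : ℝ} (hx : x ≠ 0) :
    2 * x ^ m * deriv (truncF 1 K f) x = (-(X ^ (m - K - 1) * euler K f)).eval x := by
  have h : x ^ m = x ^ (K + 1) * x ^ (m - K - 1) := by rw [← pow_add]; congr 1; omega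
  have hxK := pow_ne_zero (K + 1) hx
  rw [deriv_truncF_one _ _ hx, eval_neg, eval_mul, eval_pow, eval_X, h]
  field_simp

/-- The coefficient at `x^γ` of `2 x^m ∂_x` of the `j`-th truncation of `φ`. -/
def phiRate (n m : ℕ) (σ : ℝ) (δ : ℕ → ℝ) (j γ : ℕ) : ℝ :=
  if σ = 0 then
    if m ≤ γ ∧ γ + 1 ≤ m + j then ((γ : ℝ) - m + 1) * δ (n + 2 + γ - m - j) else 0
  else
    if m + j ≤ n + 2 + γ ∧ γ + 2 ≤ m then -((γ : ℝ) - m + 1) * δ (n + 2 + γ - m - j) else 0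

theorem coeff_X_pow_mul_derivative_phi {j : ℕ} (hjn : j ≤ n) (δ : ℕ → ℝ) (γ : ℕ) :
    (X ^ m * derivative (phiPoly n δ /ₘ X ^ (n + 1 - j))).coeff γ = phiRate n m 0 δ j γ := by
  rw [coeff_X_pow_mul', phiRate, if_pos rfl]
  by_cases h : m ≤ γ
  · rw [if_pos h, coeff_derivative, coeff_div_X_pow, phiPoly_coeff,
      show γ - m + 1 + (n + 1 - j) = n + 2 + γ - m - j by omega, Nat.cast_sub h]
    by_cases h2 : γ + 1 ≤ m + j
    · rw [if_pos (by omega), if_pos ⟨h, h2⟩]; ring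
    · rw [if_neg (by omega), if_neg (by omega), zero_mul]
  · rw [if_neg h, if_neg (by omega)]

theorem coeff_neg_X_pow_mul_euler_phi {j : ℕ} (hjn : j ≤ n) (hm : n + 2 ≤ m + j) (δ : ℕ → ℝ)
    (hj : 1 ≤ j) (γ : ℕ) :
    (-(X ^ (m - (n + 1 - j) - 1) * euler (n + 1 - j) (phiPoly n δ))).coeff γ =
      phiRate n m 1 δ j γ := by
  obtain ⟨K, hK⟩ : ∃ K, n + 1 - j = K := ⟨_, rfl⟩
  rw [hK, coeff_neg, coeff_X_pow_mul', phiRate, if_neg one_ne_zero]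
  by_cases h : m + j ≤ n + 2 + γ
  · rw [if_pos (by omega)]
    obtain ⟨l, hl⟩ : ∃ l, γ - (m - K - 1) = l := ⟨_, rfl⟩
    rw [hl]
    by_cases h2 : γ + 2 ≤ m
    · have hc : (euler K (phiPoly n δ)).coeff l = ((l : ℝ) - K) * δ l := by
        have hlK : l < K := by omega
        rw [euler, coeff_sub, coeff_C_mul, coeff_mod_X_pow, if_pos hlK]
        have h3 : (X * derivative (phiPoly n δ %ₘ X ^ K)).coeff l = l * (phiPoly n δ).coeff l := by
          cases l with
          | zero => simp
          | succ l => rw [coeff_X_mul, coeff_derivative, coeff_mod_X_pow, if_pos hlK]; push_cast; ring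
        rw [h3, phiPoly_coeff, if_pos (by omega)]
        ring
      -- The Euler factor l - K at l = γ - (m-K-1) is the factor γ-m+1 of the equations for d_γ.
      have hcast : (l : ℝ) - K = γ - m + 1 := by
        have : l + m = γ + K + 1 := by omega
        have : (l : ℝ) + m = γ + K + 1 := by exact_mod_cast this
        linarith
      rw [hc, if_pos ⟨h, h2⟩, hcast, show n + 2 + γ - m - j = l by omega]
      ring
    · rw [if_neg (by omega), coeff_eq_zero_of_degree_lt (lt_of_lt_of_le (degree_euler_lt K _)
        (by exact_mod_cast by omega)), neg_zero]
  · rw [if_neg (by omega), if_neg (by omega), neg_zero]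

theorem two_mul_pow_deriv_trunc_phi {j : ℕ} {σ : ℝ} (hj : 1 ≤ j) (hjn : j ≤ n) (hm : m ≤ n + 1)
    (h : σ = 0 ∧ FirstKind n m j ∨ σ = 1 ∧ ¬ FirstKind n m j) (δ : ℕ → ℝ) {x : ℝ}
    (hx : m = 0 ∨ x ≠ 0) :
    2 * x ^ m * deriv (truncLin σ (n + 1 - j) (phiPoly n δ)) x =
      ∑ γ ∈ Finset.range (n + 2), phiRate n m σ δ j γ * x ^ γ := by
  unfold FirstKind at h
  rw [truncLin_apply]
  rcases h with ⟨rfl, h⟩ | ⟨rfl, h⟩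
  · rw [two_mul_pow_deriv_truncF_zero, eval_eq_sum_of_degree_lt (N := n + 2)]
    · simp only [coeff_X_pow_mul_derivative_phi hjn]
    · rw [degree_lt_iff_coeff_zero]
      intro γ hγ
      rw [coeff_X_pow_mul_derivative_phi hjn, phiRate, if_pos rfl, if_neg (by omega)]
  · rw [two_mul_pow_deriv_truncF_one (by omega) _ (hx.resolve_left (by omega)),
      eval_eq_sum_of_degree_lt (N := n + 2)]
    · simp only [coeff_neg_X_pow_mul_euler_phi (m := m) hjn (by omega) _ hj]
    · rw [degree_lt_iff_coeff_zero]
      intro γ hγ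
      rw [coeff_neg_X_pow_mul_euler_phi hjn (by omega) _ hj, phiRate, if_neg one_ne_zero,
        if_neg (by omega)]

/-- The summation ranges in the equations for d_γ are the indices j for which `phiRate` is not
forced to be zero, so the sum may be extended to all j; for the second kind j is shifted by r. -/
theorem pderiv_d_eq {d : ℕ → Time n → ℝ} {e : Time n → ℝ} {ζ : ℕ → ℕ → Time n → ℝ}
    (hdef : IsDeformation n m d e ζ) (r : Finset.Icc 1 n) (t : Time n) {γ : ℕ} (hγ : γ ≤ n + 1) :
    pderiv (d γ) r t = ∑ j ∈ Finset.Icc 1 n, deformCoeff n m (fun i j => ζ i j t) r j *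
      phiRate n m (kindSign n m r) (fun γ => d γ t) j γ := by
  have hr := Finset.mem_Icc.mp r.2
  have hsingle : ∀ g : ℕ → ℝ, ∑ j ∈ Finset.Icc 1 n, (if j = (r : ℕ) then (1 : ℝ) else 0) * g j =
      g r := by
    intro g
    rw [Finset.sum_eq_single_of_mem (r : ℕ) r.2 fun j _ hj => by simp [hj]]
    simp
  unfold deformCoeff kindSign
  by_cases hk : FirstKind n m r
  · simp only [if_pos hk]
    by_cases hk1 : (r : ℕ) ≤ kappa1 n m
    · simp only [if_pos hk1]
      rw [hsingle, hdef.pde_first_low r hk hk1 γ hγ t, phiRate, if_pos rfl]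
    · simp only [if_neg hk1]
      rw [hdef.pde_first_high r hk (not_le.mp hk1) γ hγ t]
      simp only [phiRate, if_true]
      by_cases hc : m ≤ γ ∧ γ + 1 ≤ m + r
      · rw [if_pos hc, Finset.mul_sum]
        have hsub : Finset.Icc (γ + 1 - m) (r : ℕ) ⊆ Finset.Icc 1 n := by
          intro j hj
          rw [Finset.mem_Icc] at *
          omega
        rw [← Finset.sum_subset hsub fun j hj hj' => ?_]
        · refine Finset.sum_congr rfl fun j hj => ?_
          rw [Finset.mem_Icc] at hj
          rw [if_pos hj.2, if_pos (by omega)]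
          ring
        · rw [Finset.mem_Icc] at hj hj'
          by_cases hjr : j ≤ r
          · rw [if_neg (c := m ≤ γ ∧ γ + 1 ≤ m + j) (by omega), mul_zero]
          · rw [if_neg hjr, zero_mul]
      · rw [if_neg hc]
        refine (Finset.sum_eq_zero fun j hj => ?_).symm
        by_cases hjr : j ≤ r
        · rw [if_neg (c := m ≤ γ ∧ γ + 1 ≤ m + j) (by omega), mul_zero]
        · rw [if_neg hjr, zero_mul]
  · simp only [if_neg hk]
    by_cases hk1 : (r : ℕ) ≤ n - kappa2 m
    · simp only [if_pos hk1]
      rw [hdef.pde_second_low r hk hk1 γ hγ t]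
      simp only [phiRate, if_neg (one_ne_zero (α := ℝ))]
      by_cases hc : m + r ≤ n + 2 + γ ∧ γ + 2 ≤ m
      · rw [if_pos hc, Finset.mul_sum]
        have hsub : Finset.Icc (r : ℕ) (n + 2 + γ - m) ⊆ Finset.Icc 1 n := by
          intro j hj
          rw [Finset.mem_Icc] at *
          omega
        rw [← Finset.sum_subset hsub fun j hj hj' => ?_]
        · refine Finset.sum_bij' (fun j _ => r + j) (fun j _ => j - r) ?_ ?_ ?_ ?_ ?_ <;>
            intro j hj <;> simp only [Finset.mem_Icc] at hj ⊢
          · omega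
          · omega
          · omega
          · omega
          · rw [if_pos (by omega), if_pos (by omega),
              show n + 2 + γ - m - (r + j) = n + 2 + γ - m - r - j by omega]
            ring
        · rw [Finset.mem_Icc] at hj hj'
          by_cases hjr : (r : ℕ) ≤ j
          · rw [if_neg (c := m + j ≤ n + 2 + γ ∧ γ + 2 ≤ m) (by omega), mul_zero]
          · rw [if_neg hjr, zero_mul]
      · rw [if_neg hc]
        refine (Finset.sum_eq_zero fun j hj => ?_).symm
        by_cases hjr : (r : ℕ) ≤ j
        · rw [if_neg (c := m + j ≤ n + 2 + γ ∧ γ + 2 ≤ m) (by omega), mul_zero]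
        · rw [if_neg hjr, zero_mul]
    · simp only [if_neg hk1]
      rw [hsingle, hdef.pde_second_high r hk (not_le.mp hk1) γ hγ t, phiRate,
        if_neg (one_ne_zero (α := ℝ))]

/-- An index r ≤ n of the second kind forces m ≥ 2, which rules out the alternative m = 0. -/
theorem kindSign_domain {r : ℕ} (hr : r ≤ n) {x : ℝ} (hx : m = 0 ∨ x ≠ 0) :
    kindSign n m r = 0 ∨ x ≠ 0 := by
  by_cases h : FirstKind n m r
  · exact Or.inl (if_pos h)
  · unfold FirstKind at h
    exact Or.inr (hx.resolve_left (by omega))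

theorem phi_evolution {d : ℕ → Time n → ℝ} {e : Time n → ℝ} {ζ : ℕ → ℕ → Time n → ℝ}
    (hdef : IsDeformation n m d e ζ) (hm : m ≤ n + 1) (r : Finset.Icc 1 n) (t : Time n) {x : ℝ}
    (hx : m = 0 ∨ x ≠ 0) :
    (phiPoly n fun γ => pderiv (d γ) r t).eval x = 2 * x ^ m *
      deriv (deformOp n m (fun i j => ζ i j t) r (phiPoly n fun γ => d γ t)) x := by
  have hr := Finset.mem_Icc.mp r.2
  rw [deriv_deformOp _ _ _ (kindSign_domain hr.2 hx), phiPoly_eval, Finset.mul_sum]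
  have h1 : ∀ j ∈ Finset.Icc 1 n, 2 * x ^ m * (deformCoeff n m (fun i j => ζ i j t) r j *
      deriv (truncLin (kindSign n m r) (n + 1 - j) (phiPoly n fun γ => d γ t)) x) =
      ∑ γ ∈ Finset.range (n + 2), deformCoeff n m (fun i j => ζ i j t) r j *
        phiRate n m (kindSign n m r) (fun γ => d γ t) j γ * x ^ γ := by
    intro j hj
    rw [Finset.mem_Icc] at hj
    by_cases hc : deformCoeff n m (fun i j => ζ i j t) r j = 0
    · simp [hc]
    · have h2 := two_mul_pow_deriv_trunc_phi hj.1 hj.2 hm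
        (kind_of_deformCoeff_ne_zero hr.1 hj.1 hc) (fun γ => d γ t) hx
      simp only [mul_assoc, ← Finset.mul_sum] at h2 ⊢
      linear_combination deformCoeff n m (fun i j => ζ i j t) r j * h2
  rw [Finset.sum_congr rfl h1, Finset.sum_comm]
  refine Finset.sum_congr rfl fun γ hγ => ?_
  rw [Finset.mem_range] at hγ
  rw [pderiv_d_eq hdef r t (by omega), Finset.sum_mul]

end

section

open Polynomial Filter Topology

variable {n m : ℕ} {E : Type*} [NormedAddCommGroup E] [NormedSpace ℝ E]

/-! ### Differentiability of the entries of the Lax matrix -/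

theorem coeffDiff_uPoly {l : E → Fin n → ℝ} {z : E}
    (hl : ∀ i, DifferentiableAt ℝ (fun y => l y i) z) : CoeffDiff (fun y => uPoly (l y)) z :=
  CoeffDiff.prod _ fun i _ => (CoeffDiff.const _ _).sub (CoeffDiff.C (hl i))

theorem coeffDiff_vPoly (m : ℕ) {l p : E → Fin n → ℝ} {z : E}
    (hl : ∀ i, DifferentiableAt ℝ (fun y => l y i) z)
    (hp : ∀ i, DifferentiableAt ℝ (fun y => p y i) z) (hinj : Function.Injective (l z)) :
    CoeffDiff (fun y => vPoly m (l y) (p y)) z :=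
  CoeffDiff.interpolate hl (fun i => ((hl i).pow m).mul (hp i)) hinj

theorem coeffDiff_phiPoly {δ : E → ℕ → ℝ} {z : E}
    (hδ : ∀ γ ≤ n + 1, DifferentiableAt ℝ (fun y => δ y γ) z) :
    CoeffDiff (fun y => phiPoly n (δ y)) z :=
  CoeffDiff.sum _ fun γ hγ => (CoeffDiff.C (hδ γ (by rw [Finset.mem_range] at hγ; omega))).mul
    (CoeffDiff.const _ _)

theorem differentiableAt_Phi (m : ℕ) {δ : E → ℕ → ℝ} {ε f g : E → ℝ} {z : E}
    (hδ : ∀ γ ≤ n + 1, DifferentiableAt ℝ (fun y => δ y γ) z) (hε : DifferentiableAt ℝ ε z)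
    (hf : DifferentiableAt ℝ f z) (hg : DifferentiableAt ℝ g z) :
    DifferentiableAt ℝ (fun y => Phi n m (δ y) (ε y) (f y) (g y)) z := by
  simp only [Phi_eq]
  have h1 : DifferentiableAt ℝ (fun y => f y ^ m * g y ^ 2 / 2) z := by fun_prop
  exact (h1.sub (((coeffDiff_phiPoly hδ).eval
    (N := n + 2) (Eventually.of_forall fun y => phiPoly_degree_lt n (δ y)) hf).mul hg)).sub
    (hε.mul (hf.pow n))

theorem coeffDiff_hPoly (m : ℕ) {l p : E → Fin n → ℝ} {δ : E → ℕ → ℝ} {ε : E → ℝ} {z : E}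
    (hl : ∀ i, DifferentiableAt ℝ (fun y => l y i) z)
    (hp : ∀ i, DifferentiableAt ℝ (fun y => p y i) z)
    (hδ : ∀ γ ≤ n + 1, DifferentiableAt ℝ (fun y => δ y γ) z) (hε : DifferentiableAt ℝ ε z)
    (hinj : Function.Injective (l z)) :
    CoeffDiff (fun y => hPoly n m (δ y) (ε y) (l y) (p y)) z :=
  CoeffDiff.interpolate hl (fun i => differentiableAt_Phi m hδ hε (hl i) (hp i)) hinj

theorem coeffDiff_uwPoly (m : ℕ) {l p : E → Fin n → ℝ} {δ : E → ℕ → ℝ} {ε : E → ℝ} {z : E}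
    (hl : ∀ i, DifferentiableAt ℝ (fun y => l y i) z)
    (hp : ∀ i, DifferentiableAt ℝ (fun y => p y i) z)
    (hδ : ∀ γ ≤ n + 1, DifferentiableAt ℝ (fun y => δ y γ) z) (hε : DifferentiableAt ℝ ε z)
    (hinj : Function.Injective (l z)) :
    CoeffDiff (fun y => uwPoly n m (δ y) (ε y) (l y) (p y)) z := by
  have hv := coeffDiff_vPoly m hl hp hinj
  exact ((CoeffDiff.const _ _).mul (((CoeffDiff.C hε).mul (CoeffDiff.const _ _)).add
    (coeffDiff_hPoly m hl hp hδ hε hinj))).sub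
    (hv.mul (hv.sub ((CoeffDiff.const _ _).mul (coeffDiff_phiPoly hδ))))

theorem coeffDiff_wPoly (hm : m ≤ n + 1) {l p : E → Fin n → ℝ} {δ : E → ℕ → ℝ} {ε : E → ℝ} {z : E}
    (hl : ∀ i, DifferentiableAt ℝ (fun y => l y i) z)
    (hp : ∀ i, DifferentiableAt ℝ (fun y => p y i) z)
    (hδ : ∀ γ ≤ n + 1, DifferentiableAt ℝ (fun y => δ y γ) z) (hε : DifferentiableAt ℝ ε z)
    (hinj : Function.Injective (l z)) :
    CoeffDiff (fun y => wPoly n m (δ y) (ε y) (l y) (p y)) z :=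
  CoeffDiff.divByMonic (fun y => uPoly_monic (l y)) (fun y => uPoly_natDegree (l y))
    (fun y => uwPoly_degree_lt hm (δ y) (ε y) (l y) (p y)) (coeffDiff_uPoly hl)
    (coeffDiff_uwPoly m hl hp hδ hε hinj)

theorem coeffDiff_laxEntry (hm : m ≤ n + 1) {l p : E → Fin n → ℝ} {δ : E → ℕ → ℝ} {ε : E → ℝ}
    {z : E} (hl : ∀ i, DifferentiableAt ℝ (fun y => l y i) z)
    (hp : ∀ i, DifferentiableAt ℝ (fun y => p y i) z)
    (hδ : ∀ γ ≤ n + 1, DifferentiableAt ℝ (fun y => δ y γ) z) (hε : DifferentiableAt ℝ ε z)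
    (hinj : Function.Injective (l z)) (i j : Fin 2) :
    CoeffDiff (fun y => laxEntry n m (δ y) (ε y) (l y) (p y) i j) z := by
  have h1 := (coeffDiff_vPoly m hl hp hinj).sub (coeffDiff_phiPoly hδ)
  fin_cases i <;> fin_cases j
  · exact h1
  · exact coeffDiff_uPoly hl
  · exact coeffDiff_wPoly hm hl hp hδ hε hinj
  · exact h1.neg

/-! ### The flow -/

/-- Only the velocities at the instant s matter, so the curves need not be trajectories. The
existence of h' and w' comes from differentiability alone; they are then used only through the
derivative of u w = `uwPoly`. -/
theorem exists_isLaxFlow {κ : ℝ} {F : ℝ[X] →ₗ[ℝ] (ℝ → ℝ)} (hm : m ≤ n + 1)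
    {l p : ℝ → Fin n → ℝ} {δ : ℝ → ℕ → ℝ} {ε : ℝ → ℝ} {δ' : ℕ → ℝ} {s : ℝ}
    (hl : ∀ i, HasDerivAt (fun y => l y i) (gradMu m (δ s) F (l s) (p s) i) s)
    (hp : ∀ i, HasDerivAt (fun y => p y i) (-gradLam m (δ s) (ε s) F (l s) (p s) i) s)
    (hδ : ∀ γ ≤ n + 1, HasDerivAt (fun y => δ y γ) (δ' γ) s) (hε : HasDerivAt ε (κ * ε s) s)
    (hinj : Function.Injective (l s))
    (hphi : ∀ x, (m = 0 ∨ x ≠ 0) →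
      (phiPoly n δ').eval x = 2 * x ^ m * deriv (F (phiPoly n (δ s))) x) :
    ∃ u' v' h' w' : ℝ[X],
      IsLaxFlow n m κ F (δ s) (ε s) (l s) (p s) (phiPoly n δ') u' v' h' w' ∧
      HasPolyDeriv (fun y => uPoly (l y)) u' s ∧
      HasPolyDeriv (fun y => vPoly m (l y) (p y)) v' s ∧
      HasPolyDeriv (fun y => phiPoly n (δ y)) (phiPoly n δ') s ∧
      HasPolyDeriv (fun y => wPoly n m (δ y) (ε y) (l y) (p y)) w' s := by
  have hl' := fun i => (hl i).differentiableAt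
  have hp' := fun i => (hp i).differentiableAt
  have hδ' := fun γ hγ => (hδ γ hγ).differentiableAt
  have hphid : HasPolyDeriv (fun y => phiPoly n (δ y)) (phiPoly n δ') s := by
    intro i
    simp only [phiPoly_coeff]
    split_ifs with hi
    · exact hδ i hi
    · exact hasDerivAt_const _ _
  obtain ⟨u', hu', hud⟩ := (coeffDiff_uPoly hl').exists_hasPolyDeriv
    (Eventually.of_forall fun y => uPoly_degree_lt (l y))
  obtain ⟨h', hh', hhd⟩ := (coeffDiff_hPoly m hl' hp' hδ' hε.differentiableAt
    hinj).exists_hasPolyDeriv (Eventually.of_forall fun y => hPoly_degree_lt m (δ y) (ε y) (l y) (p y))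
  obtain ⟨w', -, hwd⟩ := (coeffDiff_wPoly hm hl' hp' hδ' hε.differentiableAt
    hinj).exists_hasPolyDeriv (Eventually.of_forall fun y => wPoly_degree_lt hm (δ y) (ε y) (l y) (p y))
  have hvd := hasPolyDeriv_interpolate hl (fun i => ((hl i).pow m).mul (hp i)) hinj
  refine ⟨u', _, h', w', ⟨hphi, ?_, fun k => ?_, interpolate_degree_lt _ _, fun k => ?_, hh', ?_⟩,
    hud, hvd, hphid, hwd⟩
  · rw [degree_lt_iff_coeff_zero] at hu' ⊢
    intro i hi
    rcases hi.eq_or_lt with rfl | hi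
    -- The coefficient of the monic u at x^n is constantly 1, which lowers the degree of u' by one.
    · have h1 := hud n
      have h2 : (fun y => (uPoly (l y)).coeff n) = fun _ => 1 := by
        funext y
        have := uPoly_monic (l y)
        rwa [Monic, leadingCoeff, uPoly_natDegree] at this
      rw [h2] at h1
      exact h1.unique (hasDerivAt_const s 1)
    · exact hu' i hi
  · have h1 := hud.eval (Eventually.of_forall fun y => uPoly_degree_lt (l y)) (hl k)
    simp only [uPoly_eval_node, derivative_uPoly_eval] at h1
    linear_combination h1.unique (hasDerivAt_const s (0 : ℝ))
  · rw [eval_interpolate' hinj, vRate, vPoly_eq_interpolate]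
    simp only [Pi.mul_apply, Pi.pow_apply]
    ring
  · have h1 := hud.mul hwd
    have h2 := ((HasPolyDeriv.const (2 * X ^ m) s).mul (((HasPolyDeriv.C hε).mul
      (HasPolyDeriv.const (X ^ n) s)).add hhd)).sub
      (hvd.mul (hvd.sub ((HasPolyDeriv.const 2 s).mul hphid)))
    -- The factorization needs distinct nodes, an open condition.
    have h3 : ∀ᶠ y in 𝓝 s, uPoly (l y) * wPoly n m (δ y) (ε y) (l y) (p y) =
        uwPoly n m (δ y) (ε y) (l y) (p y) := by
      filter_upwards [eventually_injective (fun i => (hl' i).continuousAt) hinj] with y hy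
      exact uPoly_mul_wPoly _ _ _ hy
    have h4 := h1.unique ((show HasPolyDeriv (fun y => uwPoly n m (δ y) (ε y) (l y) (p y)) _ s from
      h2).congr h3)
    rw [h4, vPoly_eq_interpolate]
    simp only [Pi.mul_apply, Pi.pow_apply]
    ring

/-! ### Partial derivatives and the Poisson bracket -/

/-- `dF/dt_r` is the derivative of `F` along a straight line. -/
theorem hasDerivAt_line_evolDeriv {G : (Fin n → ℝ) × (Fin n → ℝ) × Time n → ℝ}
    (H : (Fin n → ℝ) → (Fin n → ℝ) → Time n → ℝ) (r : Finset.Icc 1 n) (lam mu : Fin n → ℝ)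
    (t : Time n) (hG : DifferentiableAt ℝ G (lam, mu, t)) :
    HasDerivAt (fun s : ℝ => G
        (lam + s • (fun i => pderiv (fun p => H lam p t) i mu),
          mu + s • (fun i => -pderiv (fun l => H l mu t) i lam),
          t + s • (Pi.single r 1 : Time n)))
      (evolDeriv H (fun l p s => G (l, p, s)) r lam mu t) 0 := by
  set a : Fin n → ℝ := fun i => pderiv (fun p => H lam p t) i mu with ha
  set b : Fin n → ℝ := fun i => -pderiv (fun l => H l mu t) i lam with hb
  set D := fderiv ℝ G (lam, mu, t) with hD
  have hGD : HasFDerivAt G D (lam, mu, t) := hG.hasFDerivAt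
  have hupd : ∀ {ι : Type} [Fintype ι] [DecidableEq ι] (c : ι → ℝ) (i : ι),
      HasDerivAt (fun s => Function.update c i s) (Pi.single i 1) (c i) := by
    intro ι _ _ c i
    rw [hasDerivAt_pi]
    intro j
    have := hasDerivAt_update c i j
    rwa [← Pi.single_apply] at this
  have e1 : ∀ i, pderiv (fun l => G (l, mu, t)) i lam = D (Pi.single i 1, 0, 0) := by
    intro i
    have h1 := (hupd lam i).prodMk ((hasDerivAt_const (lam i) mu).prodMk (hasDerivAt_const (lam i) t))
    have h2 : HasFDerivAt G D (Function.update lam i (lam i), mu, t) := by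
      rwa [Function.update_eq_self]
    exact (h2.comp_hasDerivAt (lam i) h1).deriv
  have e2 : ∀ i, pderiv (fun p => G (lam, p, t)) i mu = D (0, Pi.single i 1, 0) := by
    intro i
    have h1 := (hasDerivAt_const (mu i) lam).prodMk ((hupd mu i).prodMk (hasDerivAt_const (mu i) t))
    have h2 : HasFDerivAt G D (lam, Function.update mu i (mu i), t) := by
      rwa [Function.update_eq_self]
    exact (h2.comp_hasDerivAt (mu i) h1).deriv
  have e3 : pderiv (fun s => G (lam, mu, s)) r t = D (0, 0, Pi.single r 1) := by
    have h1 := (hasDerivAt_const (t r) lam).prodMk ((hasDerivAt_const (t r) mu).prodMk (hupd t r))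
    have h2 : HasFDerivAt G D (lam, mu, Function.update t r (t r)) := by
      rwa [Function.update_eq_self]
    exact (h2.comp_hasDerivAt (t r) h1).deriv
  have hline : ∀ {V : Type} [NormedAddCommGroup V] [NormedSpace ℝ V] (c c' : V),
      HasDerivAt (fun s : ℝ => c + s • c') c' 0 := by
    intro V _ _ c c'
    simpa using ((hasDerivAt_id' (0 : ℝ)).smul_const c').const_add c
  have h1 := (hline lam a).prodMk ((hline mu b).prodMk (hline t (Pi.single r 1 : Time n)))
  have h2 : HasFDerivAt G D (lam + (0 : ℝ) • a, mu + (0 : ℝ) • b,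
      t + (0 : ℝ) • (Pi.single r 1 : Time n)) := by
    simpa using hGD
  refine (h2.comp_hasDerivAt (0 : ℝ) h1).congr_deriv ?_
  have hsum : ∀ c : Fin n → ℝ, c = ∑ i, c i • (Pi.single i 1 : Fin n → ℝ) := by
    intro c
    ext j
    simp [Finset.sum_apply, Pi.single_apply]
  have hsa : D (a, 0, 0) = ∑ i, a i * D (Pi.single i 1, 0, 0) := by
    have h3 := congrArg (D.toLinearMap.comp
      (LinearMap.inl ℝ (Fin n → ℝ) ((Fin n → ℝ) × Time n))) (hsum a)
    rw [map_sum] at h3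
    simp only [map_smul, smul_eq_mul] at h3
    exact h3
  have hsb : D (0, b, 0) = ∑ i, b i * D (0, Pi.single i 1, 0) := by
    have h3 := congrArg (D.toLinearMap.comp
      ((LinearMap.inr ℝ (Fin n → ℝ) ((Fin n → ℝ) × Time n)).comp
        (LinearMap.inl ℝ (Fin n → ℝ) (Time n)))) (hsum b)
    rw [map_sum] at h3
    simp only [map_smul, smul_eq_mul] at h3
    exact h3
  -- By linearity of D its value on (∂H/∂μ, -∂H/∂λ, e_r) splits into the two halves of the Poisson
  -- bracket and the partial derivative in t_r.
  have hdec : ((a, b, Pi.single r 1) : (Fin n → ℝ) × (Fin n → ℝ) × Time n) =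
      (a, 0, 0) + (0, b, 0) + (0, 0, Pi.single r 1) := by simp
  rw [hdec, map_add, map_add, hsa, hsb, evolDeriv, e3, poisson]
  simp only [e1, e2, ha, hb]
  rw [add_comm, ← Finset.sum_add_distrib]
  congr 1
  exact Finset.sum_congr rfl fun i _ => by ring

end

section

open Polynomial Filter Topology

variable {n m : ℕ} {E : Type*} [NormedAddCommGroup E] [NormedSpace ℝ E]

/-! ### The Hamiltonians -/

theorem differentiableAt_Delta {l : E → Fin n → ℝ} {z : E}
    (hl : ∀ i, DifferentiableAt ℝ (fun y => l y i) z) (i : Fin n) :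
    DifferentiableAt ℝ (fun y => Delta (l y) i) z := by
  simp only [← cofac_eval_self]
  exact CoeffDiff.eval (N := n) (CoeffDiff.prod _ fun j _ => (CoeffDiff.const _ _).sub
    (CoeffDiff.C (hl j))) (Eventually.of_forall fun y => cofac_degree_lt (l y) i) (hl i)

theorem differentiableAt_rho {l : E → Fin n → ℝ} {z : E}
    (hl : ∀ i, DifferentiableAt ℝ (fun y => l y i) z) {k : ℕ} (hk : k ≤ n) :
    DifferentiableAt ℝ (fun y => rho (l y) k) z := by
  have h : ∀ y, rho (l y) k = (uPoly (l y)).coeff (n - k) := fun y => by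
    rw [coeff_uPoly _ (Nat.sub_le n k), Nat.sub_sub_self hk]
  simp only [h]
  exact coeffDiff_uPoly hl _

theorem differentiableAt_W (m : ℕ) {l p : E → Fin n → ℝ} {z : E}
    (hl : ∀ i, DifferentiableAt ℝ (fun y => l y i) z)
    (hp : ∀ i, DifferentiableAt ℝ (fun y => p y i) z) (hinj : Function.Injective (l z)) {j : ℕ}
    (hjn : j ≤ n) : DifferentiableAt ℝ (fun y => W n m (l y) (p y) j) z := by
  have hD : ∀ i (a : ℕ), DifferentiableAt ℝ (fun y => l y i ^ a / Delta (l y) i) z := by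
    intro i a
    simp only [div_eq_mul_inv]
    exact ((hl i).pow a).mul ((differentiableAt_Delta hl i).inv (Delta_ne_zero hinj i))
  by_cases h : FirstKind n m j
  · simp only [W, if_pos h]
    refine (DifferentiableAt.fun_sum fun i _ => DifferentiableAt.mul
      (DifferentiableAt.fun_sum fun k hk => ?_) (hp i)).neg
    exact ((differentiableAt_rho hl (by omega)).const_mul _).mul (hD i _)
  · simp only [W, if_neg h]
    refine (DifferentiableAt.fun_sum fun i _ => DifferentiableAt.mul
      (DifferentiableAt.fun_sum fun k hk => ?_) (hp i)).neg
    rw [Finset.mem_Icc] at hk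
    exact ((differentiableAt_rho hl (by omega)).const_mul _).mul (hD i _)

theorem differentiableAt_hB (m : ℕ) {l p : E → Fin n → ℝ} {δ : E → ℕ → ℝ} {ε : E → ℝ} {z : E}
    (hl : ∀ i, DifferentiableAt ℝ (fun y => l y i) z)
    (hp : ∀ i, DifferentiableAt ℝ (fun y => p y i) z)
    (hδ : ∀ γ ≤ n + 1, DifferentiableAt ℝ (fun y => δ y γ) z) (hε : DifferentiableAt ℝ ε z)
    (hinj : Function.Injective (l z)) {j : ℕ} (hjn : j ≤ n) :
    DifferentiableAt ℝ (fun y => hB n m (δ y) (ε y) (l y) (p y) j) z :=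
  (coeffDiff_hPoly m hl hp hδ hε hinj (n - j)).add (differentiableAt_W m hl hp hinj hjn)

section

variable {d : ℕ → Time n → ℝ} {e : Time n → ℝ} {ζ : ℕ → ℕ → Time n → ℝ}

theorem IsDeformation.differentiableAt_d (hdef : IsDeformation n m d e ζ) {γ : ℕ} (hγ : γ ≤ n + 1)
    (t : Time n) : DifferentiableAt ℝ (d γ) t :=
  (hdef.smooth_d γ hγ).differentiable (by simp) t

theorem IsDeformation.differentiableAt_e (hdef : IsDeformation n m d e ζ) (t : Time n) :
    DifferentiableAt ℝ e t := hdef.smooth_e.differentiable (by simp) t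

theorem IsDeformation.differentiableAt_deformCoeff (hdef : IsDeformation n m d e ζ)
    (r : Finset.Icc 1 n) {j : ℕ} (hj : j ∈ Finset.Icc 1 n) (t : Time n) :
    DifferentiableAt ℝ (fun s => deformCoeff n m (fun i j => ζ i j s) r j) t := by
  rw [Finset.mem_Icc] at hj
  unfold deformCoeff
  split_ifs with h1 h2 h3 h3 h2 h3 h3
  · exact differentiableAt_const _
  · exact differentiableAt_const _
  · exact ((hdef.zeta_first r h1 (not_le.mp h2) j (Finset.mem_Icc.mpr ⟨hj.1, h3⟩)).1).differentiable
      (by simp) t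
  · exact differentiableAt_const _
  · exact ((hdef.zeta_second r h1 h2 j (Finset.mem_Icc.mpr ⟨h3, hj.2⟩)).1).differentiable
      (by simp) t
  · exact differentiableAt_const _
  · exact differentiableAt_const _
  · exact differentiableAt_const _

theorem HB_eq_sum (m : ℕ) (d : ℕ → Time n → ℝ) (e : Time n → ℝ) (ζ : ℕ → ℕ → Time n → ℝ) {r : ℕ}
    (hr : r ∈ Finset.Icc 1 n) (lam mu : Fin n → ℝ) (t : Time n) :
    HB n m d e ζ r lam mu t = ∑ j ∈ Finset.Icc 1 n, deformCoeff n m (fun i j => ζ i j t) r j *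
      hB n m (fun γ => d γ t) (e t) lam mu j := by
  rw [HB, deform_eq_sum _ _ hr]
  rfl

theorem IsDeformation.differentiableAt_HB (hdef : IsDeformation n m d e ζ) (r : Finset.Icc 1 n)
    {l p : E → Fin n → ℝ} {τ : E → Time n} {z : E}
    (hl : ∀ i, DifferentiableAt ℝ (fun y => l y i) z)
    (hp : ∀ i, DifferentiableAt ℝ (fun y => p y i) z) (hτ : DifferentiableAt ℝ τ z)
    (hinj : Function.Injective (l z)) :
    DifferentiableAt ℝ (fun y => HB n m d e ζ r (l y) (p y) (τ y)) z := by
  simp only [HB_eq_sum m d e ζ r.2]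
  refine DifferentiableAt.fun_sum fun j hj => DifferentiableAt.mul ?_ ?_
  · exact (hdef.differentiableAt_deformCoeff r hj (τ z)).comp z hτ
  · exact differentiableAt_hB m hl hp (fun γ hγ => (hdef.differentiableAt_d hγ (τ z)).comp z hτ)
      ((hdef.differentiableAt_e (τ z)).comp z hτ) hinj (Finset.mem_Icc.mp hj).2

/-! ### The gradient of the deformed Hamiltonians -/

theorem pderiv_HB_mu {r : ℕ} (hr : r ∈ Finset.Icc 1 n) (lam mu : Fin n → ℝ)
    (t : Time n) (h0 : ∀ i, m = 0 ∨ lam i ≠ 0) (hlam : Function.Injective lam) (k : Fin n) :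
    pderiv (fun p => HB n m d e ζ r lam p t) k mu =
      gradMu m (fun γ => d γ t) (deformOp n m (fun i j => ζ i j t) r) lam mu k := by
  have hr' := Finset.mem_Icc.mp hr
  simp only [pderiv, HB_eq_sum m d e ζ hr]
  refine HasDerivAt.deriv ((HasDerivAt.fun_sum (A' := fun j =>
    deformCoeff n m (fun i j => ζ i j t) r j * gradMu m (fun γ => d γ t)
      (truncLin (kindSign n m r) (n + 1 - j)) lam mu k) fun j hj => ?_).congr_deriv ?_)
  · rw [Finset.mem_Icc] at hj
    -- An index with zero coefficient may be of the other kind, for which the gradient formula with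
    -- this σ is not available.
    by_cases hc : deformCoeff n m (fun i j => ζ i j t) r j = 0
    · simpa [hc] using hasDerivAt_const (mu k) (0 : ℝ)
    · exact (hasDerivAt_hB_mu hj.1 hj.2 (kind_of_deformCoeff_ne_zero hr'.1 hj.1 hc) _ _ mu h0 hlam
        k).const_mul _
  · simp only [gradMu, deformOp_apply, deriv_deformOp _ _ _ (kindSign_domain hr'.2 (h0 k)),
      Finset.mul_sum, Finset.sum_mul, ← Finset.sum_sub_distrib, Finset.sum_div]
    exact Finset.sum_congr rfl fun j _ => by ring

theorem pderiv_HB_lam (hm : m ≤ n + 1) {r : ℕ} (hr : r ∈ Finset.Icc 1 n) (lam mu : Fin n → ℝ)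
    (t : Time n) (h0 : ∀ i, m = 0 ∨ lam i ≠ 0) (hlam : Function.Injective lam) (k : Fin n) :
    pderiv (fun l => HB n m d e ζ r l mu t) k lam =
      gradLam m (fun γ => d γ t) (e t) (deformOp n m (fun i j => ζ i j t) r) lam mu k := by
  have hr' := Finset.mem_Icc.mp hr
  simp only [pderiv, HB_eq_sum m d e ζ hr]
  refine HasDerivAt.deriv ((HasDerivAt.fun_sum (A' := fun j =>
    deformCoeff n m (fun i j => ζ i j t) r j * gradLam m (fun γ => d γ t) (e t)
      (truncLin (kindSign n m r) (n + 1 - j)) lam mu k) fun j hj => ?_).congr_deriv ?_)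
  · rw [Finset.mem_Icc] at hj
    by_cases hc : deformCoeff n m (fun i j => ζ i j t) r j = 0
    · simpa [hc] using hasDerivAt_const (lam k) (0 : ℝ)
    · exact (hasDerivAt_hB_lam hm hj.1 hj.2 (kind_of_deformCoeff_ne_zero hr'.1 hj.1 hc) _ _ mu h0
        hlam k).const_mul _
  · simp only [gradLam, deformOp_apply, deriv_deformOp _ _ _ (kindSign_domain hr'.2 (h0 k)),
      Finset.mul_sum, Finset.sum_mul, Finset.sum_div, ← Finset.sum_add_distrib,
      ← Finset.sum_sub_distrib]
    exact Finset.sum_congr rfl fun j _ => by ring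

/-! ### The Lax equation -/

theorem hasDerivAt_line_pderiv {F : Time n → ℝ} (r : Finset.Icc 1 n) {t : Time n}
    (hF : DifferentiableAt ℝ F t) :
    HasDerivAt (fun s : ℝ => F (t + s • (Pi.single r 1 : Time n))) (pderiv F r t) 0 := by
  have h1 : HasDerivAt (fun s => F (t + (s - t r) • (Pi.single r 1 : Time n)))
      (fderiv ℝ F t (Pi.single r 1)) (t r) := by
    have h2 : HasFDerivAt F (fderiv ℝ F t) (t + (t r - t r) • (Pi.single r 1 : Time n)) := by
      simpa using hF.hasFDerivAt
    refine h2.comp_hasDerivAt (t r) ?_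
    simpa using (((hasDerivAt_id' (t r)).sub_const (t r)).smul_const
      (Pi.single r 1 : Time n)).const_add t
  have h3 : pderiv F r t = fderiv ℝ F t (Pi.single r 1) := by
    rw [pderiv, ← h1.deriv]
    congr 1
    funext s
    congr 1
    ext j
    by_cases hj : j = r
    · subst hj; simp
    · simp [hj]
  have h4 : HasFDerivAt F (fderiv ℝ F t) (t + (0 : ℝ) • (Pi.single r 1 : Time n)) := by
    simpa using hF.hasFDerivAt
  rw [h3]
  refine h4.comp_hasDerivAt (0 : ℝ) ?_
  simpa using ((hasDerivAt_id' (0 : ℝ)).smul_const (Pi.single r 1 : Time n)).const_add t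

theorem LaxAt_apply (d : ℕ → Time n → ℝ) (e : Time n → ℝ) {lam : Fin n → ℝ} (mu : Fin n → ℝ)
    (t : Time n) (hlam : Function.Injective lam) (h0 : ∀ i, m = 0 ∨ lam i ≠ 0) (i j : Fin 2) {x : ℝ}
    (hx : x ≠ 0) :
    LaxAt n m d e x lam mu t i j = (laxEntry n m (fun γ => d γ t) (e t) lam mu i j).eval x := by
  rw [LaxAt, Matrix.map_apply, Lax_apply _ _ mu hlam h0, evalAt_toLaurent _ hx]

/-- The polynomial form of L requires distinct nodes, nonzero if m ≥ 1. These are open conditions,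
so the two forms have the same derivatives. -/
theorem eventually_LaxAt_eq {Y : Type*} [TopologicalSpace Y] (d : ℕ → Time n → ℝ) (e : Time n → ℝ)
    {l : Y → Fin n → ℝ} (p : Y → Fin n → ℝ) (τ : Y → Time n) {z : Y}
    (hl : ∀ i, ContinuousAt (fun y => l y i) z) (hlam : Function.Injective (l z))
    (h0 : ∀ i, m = 0 ∨ l z i ≠ 0) (i j : Fin 2) {x : ℝ} (hx : x ≠ 0) :
    (fun y => LaxAt n m d e x (l y) (p y) (τ y) i j) =ᶠ[𝓝 z]
      fun y => (laxEntry n m (fun γ => d γ (τ y)) (e (τ y)) (l y) (p y) i j).eval x := by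
  have h1 : ∀ᶠ y in 𝓝 z, ∀ i, m = 0 ∨ l y i ≠ 0 :=
    eventually_all.mpr fun i => (hl i).eventually (eventually_mem_domain (h0 i))
  filter_upwards [h1, eventually_injective hl hlam] with y hy hy'
  exact LaxAt_apply d e (p y) (τ y) hy' hy i j hx

theorem IsDeformation.differentiableAt_LaxAt (hdef : IsDeformation n m d e ζ) (hm : m ≤ n + 1)
    {l p : E → Fin n → ℝ} {τ : E → Time n} {z : E}
    (hl : ∀ i, DifferentiableAt ℝ (fun y => l y i) z)
    (hp : ∀ i, DifferentiableAt ℝ (fun y => p y i) z) (hτ : DifferentiableAt ℝ τ z)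
    (hinj : Function.Injective (l z)) (h0 : ∀ i, m = 0 ∨ l z i ≠ 0) (i j : Fin 2) {x : ℝ}
    (hx : x ≠ 0) : DifferentiableAt ℝ (fun y => LaxAt n m d e x (l y) (p y) (τ y) i j) z := by
  refine DifferentiableAt.congr_of_eventuallyEq ?_
    (eventually_LaxAt_eq d e p τ (fun i => (hl i).continuousAt) hinj h0 i j hx)
  exact CoeffDiff.eval (N := n + 2) (coeffDiff_laxEntry hm hl hp
    (fun γ hγ => (hdef.differentiableAt_d hγ (τ z)).comp z hτ)
    ((hdef.differentiableAt_e (τ z)).comp z hτ) hinj i j)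
    (Eventually.of_forall fun y => laxEntry_degree_lt hm _ _ _ _ i j) (differentiableAt_const x)

theorem hasDerivAt_UBarAt (hm : m ≤ n + 1) (d : ℕ → Time n → ℝ) (e : Time n → ℝ)
    (ζ : ℕ → ℕ → Time n → ℝ) {r : ℕ} (hr : r ∈ Finset.Icc 1 n) {lam : Fin n → ℝ} (mu : Fin n → ℝ)
    (t : Time n) (hlam : Function.Injective lam) (h0 : ∀ i, m = 0 ∨ lam i ≠ 0) (a b : Fin 2)
    {x : ℝ} (hx : x ≠ 0) :
    HasDerivAt (fun y => UBarAt n m d e ζ r y lam mu t a b)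
      (deriv (deformOp n m (fun i j => ζ i j t) r
        (laxEntry n m (fun γ => d γ t) (e t) lam mu a b)) x) x := by
  refine (((isLaxOp_deformOp hm _ hr).differentiableAt _ (Or.inr hx)).hasDerivAt.add_const
    (deformConst n m (fun i j => ζ i j t) r (uPoly lam)
      (laxEntry n m (fun γ => d γ t) (e t) lam mu a b))).congr_of_eventuallyEq ?_
  filter_upwards [eventually_ne_nhds hx] with y hy
  exact UBarAt_apply hm d e ζ hr mu t hlam h0 a b hy

/-- The derivative of the Lax matrix along the flow, with its polynomial entries. -/
theorem IsDeformation.exists_isLaxFlow_evolDeriv (hdef : IsDeformation n m d e ζ) (hm : m ≤ n + 1)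
    (r : Finset.Icc 1 n) (lam mu : Fin n → ℝ) (t : Time n) (hlam : Function.Injective lam)
    (h0 : ∀ i, m = 0 ∨ lam i ≠ 0) :
    ∃ φ' u' v' h' w' : ℝ[X],
      IsLaxFlow n m (if m = n + 1 ∧ (r : ℕ) = 1 then 1 else 0)
        (deformOp n m (fun i j => ζ i j t) r) (fun γ => d γ t) (e t) lam mu φ' u' v' h' w' ∧
      ∀ (i j : Fin 2) (x : ℝ), x ≠ 0 →
        evolDeriv (HB n m d e ζ r) (fun l p s => LaxAt n m d e x l p s i j) r lam mu t =
          ((!![v' - φ', u'; w', -(v' - φ')] : Matrix (Fin 2) (Fin 2) ℝ[X]) i j).eval x := by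
  -- The straight line through (λ, μ, t) with the velocity of the flow.
  obtain ⟨l, hl⟩ : ∃ l : ℝ → Fin n → ℝ, l = fun s : ℝ => lam + s •
      (fun i => pderiv (fun p => HB n m d e ζ r lam p t) i mu) := ⟨_, rfl⟩
  obtain ⟨p, hp⟩ : ∃ p : ℝ → Fin n → ℝ, p = fun s : ℝ => mu + s •
      (fun i => -pderiv (fun l => HB n m d e ζ r l mu t) i lam) := ⟨_, rfl⟩
  obtain ⟨τ, hτ⟩ : ∃ τ : ℝ → Time n, τ = fun s : ℝ => t + s • (Pi.single r 1 : Time n) := ⟨_, rfl⟩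
  have hl0 : l 0 = lam := by simp [hl]
  have hp0 : p 0 = mu := by simp [hp]
  have hτ0 : τ 0 = t := by simp [hτ]
  have hld : ∀ i, HasDerivAt (fun y => l y i)
      (gradMu m (fun γ => d γ t) (deformOp n m (fun i j => ζ i j t) r) lam mu i) 0 := by
    intro i
    rw [← pderiv_HB_mu (e := e) r.2 lam mu t h0 hlam i, hl]
    simpa using ((hasDerivAt_id' (0 : ℝ)).mul_const _).const_add (lam i)
  have hpd : ∀ i, HasDerivAt (fun y => p y i)
      (-gradLam m (fun γ => d γ t) (e t) (deformOp n m (fun i j => ζ i j t) r) lam mu i) 0 := by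
    intro i
    rw [← pderiv_HB_lam hm r.2 lam mu t h0 hlam i, hp]
    simpa using ((hasDerivAt_id' (0 : ℝ)).mul_const
      (-pderiv (fun l => HB n m d e ζ r l mu t) i lam)).const_add (mu i)
  have hdd : ∀ γ ≤ n + 1, HasDerivAt (fun y => d γ (τ y)) (pderiv (d γ) r t) 0 := by
    intro γ hγ
    rw [hτ]
    exact hasDerivAt_line_pderiv r (hdef.differentiableAt_d hγ t)
  have hed : HasDerivAt (fun y => e (τ y))
      ((if m = n + 1 ∧ (r : ℕ) = 1 then 1 else 0) * e t) 0 := by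
    have h1 := hasDerivAt_line_pderiv r (hdef.differentiableAt_e t)
    rw [hdef.pde_e] at h1
    rw [hτ]
    simpa using h1
  have hinj : Function.Injective (l 0) := by rwa [hl0]
  have key := exists_isLaxFlow (κ := if m = n + 1 ∧ (r : ℕ) = 1 then 1 else 0)
    (F := deformOp n m (fun i j => ζ i j t) r) hm (l := l) (p := p) (δ := fun s γ => d γ (τ s))
    (ε := fun s => e (τ s)) (δ' := fun γ => pderiv (d γ) r t) (s := 0)
  simp only [hl0, hp0, hτ0] at key
  obtain ⟨u', v', h', w', hflow, hu, hv, hφ, hw⟩ := key hld hpd hdd hed hlam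
    fun x hx => phi_evolution hdef hm r t hx
  refine ⟨_, u', v', h', w', hflow, fun i j x hx => ?_⟩
  have hG : DifferentiableAt ℝ (fun z : (Fin n → ℝ) × (Fin n → ℝ) × Time n =>
      LaxAt n m d e x z.1 z.2.1 z.2.2 i j) (lam, mu, t) :=
    hdef.differentiableAt_LaxAt hm (fun i => by fun_prop) (fun i => by fun_prop) (by fun_prop)
      hlam h0 i j hx
  have h1 := hasDerivAt_line_evolDeriv (HB n m d e ζ r) r lam mu t hG
  have h2 : HasDerivAt (fun s => LaxAt n m d e x (l s) (p s) (τ s) i j)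
      (evolDeriv (HB n m d e ζ r) (fun l p s => LaxAt n m d e x l p s i j) r lam mu t) 0 := by
    rw [hl, hp, hτ]
    exact h1
  have h3 : HasPolyDeriv (fun s => laxEntry n m (fun γ => d γ (τ s)) (e (τ s)) (l s) (p s) i j)
      ((!![v' - phiPoly n fun γ => pderiv (d γ) r t, u';
        w', -(v' - phiPoly n fun γ => pderiv (d γ) r t)] : Matrix (Fin 2) (Fin 2) ℝ[X]) i j) 0 := by
    have h4 := hv.sub hφ
    fin_cases i <;> fin_cases j
    · exact h4
    · exact hu
    · exact hw
    · exact h4.neg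
  have h5 := h3.eval (N := n + 2) (Eventually.of_forall fun y => laxEntry_degree_lt hm _ _ _ _ i j)
    (hasDerivAt_const (0 : ℝ) x)
  rw [mul_zero, add_zero] at h5
  exact h2.unique (h5.congr_of_eventuallyEq (eventually_LaxAt_eq d e p τ
    (fun i => (hld i).continuousAt) hinj (by rwa [hl0]) i j hx))

theorem IsDeformation.lax_equation (hdef : IsDeformation n m d e ζ) (hm : m ≤ n + 1)
    (r : Finset.Icc 1 n) (lam mu : Fin n → ℝ) (t : Time n) (hlam : Function.Injective lam)
    (h0 : ∀ i, m = 0 ∨ lam i ≠ 0) {x : ℝ} (hx : x ≠ 0) (i j : Fin 2) :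
    evolDeriv (HB n m d e ζ r) (fun l p s => LaxAt n m d e x l p s i j) r lam mu t =
      (UBarAt n m d e ζ r x lam mu t * LaxAt n m d e x lam mu t
        - LaxAt n m d e x lam mu t * UBarAt n m d e ζ r x lam mu t) i j
      + 2 * x ^ m * deriv (fun y : ℝ => UBarAt n m d e ζ r y lam mu t i j) x := by
  obtain ⟨φ', u', v', h', w', hflow, hev⟩ :=
    hdef.exists_isLaxFlow_evolDeriv hm r lam mu t hlam h0
  have hF := isLaxOp_deformOp hm (fun i j => ζ i j t) r.2
  rw [hev i j x hx, (hasDerivAt_UBarAt hm d e ζ r.2 mu t hlam h0 i j hx).deriv]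
  simp only [Matrix.sub_apply, Matrix.mul_apply, Fin.sum_univ_two,
    UBarAt_apply hm d e ζ r.2 mu t hlam h0 _ _ hx, LaxAt_apply d e mu t hlam h0 _ _ hx]
  have hxx : m = 0 ∨ x ≠ 0 := Or.inr hx
  have hR : ∀ a b, (deformRem n m (fun i j => ζ i j t) r (uPoly lam)
      (laxEntry n m (fun γ => d γ t) (e t) lam mu a b)).degree < n := fun a b =>
    deformRem_degree_lt _ r lam (laxEntry_degree_lt hm _ (e t) lam mu a b)
  have hU := fun (f : ℝ[X]) y (_ : m = 0 ∨ y ≠ 0) =>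
    deformOp_mul_eq (n := n) (m := m) (fun i j => ζ i j t) r (uPoly lam) f y
  have e1 := hflow.upper_right hF hlam h0 (hR 0 0) (hU _) hxx
  have e2 := hflow.diagonal hF hlam h0 (hR 1 0) (hU _) hxx
  have e3 := hflow.lower_left hF hm hlam h0 (hR 0 0) (hU _) (hR 1 0) (hU _) hxx
  have hd : deriv (-deformOp n m (fun i j => ζ i j t) r
      (vPoly m lam mu - phiPoly n fun γ => d γ t)) x =
      -deriv (deformOp n m (fun i j => ζ i j t) r (vPoly m lam mu - phiPoly n fun γ => d γ t)) x :=
    deriv.neg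
  clear hev hU hR
  -- L and Ū are traceless, the additive constants included, and the constant attached to u is 0; so
  -- three scalar equations give all four entries.
  fin_cases i <;> fin_cases j <;>
    simp only [laxEntry, Matrix.of_apply, Matrix.cons_val', Matrix.cons_val_zero,
      Matrix.cons_val_one, Matrix.cons_val_fin_one, Fin.zero_eta, Fin.mk_one, Fin.isValue,
      deformConst_self, deformConst_neg, hd, map_neg, Pi.neg_apply, eval_neg, eval_sub] at e1 e2 e3 ⊢
  · linear_combination e2
  · linear_combination e1
  · linear_combination e3
  · linear_combination -e2

end

end

end PainleveLax

end

theorem theorem3 (n m : ℕ) (hm : m ≤ n + 1)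
    (d : ℕ → PainleveLax.Time n → ℝ) (e : PainleveLax.Time n → ℝ)
    (ζ : ℕ → ℕ → PainleveLax.Time n → ℝ) (hdef : PainleveLax.IsDeformation n m d e ζ)
    (r : Finset.Icc 1 n) (lam mu : Fin n → ℝ) (t : PainleveLax.Time n)
    (hlam : Function.Injective lam) (hlam0 : m ≠ 0 → ∀ i, lam i ≠ 0)
    (x : ℝ) (hx : x ≠ 0) :
    DifferentiableAt ℝ
      (fun z : (Fin n → ℝ) × (Fin n → ℝ) × PainleveLax.Time n =>
        PainleveLax.HB n m d e ζ r z.1 z.2.1 z.2.2) (lam, mu, t) ∧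
    ∀ i j : Fin 2,
      DifferentiableAt ℝ
        (fun z : (Fin n → ℝ) × (Fin n → ℝ) × PainleveLax.Time n =>
          PainleveLax.LaxAt n m d e x z.1 z.2.1 z.2.2 i j) (lam, mu, t) ∧
      DifferentiableAt ℝ (fun y : ℝ => PainleveLax.UBarAt n m d e ζ r y lam mu t i j) x ∧
      PainleveLax.evolDeriv (PainleveLax.HB n m d e ζ r)
          (fun l p s => PainleveLax.LaxAt n m d e x l p s i j) r lam mu t =
        (PainleveLax.UBarAt n m d e ζ r x lam mu t * PainleveLax.LaxAt n m d e x lam mu t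
          - PainleveLax.LaxAt n m d e x lam mu t * PainleveLax.UBarAt n m d e ζ r x lam mu t) i j
        + 2 * x ^ m * deriv (fun y : ℝ => PainleveLax.UBarAt n m d e ζ r y lam mu t i j) x := by
  have h0 : ∀ i, m = 0 ∨ lam i ≠ 0 := fun i => or_iff_not_imp_left.mpr fun h => hlam0 h i
  refine ⟨hdef.differentiableAt_HB r (fun i => by fun_prop) (fun i => by fun_prop) (by fun_prop)
    hlam, fun i j => ⟨?_, ?_, hdef.lax_equation hm r lam mu t hlam h0 hx i j⟩⟩
  · exact hdef.differentiableAt_LaxAt hm (fun i => by fun_prop) (fun i => by fun_prop) (by fun_prop)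
      hlam h0 i j hx
  · exact (PainleveLax.hasDerivAt_UBarAt hm d e ζ r.2 mu t hlam h0 i j hx).differentiableAt
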